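/- Let $a>0$ be real and let ${}_1F_1(a;b;z)=\sum_{k\ge 0}\frac{(a)_k}{(b)_k}\frac{z^k}{k!}$ be the confluent hypergeometric function, where $(a)_k=a(a+1)\cdots(a+k-1)$. Write $\xi=x+iy$ and put $$\mathcal A=\{\xi\in\mathbb C:\ x<1\ \text{ or }\ x-1-\tfrac12\log(x^2+y^2)<0\},\qquad \mathcal B=\{\xi\in\mathbb C:\ x>1\ \text{ and }\ x-1-\tfrac12\log(x^2+y^2)>0\},$$ the regions to the left and to the right of the curve $\mathcal S_+=\{x\ge 1,\ x-1-\tfrac12\log(x^2+y^2)=0\}$. As $b\to+\infty$ through real values, with $a$ fixed: (a) Uniformly for $\xi$ in compact subsets of $\mathcal A$, $${}_1F_1(a;b;b\xi)=(1-\xi)^{-a}\Bigl\{1-\frac{a(a+1)}{2}\Bigl(\frac{\xi}{1-\xi}\Bigr)^2 b^{-1} +\Bigl[\frac{a(a+1)(a+2)(a+3)}{8}\Bigl(\frac{\xi}{1-\xi}\Bigr)^4+\frac{2a(a+1)(a+2)}{3}\Bigl(\frac{\xi}{1-\xi}\Bigr)^3+\frac{a(a+1)}{2}\Bigl(\frac{\xi}{1-\xi}\Bigr)^2\Bigr]b^{-2}+O(b^{-3})\Bigr\},$$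 where $(1-\xi)^{-a}$ is the principal branch. (b) Uniformly for $\xi$ in compact subsets of $\mathcal B$, $${}_1F_1(a;b;b\xi)=e^{b(\xi-1-\log\xi)}\,b^{a-\frac12}\,\frac{\sqrt{2\pi}}{\Gamma(a)}\,\xi(\xi-1)^{a-1}\Bigl[1+\frac1{12b}\Bigl(1+\frac{12a(a-1)}{\xi-1}+\frac{6(a-1)(a-2)}{(\xi-1)^2}\Bigr)+O(b^{-2})\Bigr],$$ where $\log\xi$ and $(\xi-1)^{a-1}$ are the principal branches. The constants implied by the $O$-terms, and how large $b$ must be, may depend on $a$ and on the compact set. -/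

import Mathlib

noncomputable section

/-- The `k`-th term `(a)_k / (b)_k * z ^ k / k!` of Kummer's confluent hypergeometric series, where
`(a)_k = a (a + 1) ⋯ (a + k - 1)` is the rising factorial. -/
def confluentTerm (a b z : ℂ) (k : ℕ) : ℂ :=
  (ascPochhammer ℂ k).eval a / (ascPochhammer ℂ k).eval b * (z ^ k / (k.factorial : ℂ))

/-- The confluent hypergeometric function `₁F₁(a; b; z) = ∑ k, (a)_k / (b)_k * z ^ k / k!`
(meaningful when `b` is not a non-positive integer). -/
def confluentHypergeometric (a b z : ℂ) : ℂ :=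
  ∑' k : ℕ, confluentTerm a b z k

/-- The region `𝒜`: the points `ξ = x + i y` such that `x < 1` or
`x - 1 - (1/2) log (x² + y²) < 0`. -/
def regionA : Set ℂ :=
  {ξ : ℂ | ξ.re < 1 ∨ ξ.re - 1 - 1 / 2 * Real.log (ξ.re ^ 2 + ξ.im ^ 2) < 0}

/-- The region `ℬ`: the points `ξ = x + i y` such that `x > 1` and
`x - 1 - (1/2) log (x² + y²) > 0`. -/
def regionB : Set ℂ :=
  {ξ : ℂ | 1 < ξ.re ∧ 0 < ξ.re - 1 - 1 / 2 * Real.log (ξ.re ^ 2 + ξ.im ^ 2)}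

/-- The series defining `₁F₁(a; b; z)` converges for every `z` when `b` is not a non-positive
integer. -/
theorem summable_confluentTerm (a b z : ℂ) (hb : ∀ k : ℕ, b ≠ -(k : ℂ)) :
    Summable (confluentTerm a b z) := by
  have hterm : ∀ k : ℕ, confluentTerm a b z k =
      Complex.Gamma b * (Complex.regularizedHGFunCoeff {a} {b} k * z ^ k) := by
    intro k
    have hG : Complex.Gamma b ≠ 0 := Complex.Gamma_ne_zero hb
    have h := Complex.Gamma_add_nat_div_Gamma_eq (n := k) b hb
    have hk : Complex.Gamma (b + k) ≠ 0 := by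
      apply Complex.Gamma_ne_zero
      intro m hm
      apply hb (m + k)
      push_cast
      linear_combination hm
    unfold confluentTerm Complex.regularizedHGFunCoeff
    simp only [Multiset.map_singleton, Multiset.prod_singleton]
    rw [← h]
    field_simp
  have hr : (Complex.regularizedHGFunSeries {a} {b}).radius = ⊤ :=
    Complex.radius_regularizedHGFunSeries_eq_top (by simp)
  have hs := (Complex.regularizedHGFunSeries {a} {b}).summable (x := z) (by simp [hr])
  have hs2 : Summable fun k : ℕ => Complex.regularizedHGFunCoeff {a} {b} k * z ^ k := by
    refine hs.congr fun k => ?_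
    simp [Complex.regularizedHGFunSeries, FormalMultilinearSeries.ofScalars, mul_comm]
  exact (hs2.mul_left (Complex.Gamma b)).congr fun k => (hterm k).symm

end

open MeasureTheory Set Filter Topology ComplexConjugate

/-! Both expansions come from Laplace's method with saddle point 1, applied to two different
integral representations of `₁F₁(a; b; b ξ)`.

Region `𝒜`. Euler's integral is a convolution, so Fourier inversion turns it into an inverse Laplace
transform (`confluentHypergeometric_eq_integral_vertical`): up to normalisation, `₁F₁(a; b; b ξ)` is
the mean of `(1 - ξ / u) ^ (-a)` against `exp (b u) u ^ (-b)` on a line `re u = c`. The saddle is `u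
= 1`. The moments of `1 / u` under this complex weight are exactly `b ^ k / (b)_k`, so expanding in
powers of `1 / u - 1` gives closed-form terms, and the error is the mean of the Taylor remainder.
The polynomial has degree 5 because its fifth moment is `O(b⁻³)`, whereas stopping at degree 4 would
leave a fifth absolute moment of order only `b ^ (-5/2)`. The sixth absolute moment on `re u = 1` is
`O(b⁻³)`.

If `re ξ < 1`, the line `re u = 1` passes to the right of `ξ` and nothing else is needed. If `re ξ ≥
1` and `im ξ > 0`, the path follows `re u = 1` up to a height `η < im ξ`, turns right below `ξ`, and
goes up again along `re u = c`. The condition `exp (re ξ - 1) < |ξ|` makes `|exp (u - 1) / u| ≤ q <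
1` on the last two pieces, so they are exponentially small (`norm_verticalMean_shift_le`). The case
`im ξ < 0` follows by conjugation, and `𝒜` contains no real `ξ ≥ 1`.

Region `ℬ`. Reflected, Euler's integral becomes that of `exp (-b σ) σ ^ (b - a - 1) (ξ - σ) ^ (a -
1)` from 0 to `ξ`. For `1 < X < re ξ` it equals the integral over `[0, X]` plus one over the segment
from `X` to `ξ`; this is clear for real `ξ` and extends by the identity theorem
(`innerPart_add_tailPart`). The weight is a Gamma law of shape `b - a` and rate `b`, concentrated at
1: a cubic Taylor polynomial of `(ξ - σ) ^ (a - 1)` has explicit moments, and the fourth moment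
bounds the remainder by `O(b⁻²)` (`exists_innerPart_sub_le`). The segment is negligible because `log
|ξ| < re ξ - 1`. The factor `1 + 1 / (12 b)` comes from Stirling's formula for `Γ(b)`, the only
place where an asymptotic form of `Γ` enters the expansion itself.

All estimates are local in `ξ` with explicit thresholds for `b`, and compactness makes them uniform.
-/

/-! ### Holomorphic parameter integrals and the Laplace transform of a power. -/

/-- An integral depending on a complex parameter is holomorphic when the integrand is holomorphic in
the parameter and locally dominated. -/
theorem differentiableOn_integral_of_locally_dominated {α : Type*} [MeasurableSpace α]
    {μ : Measure α} {U : Set ℂ} (hU : IsOpen U) {k : ℂ → α → ℂ}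
    (hmeas : ∀ z ∈ U, AEStronglyMeasurable (k z) μ)
    (hdiff : ∀ᵐ t ∂μ, DifferentiableOn ℂ (fun z => k z t) U)
    (hbound : ∀ z ∈ U, ∃ r > 0, ∃ g : α → ℝ, Integrable g μ ∧
      ∀ᵐ t ∂μ, ∀ w ∈ Metric.ball z r, ‖k w t‖ ≤ g t) :
    DifferentiableOn ℂ (fun z => ∫ t, k z t ∂μ) U := by
  intro z hz
  obtain ⟨r₁, hr₁, g, hg, hkg⟩ := hbound z hz
  obtain ⟨r₂, hr₂, hball⟩ := Metric.isOpen_iff.1 hU z hz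
  set r := min r₁ r₂ with hrdef
  have hr : 0 < r := lt_min hr₁ hr₂
  have hsub : ∀ x ∈ Metric.ball z (r / 2), ∀ y, dist y x ≤ r / 4 → y ∈ Metric.ball z r := by
    intro x hx y hy
    rw [Metric.mem_ball] at hx ⊢
    linarith [dist_triangle y x z]
  have hU' : Metric.ball z r ⊆ U := (Metric.ball_subset_ball (min_le_right _ _)).trans hball
  have hz2 : z ∈ Metric.ball z (r / 2) := Metric.mem_ball_self (by positivity)
  have hder : ∀ᵐ t ∂μ, ∀ x ∈ Metric.ball z (r / 2),
      HasDerivAt (fun w => k w t) (deriv (fun w => k w t) x) x := by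
    filter_upwards [hdiff] with t ht x hx
    refine (ht.differentiableAt (hU.mem_nhds (hU' ?_))).hasDerivAt
    exact Metric.ball_subset_ball (by linarith) hx
  -- The derivative at `z` is an almost everywhere limit of difference quotients with increments `1
  -- / (n + 1)`, which gives its measurability in `t`; the shift by `N` keeps the sample points in
  -- `U`.
  have hmeas' : AEStronglyMeasurable (fun t => deriv (fun w => k w t) z) μ := by
    set h : ℕ → ℂ := fun n => ((1 / ((n : ℝ) + 1) : ℝ) : ℂ) with hh
    have hlim : Tendsto h atTop (𝓝[≠] 0) := by
      refine tendsto_nhdsWithin_iff.2 ⟨?_, Eventually.of_forall fun n => ?_⟩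
      · have := (Complex.continuous_ofReal.tendsto 0).comp
          (tendsto_one_div_add_atTop_nhds_zero_nat (𝕜 := ℝ))
        simpa [hh, Function.comp_def] using this
      · simp only [hh, mem_compl_iff, mem_singleton_iff, Complex.ofReal_eq_zero]
        positivity
    have hev : ∀ᶠ n in atTop, z + h n ∈ U := by
      have : Tendsto (fun n => z + h n) atTop (𝓝 z) := by
        simpa using (tendsto_nhds_of_tendsto_nhdsWithin hlim).const_add z
      exact this.eventually (hU.mem_nhds hz)
    obtain ⟨N, hN⟩ := eventually_atTop.1 hev
    refine aestronglyMeasurable_of_tendsto_ae atTop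
      (f := fun n t => (h (n + N))⁻¹ * (k (z + h (n + N)) t - k z t)) (fun n => ?_) ?_
    · exact ((hmeas _ (hN _ (by omega))).sub (hmeas z hz)).const_mul _
    · filter_upwards [hder] with t ht
      have := (hasDerivAt_iff_tendsto_slope_zero.1 (ht z hz2)).comp
        (hlim.comp (tendsto_add_atTop_nat N))
      simpa [Function.comp_def] using this
  -- Cauchy's estimate on circles of radius `r / 4` about points of the ball of radius `r / 2`
  -- bounds the derivative by `g / (r / 4)`.
  have key := hasDerivAt_integral_of_dominated_loc_of_deriv_le (μ := μ) (𝕜 := ℂ) (F := k)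
    (F' := fun x t => deriv (fun w => k w t) x) (x₀ := z) (s := Metric.ball z (r / 2))
    (bound := fun t => g t / (r / 4)) (Metric.ball_mem_nhds _ (by positivity))
    (by filter_upwards [hU.mem_nhds hz] with w hw using hmeas w hw)
    (by
      refine hg.mono' (hmeas z hz) ?_
      filter_upwards [hkg] with t ht using ht z (Metric.mem_ball_self hr₁))
    hmeas'
    (by
      filter_upwards [hkg, hdiff] with t ht htd x hx
      refine Complex.norm_deriv_le_of_forall_mem_sphere_norm_le (by positivity) ?_ ?_
      · refine (htd.mono fun y hy => ?_).diffContOnCl_ball (U := U) ?_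
        · exact hy
        · intro y hy
          exact hU' (hsub x hx y (Metric.mem_closedBall.1 hy))
      · intro y hy
        exact ht y (Metric.ball_subset_ball (min_le_left _ _)
          (hsub x hx y (le_of_eq (Metric.mem_sphere.1 hy)))))
    (hg.div_const _) hder
  exact key.2.differentiableAt.differentiableWithinAt

theorem integrableOn_rpow_mul_exp_neg_mul {s r : ℝ} (hs : 0 < s) (hr : 0 < r) :
    IntegrableOn (fun t : ℝ => t ^ (s - 1) * Real.exp (-(r * t))) (Ioi 0) := by
  have := integrableOn_rpow_mul_exp_neg_mul_rpow (s := s - 1) (p := 1) (b := r) (by linarith)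
    one_pos hr
  simpa using this

theorem norm_rpow_mul_exp_neg_mul (s : ℝ) (r : ℂ) {t : ℝ} (ht : 0 < t) :
    ‖((t ^ (s - 1) : ℝ) : ℂ) * Complex.exp (-(r * t))‖ = t ^ (s - 1) * Real.exp (-(r.re * t)) := by
  rw [norm_mul, Complex.norm_exp, Complex.norm_real, Real.norm_of_nonneg (by positivity)]
  simp

theorem measurable_rpow_mul_cexp (s : ℝ) (r : ℂ) :
    Measurable fun t : ℝ => ((t ^ (s - 1) : ℝ) : ℂ) * Complex.exp (-(r * t)) := by
  fun_prop

theorem integrableOn_rpow_mul_cexp_neg_mul {s : ℝ} {r : ℂ} (hs : 0 < s) (hr : 0 < r.re) :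
    IntegrableOn (fun t : ℝ => ((t ^ (s - 1) : ℝ) : ℂ) * Complex.exp (-(r * t))) (Ioi 0) := by
  refine (integrableOn_rpow_mul_exp_neg_mul hs hr).mono'
    (measurable_rpow_mul_cexp s r).aestronglyMeasurable ?_
  filter_upwards [ae_restrict_mem measurableSet_Ioi] with t ht
  exact (norm_rpow_mul_exp_neg_mul s r ht).le

/-- The Laplace transform of `t ^ (s - 1)` on the right half plane. -/
theorem integral_rpow_mul_cexp_neg_mul_Ioi {s : ℝ} {r : ℂ} (hs : 0 < s) (hr : 0 < r.re) :
    ∫ t : ℝ in Ioi 0, ((t ^ (s - 1) : ℝ) : ℂ) * Complex.exp (-(r * t)) =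
      r ^ (-(s : ℂ)) * (Real.Gamma s : ℂ) := by
  set U : Set ℂ := {z | 0 < z.re} with hUdef
  have hU : IsOpen U := isOpen_lt continuous_const Complex.continuous_re
  have hL : DifferentiableOn ℂ (fun z : ℂ => ∫ t : ℝ in Ioi 0,
      ((t ^ (s - 1) : ℝ) : ℂ) * Complex.exp (-(z * t))) U := by
    refine differentiableOn_integral_of_locally_dominated hU
      (fun z _ => (measurable_rpow_mul_cexp s z).aestronglyMeasurable)
      (Eventually.of_forall fun t => by fun_prop) fun z hz => ?_
    have hz' : 0 < z.re := hz
    refine ⟨z.re / 2, by positivity, _, integrableOn_rpow_mul_exp_neg_mul hs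
      (r := z.re / 2) (by positivity), ?_⟩
    filter_upwards [ae_restrict_mem measurableSet_Ioi] with t ht w hw
    have ht' : 0 < t := ht
    rw [norm_rpow_mul_exp_neg_mul s w ht]
    have : z.re / 2 ≤ w.re := by
      have h1 := (Complex.abs_re_le_norm (w - z)).trans (mem_ball_iff_norm.1 hw).le
      rw [Complex.sub_re] at h1
      linarith [(abs_le.1 h1).1]
    gcongr
  have hR : DifferentiableOn ℂ (fun z : ℂ => z ^ (-(s : ℂ)) * (Real.Gamma s : ℂ)) U := by
    intro z hz
    refine DifferentiableAt.differentiableWithinAt ?_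
    refine DifferentiableAt.mul_const (DifferentiableAt.cpow_const ?_ ?_) _
    · exact differentiableAt_id
    · exact Or.inl hz
  have hconv : Convex ℝ U := convex_halfSpace_re_gt 0
  -- Identity theorem: the two sides are holomorphic on the half plane and agree at the real points
  -- `1 + 1 / (n + 1)`, which accumulate at 1.
  refine (hL.analyticOnNhd hU).eqOn_of_preconnected_of_frequently_eq (hR.analyticOnNhd hU)
    hconv.isPreconnected (z₀ := 1) (by simp [hUdef]) ?_ hr
  have hreal : ∀ x : ℝ, 0 < x → (∫ t : ℝ in Ioi 0,
      ((t ^ (s - 1) : ℝ) : ℂ) * Complex.exp (-((x : ℂ) * t))) =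
        (x : ℂ) ^ (-(s : ℂ)) * (Real.Gamma s : ℂ) := by
    intro x hx
    have h := Real.integral_rpow_mul_exp_neg_mul_Ioi hs hx
    have h2 := congrArg (fun y : ℝ => (y : ℂ)) h
    rw [← integral_complex_ofReal] at h2
    rw [show ((x : ℂ) ^ (-(s : ℂ)) * (Real.Gamma s : ℂ)) =
      (((1 / x) ^ s * Real.Gamma s : ℝ) : ℂ) by
        rw [one_div, Real.inv_rpow hx.le, ← Real.rpow_neg hx.le]
        push_cast [Complex.ofReal_cpow hx.le]; rfl, ← h2]
    push_cast
    rfl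
  have hlim : Tendsto (fun n : ℕ => ((1 + 1 / ((n : ℝ) + 1) : ℝ) : ℂ)) atTop (𝓝[≠] 1) := by
    refine tendsto_nhdsWithin_iff.2 ⟨?_, Eventually.of_forall fun n => ?_⟩
    · have := (Complex.continuous_ofReal.tendsto (1 + 0)).comp
        ((tendsto_one_div_add_atTop_nhds_zero_nat (𝕜 := ℝ)).const_add 1)
      simpa [Function.comp_def] using this
    · simp only [mem_compl_iff, mem_singleton_iff]
      rw [← Complex.ofReal_one, Complex.ofReal_inj]
      have : (0 : ℝ) < 1 / ((n : ℝ) + 1) := by positivity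
      linarith
  refine hlim.frequently (Frequently.of_forall fun n => ?_)
  exact hreal _ (by positivity)

/-! ### Euler's integral for `₁F₁`. -/

theorem betaIntegral_ofReal_integrand (u v : ℝ) {x : ℝ} (hx : x ∈ Icc (0 : ℝ) 1) :
    ((x ^ (u - 1) * (1 - x) ^ (v - 1) : ℝ) : ℂ) =
      (x : ℂ) ^ ((u : ℂ) - 1) * (1 - (x : ℂ)) ^ ((v : ℂ) - 1) := by
  rw [Complex.ofReal_mul, Complex.ofReal_cpow hx.1, Complex.ofReal_cpow (sub_nonneg.2 hx.2)]
  push_cast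
  rfl

theorem intervalIntegrable_beta {u v : ℝ} (hu : 0 < u) (hv : 0 < v) :
    IntervalIntegrable (fun x : ℝ => x ^ (u - 1) * (1 - x) ^ (v - 1)) volume 0 1 := by
  have h := (Complex.betaIntegral_convergent (u := u) (v := v) (by simpa) (by simpa)).norm
  refine h.congr fun x hx => ?_
  rw [uIoc_of_le zero_le_one] at hx
  have hx' : x ∈ Icc (0 : ℝ) 1 := ⟨hx.1.le, hx.2⟩
  have hnn : 0 ≤ x ^ (u - 1) * (1 - x) ^ (v - 1) :=
    mul_nonneg (Real.rpow_nonneg hx'.1 _) (Real.rpow_nonneg (sub_nonneg.2 hx'.2) _)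
  rw [← betaIntegral_ofReal_integrand u v hx', Complex.norm_real, Real.norm_of_nonneg hnn]

theorem integral_beta {u v : ℝ} (hu : 0 < u) (hv : 0 < v) :
    ∫ x : ℝ in 0..1, ((x ^ (u - 1) * (1 - x) ^ (v - 1) : ℝ) : ℂ) =
      Complex.Gamma u * Complex.Gamma v / Complex.Gamma ((u : ℂ) + v) := by
  rw [← Complex.betaIntegral_eq_Gamma_mul_div _ _ (by simpa) (by simpa), Complex.betaIntegral]
  refine intervalIntegral.integral_congr fun x hx => ?_
  rw [uIcc_of_le zero_le_one] at hx
  exact betaIntegral_ofReal_integrand u v hx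

/-- Euler's integral for the confluent hypergeometric function. -/
theorem integral_beta_mul_cexp {a b : ℝ} (ha : 0 < a) (hab : a < b) (z : ℂ) :
    ∫ x : ℝ in 0..1, ((x ^ (a - 1) * (1 - x) ^ (b - a - 1) : ℝ) : ℂ) * Complex.exp (z * x) =
      (Real.Gamma a : ℂ) * (Real.Gamma (b - a) : ℂ) / (Real.Gamma b : ℂ) *
        confluentHypergeometric a b z := by
  have hb : 0 < b := ha.trans hab
  have hba : 0 < b - a := sub_pos.2 hab
  have hbeta := intervalIntegrable_beta ha hba
  have hterm : ∀ k : ℕ, ∫ x : ℝ in 0..1, ((x ^ (a - 1) * (1 - x) ^ (b - a - 1) : ℝ) : ℂ) *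
      ((z * x) ^ k / (k.factorial : ℂ)) =
      (Real.Gamma a : ℂ) * (Real.Gamma (b - a) : ℂ) / (Real.Gamma b : ℂ) *
        confluentTerm a b z k := by
    intro k
    have hak : 0 < a + k := by positivity
    have h1 : ∫ x : ℝ in 0..1, ((x ^ (a - 1) * (1 - x) ^ (b - a - 1) : ℝ) : ℂ) *
        ((z * x) ^ k / (k.factorial : ℂ)) = z ^ k / (k.factorial : ℂ) *
        ∫ x : ℝ in 0..1, ((x ^ (a + k - 1) * (1 - x) ^ (b - a - 1) : ℝ) : ℂ) := by
      rw [← intervalIntegral.integral_const_mul]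
      refine intervalIntegral.integral_congr_ae (Eventually.of_forall fun x hx => ?_)
      rw [uIoc_of_le zero_le_one] at hx
      rw [show a + k - 1 = a - 1 + k by ring, Real.rpow_add hx.1, Real.rpow_natCast]
      push_cast
      ring
    rw [h1, integral_beta hak hba]
    have hA := Complex.Gamma_add_nat_div_Gamma_eq (n := k) (a : ℂ) (fun m hm => by
      have : a = -(m : ℝ) := by exact_mod_cast hm
      linarith [(Nat.cast_nonneg m : (0 : ℝ) ≤ m)])
    have hB := Complex.Gamma_add_nat_div_Gamma_eq (n := k) (b : ℂ) (fun m hm => by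
      have : b = -(m : ℝ) := by exact_mod_cast hm
      linarith [(Nat.cast_nonneg m : (0 : ℝ) ≤ m)])
    have hGa : Complex.Gamma a ≠ 0 := Complex.Gamma_ne_zero_of_re_pos (by simpa)
    have hGb : Complex.Gamma b ≠ 0 := Complex.Gamma_ne_zero_of_re_pos (by simpa)
    have hGbk : Complex.Gamma (b + k) ≠ 0 :=
      Complex.Gamma_ne_zero_of_re_pos (by simpa using by positivity)
    rw [confluentTerm, ← hA, ← hB, ← Complex.Gamma_ofReal, ← Complex.Gamma_ofReal,
      ← Complex.Gamma_ofReal]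
    push_cast
    rw [show (a : ℂ) + k + (b - a) = b + k by ring]
    field_simp
  have hsum : HasSum (fun k : ℕ => ∫ x : ℝ in 0..1,
      ((x ^ (a - 1) * (1 - x) ^ (b - a - 1) : ℝ) : ℂ) * ((z * x) ^ k / (k.factorial : ℂ)))
      (∫ x : ℝ in 0..1, ((x ^ (a - 1) * (1 - x) ^ (b - a - 1) : ℝ) : ℂ) *
        Complex.exp (z * x)) := by
    refine intervalIntegral.hasSum_integral_of_dominated_convergence
      (fun k x => x ^ (a - 1) * (1 - x) ^ (b - a - 1) * (‖z‖ ^ k / k.factorial)) (fun k => ?_)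
      (fun k => Eventually.of_forall fun x hx => ?_) (Eventually.of_forall fun x _ => ?_) ?_
      (Eventually.of_forall fun x _ => ?_)
    · refine Measurable.aestronglyMeasurable ?_
      fun_prop
    · rw [uIoc_of_le zero_le_one] at hx
      have hnn : 0 ≤ x ^ (a - 1) * (1 - x) ^ (b - a - 1) :=
        mul_nonneg (Real.rpow_nonneg hx.1.le _) (Real.rpow_nonneg (sub_nonneg.2 hx.2) _)
      rw [norm_mul, Complex.norm_real, Real.norm_of_nonneg hnn, norm_div, norm_pow, norm_mul,
        Complex.norm_real, Real.norm_of_nonneg hx.1.le, Complex.norm_natCast]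
      have hx0 : 0 ≤ x := hx.1.le
      refine mul_le_mul_of_nonneg_left ?_ hnn
      gcongr
      exact mul_le_of_le_one_right (norm_nonneg z) hx.2
    · exact (Real.summable_pow_div_factorial ‖z‖).mul_left _
    · simp_rw [tsum_mul_left]
      exact hbeta.mul_const _
    · refine HasSum.mul_left _ ?_
      rw [Complex.exp_eq_exp_ℂ]
      exact NormedSpace.expSeries_div_hasSum_exp (z * x)
  rw [← hsum.tsum_eq, confluentHypergeometric, ← tsum_mul_left]
  exact tsum_congr hterm

/-- Euler's integral over `[0, t]`. -/
theorem integral_beta_mul_cexp_scaled {a b : ℝ} (ha : 0 < a) (hab : a < b) {t : ℝ} (ht : 0 < t)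
    (z : ℂ) :
    ∫ s : ℝ in 0..t, ((s ^ (a - 1) * (t - s) ^ (b - a - 1) : ℝ) : ℂ) * Complex.exp (z * s) =
      ((t ^ (b - 1) : ℝ) : ℂ) * ((Real.Gamma a : ℂ) * (Real.Gamma (b - a) : ℂ) /
        (Real.Gamma b : ℂ) * confluentHypergeometric a b (t * z)) := by
  rw [← integral_beta_mul_cexp ha hab]
  have h := intervalIntegral.smul_integral_comp_mul_left (a := 0) (b := 1) (fun s : ℝ =>
    ((s ^ (a - 1) * (t - s) ^ (b - a - 1) : ℝ) : ℂ) * Complex.exp (z * s)) t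
  rw [mul_zero, mul_one] at h
  rw [← h, Complex.real_smul, ← intervalIntegral.integral_const_mul,
    ← intervalIntegral.integral_const_mul]
  refine intervalIntegral.integral_congr fun x hx => ?_
  rw [uIcc_of_le zero_le_one] at hx
  have e1 : t - t * x = t * (1 - x) := by ring
  have e2 : t ^ (b - 1) = t * (t ^ (a - 1) * t ^ (b - a - 1)) := by
    rw [show b - 1 = 1 + ((a - 1) + (b - a - 1)) by ring, Real.rpow_add ht, Real.rpow_add ht,
      Real.rpow_one]
  rw [e1, Real.mul_rpow ht.le hx.1, Real.mul_rpow ht.le (sub_nonneg.2 hx.2), e2]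
  push_cast
  rw [show z * ((t : ℂ) * x) = t * z * x by ring]
  ring

/-- Euler's integral is entire in `z`, being dominated on each unit ball, and its beta prefactor
does not vanish. -/
theorem differentiable_confluentHypergeometric {a b : ℝ} (ha : 0 < a) (hab : a < b) :
    Differentiable ℂ fun z : ℂ => confluentHypergeometric a b z := by
  have hb : 0 < b := ha.trans hab
  have hba : 0 < b - a := sub_pos.2 hab
  have hbeta := (intervalIntegrable_iff_integrableOn_Ioc_of_le zero_le_one).1
    (intervalIntegrable_beta ha hba)
  have hI : DifferentiableOn ℂ (fun z : ℂ => ∫ x : ℝ in Ioc 0 1,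
      ((x ^ (a - 1) * (1 - x) ^ (b - a - 1) : ℝ) : ℂ) * Complex.exp (z * x)) univ := by
    refine differentiableOn_integral_of_locally_dominated isOpen_univ (fun z _ => ?_)
      (Eventually.of_forall fun t => by fun_prop) fun z _ => ?_
    · refine Measurable.aestronglyMeasurable ?_
      fun_prop
    · refine ⟨1, one_pos, _, hbeta.mul_const (Real.exp (‖z‖ + 1)), ?_⟩
      filter_upwards [ae_restrict_mem measurableSet_Ioc] with x hx w hw
      have hnn : 0 ≤ x ^ (a - 1) * (1 - x) ^ (b - a - 1) :=
        mul_nonneg (Real.rpow_nonneg hx.1.le _) (Real.rpow_nonneg (sub_nonneg.2 hx.2) _)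
      rw [norm_mul, Complex.norm_real, Real.norm_of_nonneg hnn, Complex.norm_exp]
      refine mul_le_mul_of_nonneg_left (Real.exp_le_exp.2 ?_) hnn
      have h1 : (w * x).re ≤ ‖w * x‖ := Complex.re_le_norm _
      have h2 : ‖w * x‖ ≤ ‖w‖ := by
        rw [norm_mul, Complex.norm_real, Real.norm_of_nonneg hx.1.le]
        exact mul_le_of_le_one_right (norm_nonneg w) hx.2
      have h3 : ‖w‖ ≤ ‖z‖ + 1 := by
        have := norm_le_norm_add_norm_sub' w z
        linarith [mem_ball_iff_norm.1 hw]
      linarith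
  have hG : (Real.Gamma a : ℂ) * (Real.Gamma (b - a) : ℂ) / (Real.Gamma b : ℂ) ≠ 0 := by
    have h1 := (Real.Gamma_pos_of_pos ha).ne'
    have h2 := (Real.Gamma_pos_of_pos hb).ne'
    have h3 := (Real.Gamma_pos_of_pos hba).ne'
    norm_cast
    positivity
  have hEq : (fun z : ℂ => confluentHypergeometric a b z) = fun z : ℂ =>
      ((Real.Gamma a : ℂ) * (Real.Gamma (b - a) : ℂ) / (Real.Gamma b : ℂ))⁻¹ * ∫ x : ℝ in Ioc 0 1,
      ((x ^ (a - 1) * (1 - x) ^ (b - a - 1) : ℝ) : ℂ) * Complex.exp (z * x) := by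
    funext z
    rw [← intervalIntegral.integral_of_le zero_le_one, integral_beta_mul_cexp ha hab,
      inv_mul_cancel_left₀ hG]
  rw [hEq]
  exact (differentiableOn_univ.1 hI).const_mul _

/-! ### The inverse Laplace representation on vertical lines. -/

/-- The factor `(1 - ξ / u) ^ (-a)`, in the branch `(u - ξ) ^ (-a) * u ^ a`. -/
noncomputable def kernelFactor (a : ℝ) (ξ u : ℂ) : ℂ := (u - ξ) ^ (-(a : ℂ)) * u ^ (a : ℂ)

/-- A real exponent makes the modulus `(‖u‖ / ‖u - ξ‖) ^ a` whatever the branch, and `‖u‖ ≤ ‖u - ξ‖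
+ ‖ξ‖`. -/
theorem norm_kernelFactor_le {a : ℝ} (ha : 0 < a) {ξ u : ℂ} {d : ℝ} (hd : 0 < d)
    (hu : u ≠ 0) (hdu : d ≤ ‖u - ξ‖) : ‖kernelFactor a ξ u‖ ≤ (1 + ‖ξ‖ / d) ^ a := by
  have hpos : 0 < ‖u - ξ‖ := hd.trans_le hdu
  have hne : u - ξ ≠ 0 := norm_pos_iff.1 hpos
  have h1 : ‖u‖ ≤ (1 + ‖ξ‖ / d) * ‖u - ξ‖ := by
    have h2 : ‖u‖ ≤ ‖u - ξ‖ + ‖ξ‖ := norm_le_norm_sub_add u ξ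
    have h3 : ‖ξ‖ ≤ ‖ξ‖ / d * ‖u - ξ‖ := by
      rw [div_mul_eq_mul_div, le_div_iff₀ hd]
      gcongr
    linarith
  have h4 : ‖kernelFactor a ξ u‖ = (‖u‖ / ‖u - ξ‖) ^ a := by
    rw [kernelFactor, norm_mul, ← Complex.ofReal_neg, Complex.norm_cpow_real, Complex.norm_cpow_real,
      Real.div_rpow (norm_nonneg _) (norm_nonneg _), Real.rpow_neg (norm_nonneg _)]
    rw [div_eq_inv_mul]
  rw [h4]
  exact Real.rpow_le_rpow (by positivity) ((div_le_iff₀ hpos).2 h1) ha.le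

theorem sq_norm_add_mul_I (c τ : ℝ) : ‖(c : ℂ) + τ * Complex.I‖ ^ 2 = c ^ 2 + τ ^ 2 := by
  rw [← Complex.normSq_eq_norm_sq, Complex.normSq_add_mul_I]

theorem integrable_norm_vertical_rpow {c b : ℝ} (hc : 0 < c) (hb : 1 < b) :
    Integrable fun τ : ℝ => ‖(c : ℂ) + τ * Complex.I‖ ^ (-b) := by
  have h1 := integrable_rpow_neg_one_add_norm_sq (E := ℝ) (μ := volume) (r := b) (by simpa)
  set m := min c 1 with hm
  have hmpos : 0 < m := lt_min hc one_pos
  refine (h1.const_mul (m ^ (-b))).mono' ?_ (Eventually.of_forall fun τ => ?_)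
  · refine Measurable.aestronglyMeasurable ?_
    fun_prop
  · have hn : 0 ≤ ‖(c : ℂ) + τ * Complex.I‖ := norm_nonneg _
    rw [Real.norm_of_nonneg (by positivity)]
    have hle : m * (1 + ‖τ‖ ^ 2) ^ (1 / 2 : ℝ) ≤ ‖(c : ℂ) + τ * Complex.I‖ := by
      rw [← Real.sqrt_eq_rpow]
      refine le_of_sq_le_sq ?_ hn
      rw [mul_pow, Real.sq_sqrt (by positivity), sq_norm_add_mul_I, Real.norm_eq_abs, sq_abs]
      have h2 : m ^ 2 ≤ c ^ 2 := pow_le_pow_left₀ hmpos.le (min_le_left _ _) 2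
      have h3 : m ^ 2 ≤ 1 := pow_le_one₀ hmpos.le (min_le_right _ _)
      nlinarith [sq_nonneg τ]
    have hp : 0 < m * (1 + ‖τ‖ ^ 2) ^ (1 / 2 : ℝ) := by positivity
    calc ‖(c : ℂ) + τ * Complex.I‖ ^ (-b) ≤ (m * (1 + ‖τ‖ ^ 2) ^ (1 / 2 : ℝ)) ^ (-b) :=
          Real.rpow_le_rpow_of_nonpos hp hle (by linarith)
      _ = m ^ (-b) * (1 + ‖τ‖ ^ 2) ^ (-b / 2) := by
          rw [Real.mul_rpow hmpos.le (by positivity), ← Real.rpow_mul (by positivity)]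
          congr 2
          ring

theorem add_mul_I_mem_slitPlane {c τ : ℝ} {ξ : ℂ} (h : ξ.re < c) :
    (c : ℂ) + τ * Complex.I - ξ ∈ Complex.slitPlane := by
  left
  simpa using h

theorem continuous_kernelFactor_vertical {a c : ℝ} {ξ : ℂ} (hc : 0 < c) (hξ : ξ.re < c) :
    Continuous fun τ : ℝ => kernelFactor a ξ ((c : ℂ) + τ * Complex.I) := by
  unfold kernelFactor
  refine Continuous.mul ?_ ?_
  · exact Continuous.cpow (by fun_prop) continuous_const fun τ => add_mul_I_mem_slitPlane hξ
  · refine Continuous.cpow (by fun_prop) continuous_const fun τ => ?_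
    simpa using add_mul_I_mem_slitPlane (ξ := 0) (τ := τ) (by simpa using hc)

theorem sub_re_le_norm_vertical (c : ℝ) (ξ : ℂ) (τ : ℝ) :
    c - ξ.re ≤ ‖(c : ℂ) + τ * Complex.I - ξ‖ := by
  have h := Complex.re_le_norm ((c : ℂ) + τ * Complex.I - ξ)
  simpa using h

theorem add_mul_I_ne_zero {c : ℝ} (hc : 0 < c) (τ : ℝ) : (c : ℂ) + τ * Complex.I ≠ 0 := by
  intro h
  have := congrArg Complex.re h
  simp at this
  exact hc.ne' this

theorem continuous_cpow_vertical {c : ℝ} (hc : 0 < c) (s : ℂ) :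
    Continuous fun τ : ℝ => ((c : ℂ) + τ * Complex.I) ^ s := by
  refine Continuous.cpow (by fun_prop) continuous_const fun τ => ?_
  simpa using add_mul_I_mem_slitPlane (ξ := 0) (τ := τ) (by simpa using hc)

theorem integrable_kernel_vertical {a b c : ℝ} (ha : 0 < a) (hb : 1 < b) (hc : 0 < c) {ξ : ℂ}
    (hξ : ξ.re < c) :
    Integrable fun τ : ℝ => ((c : ℂ) + τ * Complex.I) ^ (-(b : ℂ)) *
      kernelFactor a ξ ((c : ℂ) + τ * Complex.I) := by
  refine ((integrable_norm_vertical_rpow hc hb).mul_const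
    ((1 + ‖ξ‖ / (c - ξ.re)) ^ a)).mono' ?_ (Eventually.of_forall fun τ => ?_)
  · exact ((continuous_cpow_vertical hc _).mul
      (continuous_kernelFactor_vertical hc hξ)).aestronglyMeasurable
  · rw [norm_mul, ← Complex.ofReal_neg, Complex.norm_cpow_real]
    gcongr
    exact norm_kernelFactor_le ha (sub_pos.2 hξ) (add_mul_I_ne_zero hc τ)
      (sub_re_le_norm_vertical c ξ τ)

open FourierTransform in
/-- `t ^ (b - 1) ₁F₁(a; b; t ξ) / Γ(b)` as an inverse Laplace transform. -/
theorem confluentHypergeometric_eq_integral_vertical {a b c t : ℝ} (ha : 0 < a) (hab : a < b)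
    (hb : 1 < b) (hc : 0 < c) {ξ : ℂ} (hξ : ξ.re < c) (ht : 0 < t) :
    ((t ^ (b - 1) : ℝ) : ℂ) / (Real.Gamma b : ℂ) * confluentHypergeometric a b (t * ξ) =
      1 / (2 * (Real.pi : ℂ)) * ∫ τ : ℝ, Complex.exp (t * ((c : ℂ) + τ * Complex.I)) *
        (((c : ℂ) + τ * Complex.I) ^ (-(b : ℂ)) *
          kernelFactor a ξ ((c : ℂ) + τ * Complex.I)) := by
  have hb0 : 0 < b := ha.trans hab
  have hba : 0 < b - a := sub_pos.2 hab
  have hGa : (Real.Gamma a : ℂ) ≠ 0 := by exact_mod_cast (Real.Gamma_pos_of_pos ha).ne'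
  have hGba : (Real.Gamma (b - a) : ℂ) ≠ 0 := by exact_mod_cast (Real.Gamma_pos_of_pos hba).ne'
  have hGb : (Real.Gamma b : ℂ) ≠ 0 := by exact_mod_cast (Real.Gamma_pos_of_pos hb0).ne'
  have hcξ : 0 < ((c : ℂ) - ξ).re := by simpa using hξ
  -- Damping Euler's integrand by `exp (-c x)` splits it as a convolution of `p` and `q`. The
  -- Fourier transform at `w` is the Laplace transform on `re u = c`, so it is a product of a power
  -- of `u - ξ` and a power of `u`, with `u = c + 2πiw`.
  set p : ℝ → ℂ := fun s => ((s ^ (a - 1) : ℝ) : ℂ) * Complex.exp (-(((c : ℂ) - ξ) * s)) with hp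
  set q : ℝ → ℂ := fun s => ((s ^ (b - a - 1) : ℝ) : ℂ) * Complex.exp (-((c : ℂ) * s)) with hq
  have hpI : IntegrableOn p (Ioi 0) := integrableOn_rpow_mul_cexp_neg_mul ha hcξ
  have hqI : IntegrableOn q (Ioi 0) := integrableOn_rpow_mul_cexp_neg_mul hba (by simpa using hc)
  set P := (Ioi (0 : ℝ)).indicator p with hP
  set Q := (Ioi (0 : ℝ)).indicator q with hQ
  have hPI : Integrable P := (integrable_indicator_iff measurableSet_Ioi).2 hpI
  have hQI : Integrable Q := (integrable_indicator_iff measurableSet_Ioi).2 hqI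
  set h : ℝ → ℂ := posConvolution p q (ContinuousLinearMap.mul ℝ ℂ) with hh
  have hhI : Integrable h := integrable_posConvolution hpI hqI _
  have hfourier : ∀ (s : ℝ) (r : ℂ) (w : ℝ), 0 < s → 0 < r.re →
      𝓕 ((Ioi (0 : ℝ)).indicator fun v : ℝ =>
        ((v ^ (s - 1) : ℝ) : ℂ) * Complex.exp (-(r * v))) w =
        (r + (2 * Real.pi * w : ℝ) * Complex.I) ^ (-(s : ℂ)) * (Real.Gamma s : ℂ) := by
    intro s r w hs hr
    rw [Real.fourier_real_eq_integral_exp_smul, ← integral_rpow_mul_cexp_neg_mul_Ioi hs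
      (by simpa using hr), ← integral_indicator measurableSet_Ioi]
    congr 1 with v
    by_cases hv : v ∈ Ioi (0 : ℝ)
    · rw [indicator_of_mem hv, indicator_of_mem hv, smul_eq_mul, mul_left_comm, ← Complex.exp_add]
      congr 2
      push_cast
      ring
    · rw [indicator_of_notMem hv, indicator_of_notMem hv, smul_zero]
  have hhF : ∀ w : ℝ, 𝓕 h w = (Real.Gamma a : ℂ) * (Real.Gamma (b - a) : ℂ) *
      (((c : ℂ) + (2 * Real.pi * w : ℝ) * Complex.I) ^ (-(b : ℂ)) *
        kernelFactor a ξ ((c : ℂ) + (2 * Real.pi * w : ℝ) * Complex.I)) := by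
    intro w
    have h1 : h = convolution P Q (ContinuousLinearMap.mul ℂ ℂ) :=
      posConvolution_eq_convolution_indicator p q (ContinuousLinearMap.mul ℝ ℂ)
    rw [h1, Real.fourier_mul_convolution_eq hPI hQI, hfourier a _ w ha hcξ,
      hfourier (b - a) _ w hba (by simpa using hc)]
    have hne := add_mul_I_ne_zero hc (2 * Real.pi * w)
    have h2 : ((c : ℂ) + (2 * Real.pi * w : ℝ) * Complex.I) ^ (-((b - a : ℝ) : ℂ)) =
        ((c : ℂ) + (2 * Real.pi * w : ℝ) * Complex.I) ^ (-(b : ℂ)) *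
        ((c : ℂ) + (2 * Real.pi * w : ℝ) * Complex.I) ^ (a : ℂ) := by
      rw [← Complex.cpow_add _ _ hne]
      congr 1
      push_cast
      ring
    rw [h2, kernelFactor, show (c : ℂ) - ξ + (2 * Real.pi * w : ℝ) * Complex.I =
      (c : ℂ) + (2 * Real.pi * w : ℝ) * Complex.I - ξ by ring]
    ring
  have hval : ∀ x : ℝ, 0 < x → h x = Complex.exp (-(c * x)) * (((x ^ (b - 1) : ℝ) : ℂ) *
      ((Real.Gamma a : ℂ) * (Real.Gamma (b - a) : ℂ) /
        (Real.Gamma b : ℂ) * confluentHypergeometric a b (x * ξ))) := by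
    intro x hx
    rw [← integral_beta_mul_cexp_scaled ha hab hx, hh, posConvolution,
      indicator_of_mem (mem_Ioi.2 hx),
      ← intervalIntegral.integral_const_mul]
    refine intervalIntegral.integral_congr fun s _ => ?_
    simp only [hp, hq, ContinuousLinearMap.mul_apply']
    have h3 : Complex.exp (-(((c : ℂ) - ξ) * s)) * Complex.exp (-(c * ((x - s : ℝ) : ℂ))) =
        Complex.exp (-(c * x)) * Complex.exp (ξ * s) := by
      rw [← Complex.exp_add, ← Complex.exp_add]
      congr 1
      push_cast
      ring
    push_cast at h3 ⊢
    linear_combination ((s ^ (a - 1) : ℝ) : ℂ) * (((x - s) ^ (b - a - 1) : ℝ) : ℂ) * h3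
  have hcont : ContinuousAt h t := by
    have h4 : h =ᶠ[𝓝 t] fun x : ℝ => Complex.exp (-(c * x)) * (((x ^ (b - 1) : ℝ) : ℂ) *
      ((Real.Gamma a : ℂ) * (Real.Gamma (b - a) : ℂ) /
        (Real.Gamma b : ℂ) * confluentHypergeometric a b (x * ξ))) := by
      filter_upwards [lt_mem_nhds ht] with x hx using hval x hx
    refine ContinuousAt.congr ?_ h4.symm
    have h5 : Continuous fun x : ℝ => confluentHypergeometric a b (x * ξ) :=
      (differentiable_confluentHypergeometric ha hab).continuous.comp (by fun_prop)
    have h6 : ContinuousAt (fun x : ℝ => ((x ^ (b - 1) : ℝ) : ℂ)) t :=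
      Complex.continuous_ofReal.continuousAt.comp
        (Real.continuousAt_rpow_const t (b - 1) (Or.inl ht.ne'))
    exact ContinuousAt.mul (by fun_prop) (h6.mul (continuousAt_const.mul h5.continuousAt))
  -- The condition `b > 1` is what makes the transform integrable, so that inversion holds pointwise
  -- where `h` is continuous.
  have hFI : Integrable (𝓕 h) := by
    have h7 := ((integrable_kernel_vertical ha hb hc hξ).comp_mul_left'
      (R := 2 * Real.pi) (by positivity)).const_mul
        ((Real.Gamma a : ℂ) * (Real.Gamma (b - a) : ℂ))
    refine h7.congr (Eventually.of_forall fun w => ?_)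
    rw [hhF w]
  have hinv := hhI.fourierInv_fourier_eq hFI hcont
  rw [hval t ht, Real.fourierInv_eq_fourier_neg, Real.fourier_real_eq_integral_exp_smul] at hinv
  set G : ℝ → ℂ := fun τ => Complex.exp (t * ((c : ℂ) + τ * Complex.I)) *
    (((c : ℂ) + τ * Complex.I) ^ (-(b : ℂ)) * kernelFactor a ξ ((c : ℂ) + τ * Complex.I)) with hG
  have h8 : (∫ v : ℝ, Complex.exp ((-2 * Real.pi * v * -t : ℝ) * Complex.I) • 𝓕 h v) =
      Complex.exp (-(c * t)) * ((Real.Gamma a : ℂ) * (Real.Gamma (b - a) : ℂ)) *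
        ∫ v : ℝ, G (2 * Real.pi * v) := by
    rw [← integral_const_mul]
    congr 1 with v
    have h9 : Complex.exp ((-2 * Real.pi * v * -t : ℝ) * Complex.I) = Complex.exp (-(c * t)) *
        Complex.exp (t * ((c : ℂ) + (2 * Real.pi * v : ℝ) * Complex.I)) := by
      rw [← Complex.exp_add]
      congr 1
      push_cast
      ring
    rw [hhF v, smul_eq_mul, h9, hG]
    ring
  rw [h8, Measure.integral_comp_mul_left G, abs_of_pos (by positivity), Complex.real_smul] at hinv
  have h10 : Complex.exp (-((c : ℂ) * t)) ≠ 0 := Complex.exp_ne_zero _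
  have h11 : (Real.pi : ℂ) ≠ 0 := by exact_mod_cast Real.pi_ne_zero
  push_cast at hinv
  have h12 : Complex.exp (-((c : ℂ) * t)) * ((Real.Gamma a : ℂ) * (Real.Gamma (b - a) : ℂ)) ≠ 0 :=
    mul_ne_zero h10 (mul_ne_zero hGa hGba)
  refine mul_left_cancel₀ h12 ?_
  rw [one_div]
  linear_combination -hinv

/-! ### Stirling's formula with the `1 / (12 x)` term. -/

/-- The remainder in Stirling's formula for `log Γ`. -/
noncomputable def stirlingRemainder (x : ℝ) : ℝ :=
  Real.log (Real.Gamma x) - (x - 1 / 2) * Real.log x + x - 1 / 2 * Real.log (2 * Real.pi)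

theorem stirlingRemainder_sub_succ {x : ℝ} (hx : 0 < x) :
    stirlingRemainder x - stirlingRemainder (x + 1) = (x + 1 / 2) * Real.log (1 + x⁻¹) - 1 := by
  have h1 : Real.log (1 + x⁻¹) = Real.log (x + 1) - Real.log x := by
    rw [← Real.log_div (by positivity) hx.ne']
    congr 1
    field_simp
  rw [stirlingRemainder, stirlingRemainder, Real.Gamma_add_one hx.ne',
    Real.log_mul hx.ne' (Real.Gamma_pos_of_pos hx).ne', h1]
  ring

/-- With `y = 1 / (2 x + 1)` the product is `∑ y ^ (2 k) / (2 k + 1)`. After removing `k = 0`, the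
first term `y ^ 2 / 3` is the lower bound; replacing every `1 / (2 k + 1)` by `1 / 3` gives a
geometric series, the upper bound. -/
theorem add_half_mul_log_bounds {x : ℝ} (hx : 0 < x) :
    1 / (3 * (2 * x + 1) ^ 2) ≤ (x + 1 / 2) * Real.log (1 + x⁻¹) - 1 ∧
      (x + 1 / 2) * Real.log (1 + x⁻¹) - 1 ≤ 1 / (12 * x * (x + 1)) := by
  have hs := Real.hasSum_log_one_add_inv hx
  set y : ℝ := 1 / (2 * x + 1) with hy
  have hy0 : 0 < y := by positivity
  have hy1 : y < 1 := by
    rw [hy, div_lt_one (by positivity)]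
    linarith
  have hs2 : HasSum (fun k : ℕ => 1 / (2 * (k : ℝ) + 1) * (y ^ 2) ^ k)
      ((x + 1 / 2) * Real.log (1 + x⁻¹)) := by
    convert! hs.mul_left (x + 1 / 2) using 1
    funext k
    rw [pow_add, pow_mul, pow_one, hy]
    field_simp
  have hs3 := (hasSum_nat_add_iff' 1).2 hs2
  simp only [Finset.range_one, Finset.sum_singleton, Nat.cast_zero, mul_zero, zero_add, div_one,
    pow_zero, mul_one] at hs3
  constructor
  · have h := le_hasSum hs3 0 (fun k _ => by positivity)
    refine le_trans (le_of_eq ?_) h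
    rw [hy]
    norm_num
    ring
  · have hgeo := (hasSum_geometric_of_lt_one (sq_nonneg y)
      (pow_lt_one₀ hy0.le hy1 two_ne_zero)).mul_left (1 / 3 * y ^ 2)
    have h := hasSum_le (fun k => ?_) hs3 hgeo
    · refine h.trans (le_of_eq ?_)
      have h1 : 1 - y ^ 2 = 4 * x * (x + 1) * y ^ 2 := by
        rw [hy]
        field_simp
        ring
      rw [h1]
      field_simp
      norm_num
    · rw [pow_succ, mul_comm ((y ^ 2) ^ k), ← mul_assoc]
      gcongr
      push_cast
      linarith [(Nat.cast_nonneg k : (0 : ℝ) ≤ k)]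

/-- The Bohr–Mollerup limit compares `log Γ(x + n + 1)` with `x log n + log n!`, and Stirling's
formula for `n!` does the rest; the leftover `(n + x + 1 / 2) log (1 + (x + 1) / n)` tends to `x +
1`. -/
theorem tendsto_stirlingRemainder_add_nat {x : ℝ} (hx : 0 < x) :
    Tendsto (fun n : ℕ => stirlingRemainder (x + (n + 1 : ℕ))) atTop (𝓝 0) := by
  have h1 : Tendsto (fun n : ℕ => Real.log (Real.Gamma (x + (n + 1 : ℕ))) - x * Real.log n -
      Real.log n.factorial) atTop (𝓝 0) := by
    have h := (Real.BohrMollerup.tendsto_log_gamma hx).const_sub (Real.log (Real.Gamma x))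
    rw [sub_self] at h
    refine h.congr fun n => ?_
    have h2 := Real.BohrMollerup.f_add_nat_eq (f := Real.log ∘ Real.Gamma) (fun {y} hy => by
      simp only [Function.comp_apply]
      rw [Real.Gamma_add_one hy.ne', Real.log_mul hy.ne' (Real.Gamma_pos_of_pos hy).ne',
        add_comm]) hx (n + 1)
    simp only [Function.comp_apply] at h2
    rw [h2, Real.BohrMollerup.logGammaSeq]
    ring
  have h2 : Tendsto (fun n : ℕ => Real.log n.factorial - 1 / 2 * Real.log (2 * n) -
      n * Real.log (n / Real.exp 1)) atTop (𝓝 (1 / 2 * Real.log Real.pi)) := by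
    have h := (Real.continuousAt_log (Real.sqrt_ne_zero'.2 Real.pi_pos)).tendsto.comp
      Stirling.tendsto_stirlingSeq_sqrt_pi
    rw [Real.log_sqrt Real.pi_pos.le] at h
    rw [one_div_mul_eq_div]
    refine h.congr fun n => ?_
    exact Stirling.log_stirlingSeq_formula n
  have h3 : Tendsto (fun n : ℕ => (n : ℝ) * Real.log (1 + (x + 1) / n)) atTop (𝓝 (x + 1)) :=
    (Real.tendsto_mul_log_one_add_div_atTop (x + 1)).comp tendsto_natCast_atTop_atTop
  have h4 : Tendsto (fun n : ℕ => (x + 1 / 2) * Real.log (1 + (x + 1) / n)) atTop (𝓝 0) := by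
    have h5 : Tendsto (fun n : ℕ => 1 + (x + 1) / (n : ℝ)) atTop (𝓝 1) := by
      simpa using (tendsto_const_div_atTop_nhds_zero_nat (x + 1)).const_add 1
    have := ((Real.continuousAt_log one_ne_zero).tendsto.comp h5).const_mul (x + 1 / 2)
    simpa using this
  have h6 := ((h1.add h2).sub (h3.add h4)).add_const (x + 1 - 1 / 2 * Real.log Real.pi)
  have h7 : (0 : ℝ) + 1 / 2 * Real.log Real.pi - (x + 1 + 0) +
      (x + 1 - 1 / 2 * Real.log Real.pi) = 0 := by ring
  rw [h7] at h6
  refine h6.congr' ?_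
  filter_upwards [eventually_gt_atTop 0] with n hn
  have hn' : (0 : ℝ) < n := by exact_mod_cast hn
  have h8 : Real.log (1 + (x + 1) / n) = Real.log (x + (n + 1 : ℕ)) - Real.log n := by
    rw [← Real.log_div (by positivity) hn'.ne']
    congr 1
    push_cast
    field_simp
    ring
  rw [stirlingRemainder, h8, Real.log_mul two_ne_zero hn'.ne',
    Real.log_mul two_ne_zero Real.pi_ne_zero, Real.log_div hn'.ne' (Real.exp_ne_zero 1),
    Real.log_exp]
  push_cast
  ring

/-- Along unit steps `ν` increases while `ν + 1 / y ^ 2` decreases, by the two bounds on the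
increment of the remainder. Both tend to 0, so `-1 / x ^ 2 ≤ ν x ≤ 0`. -/
theorem abs_stirlingRemainder_sub_le {x : ℝ} (hx : 0 < x) :
    |stirlingRemainder x - 1 / (12 * x)| ≤ 1 / x ^ 2 := by
  set ν : ℝ → ℝ := fun y => stirlingRemainder y - 1 / (12 * y) with hν
  have hstep : ∀ y : ℝ, 0 < y → ν y ≤ ν (y + 1) ∧
      ν (y + 1) + 1 / (y + 1) ^ 2 ≤ ν y + 1 / y ^ 2 := by
    intro y hy
    have h1 := stirlingRemainder_sub_succ hy
    obtain ⟨h2, h3⟩ := add_half_mul_log_bounds hy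
    have h4 : 1 / (12 * y) - 1 / (12 * (y + 1)) = 1 / (12 * y * (y + 1)) := by
      field_simp
      ring
    have h5 : 1 / (12 * y * (y + 1)) - 1 / (3 * (2 * y + 1) ^ 2) ≤ 1 / y ^ 2 - 1 / (y + 1) ^ 2 := by
      rw [div_sub_div _ _ (by positivity) (by positivity),
        div_sub_div _ _ (by positivity) (by positivity), div_le_div_iff₀ (by positivity)
          (by positivity)]
      have : 0 < y ^ 2 := by positivity
      have h6 : 1 * (3 * (2 * y + 1) ^ 2) - 12 * y * (y + 1) * 1 = 3 := by ring
      have h7 : 1 * (y + 1) ^ 2 - y ^ 2 * 1 = 2 * y + 1 := by ring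
      rw [h6, h7]
      have h8 : 3 * (y ^ 2 * (y + 1) ^ 2) ≤ 12 * y * (y + 1) * (3 * (2 * y + 1) ^ 2) := by
        have : y ^ 2 * (y + 1) ^ 2 = y * (y + 1) * (y * (y + 1)) := by ring
        rw [this]
        have : 0 < y * (y + 1) := by positivity
        nlinarith
      have h9 : 0 ≤ 12 * y * (y + 1) * (3 * (2 * y + 1) ^ 2) := by positivity
      nlinarith
    constructor
    · simp only [hν]
      linarith
    · simp only [hν]
      linarith
  have hiter : ∀ n : ℕ, ν x ≤ ν (x + n) ∧ ν (x + n) + 1 / (x + n) ^ 2 ≤ ν x + 1 / x ^ 2 := by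
    intro n
    induction n with
    | zero => simp
    | succ n ih =>
      have h := hstep (x + n) (by positivity)
      rw [add_assoc] at h
      push_cast
      constructor
      · linarith [ih.1, h.1]
      · linarith [ih.2, h.2]
  have hlim : Tendsto (fun n : ℕ => ν (x + (n + 1 : ℕ))) atTop (𝓝 0) := by
    have h1 : Tendsto (fun n : ℕ => 1 / (12 * (x + (n + 1 : ℕ)))) atTop (𝓝 (0 : ℝ)) := by
      refine tendsto_const_nhds.div_atTop (Tendsto.const_mul_atTop (by norm_num) ?_)
      exact tendsto_atTop_add_const_left _ _
        (tendsto_natCast_atTop_atTop.comp (tendsto_add_atTop_nat 1))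
    have h2 := (tendsto_stirlingRemainder_add_nat hx).sub h1
    rwa [sub_zero] at h2
  rw [abs_le]
  constructor
  · have := le_of_tendsto hlim (Eventually.of_forall fun n =>
      (le_add_of_nonneg_right (by positivity)).trans (hiter (n + 1)).2)
    linarith
  · have := ge_of_tendsto hlim (Eventually.of_forall fun n => (hiter (n + 1)).1)
    have h2 : 0 ≤ 1 / x ^ 2 := by positivity
    linarith

theorem Gamma_eq_mul_exp_stirlingRemainder {x : ℝ} (hx : 0 < x) :
    Real.Gamma x = √(2 * Real.pi) * x ^ (x - 1 / 2) * Real.exp (-x) *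
      Real.exp (stirlingRemainder x) := by
  have hG := Real.Gamma_pos_of_pos hx
  have h2 : √(2 * Real.pi) = Real.exp (1 / 2 * Real.log (2 * Real.pi)) := by
    rw [Real.sqrt_eq_rpow, Real.rpow_def_of_pos (by positivity)]
    ring_nf
  rw [h2, Real.rpow_def_of_pos hx, ← Real.exp_add, ← Real.exp_add, ← Real.exp_add,
    stirlingRemainder, ← Real.exp_log hG]
  simp only [Real.log_exp]
  congr 1
  ring

theorem abs_exp_stirlingRemainder_sub_le {x : ℝ} (hx : 2 ≤ x) :
    |Real.exp (stirlingRemainder x) - (1 + 1 / (12 * x))| ≤ 2 / x ^ 2 := by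
  have hx0 : 0 < x := by linarith
  have h1 := abs_stirlingRemainder_sub_le hx0
  have h2 : 1 / x ^ 2 ≤ 1 / 2 * (1 / x) := by
    rw [div_mul_div_comm, div_le_div_iff₀ (by positivity) (by positivity)]
    nlinarith
  have h3 : |stirlingRemainder x| ≤ 1 / x := by
    have h4 : 1 / (12 * x) = 1 / 12 * (1 / x) := by field_simp
    have h5 : 0 < 1 / x := by positivity
    rw [abs_le] at h1 ⊢
    constructor <;> linarith [h1.1, h1.2]
  have h6 : 1 / x ≤ 1 := by
    rw [div_le_one hx0]
    linarith
  have h7 := Real.abs_exp_sub_one_sub_id_le (h3.trans h6)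
  have h8 : stirlingRemainder x ^ 2 ≤ 1 / x ^ 2 := by
    rw [← sq_abs, ← one_div_pow]
    exact pow_le_pow_left₀ (abs_nonneg _) h3 2
  have h9 : 2 / x ^ 2 = 1 / x ^ 2 + 1 / x ^ 2 := by ring
  rw [abs_le] at h1 h7 ⊢
  rw [h9]
  constructor <;> linarith [h1.1, h1.2, h7.1, h7.2]

/-! ### Taylor expansion of the kernel at the saddle `u = 1`. -/

theorem exists_norm_one_add_cpow_sub_le (s : ℂ) (n : ℕ) :
    ∃ C, 0 ≤ C ∧ ∀ᶠ w in 𝓝 (0 : ℂ),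
      ‖(1 + w) ^ s - ∑ j ∈ Finset.range n, Ring.choose s j * w ^ j‖ ≤ C * ‖w‖ ^ n := by
  have h := (Complex.one_add_cpow_hasFPowerSeriesAt_zero (a := s)).isBigO_sub_partialSum_pow n
  obtain ⟨C, hC, hb⟩ := h.exists_nonneg
  refine ⟨C, hC, hb.bound.mono fun w hw => ?_⟩
  have hps : (binomialSeries ℂ s).partialSum n w =
      ∑ j ∈ Finset.range n, Ring.choose s j * w ^ j := by
    simp [FormalMultilinearSeries.partialSum, binomialSeries, mul_comm]
  rw [hps, zero_add, norm_pow, norm_norm] at hw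
  exact hw

theorem ringChoose_one (s : ℂ) : Ring.choose s 1 = s := by simp

theorem ringChoose_succ (s : ℂ) (n : ℕ) :
    Ring.choose s (n + 1) = Ring.choose s n * (s - n) / (n + 1) := by
  rw [Ring.choose_eq_smul, Ring.choose_eq_smul, descPochhammer_succ_right, Polynomial.smeval_mul]
  simp [Polynomial.smeval_sub, Polynomial.smeval_natCast, Nat.factorial_succ]
  field_simp

/-- Near `(z₀, 1)` the arguments add up to less than `π` in absolute value, so the principal
logarithm is additive there. -/
theorem eventually_mul_cpow {z₀ : ℂ} (hz : z₀ ∈ Complex.slitPlane) (s : ℂ) :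
    ∀ᶠ p : ℂ × ℂ in 𝓝 (z₀, 1), (p.1 * p.2) ^ s = p.1 ^ s * p.2 ^ s := by
  have h1 : ContinuousAt (fun p : ℂ × ℂ => Complex.arg p.1 + Complex.arg p.2) (z₀, 1) :=
    (ContinuousAt.comp (f := Prod.fst) (x := (z₀, 1)) (Complex.continuousAt_arg hz)
      continuousAt_fst).add (ContinuousAt.comp (f := Prod.snd) (x := (z₀, 1))
        (Complex.continuousAt_arg Complex.one_mem_slitPlane) continuousAt_snd)
  have h2 : Complex.arg z₀ + Complex.arg 1 ∈ Ioo (-Real.pi) Real.pi := by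
    rw [Complex.arg_one, add_zero]
    exact ⟨Complex.neg_pi_lt_arg _, lt_of_le_of_ne (Complex.arg_le_pi _)
      (Complex.mem_slitPlane_iff_arg.1 hz).1⟩
  have h3 : ∀ᶠ p : ℂ × ℂ in 𝓝 (z₀, 1), p.1 ≠ 0 :=
    continuousAt_fst.eventually_ne (Complex.slitPlane_ne_zero hz)
  have h4 : ∀ᶠ p : ℂ × ℂ in 𝓝 (z₀, 1), p.2 ≠ 0 := continuousAt_snd.eventually_ne one_ne_zero
  filter_upwards [h1.eventually (isOpen_Ioo.mem_nhds h2), h3, h4] with p hp hp1 hp2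
  rw [Complex.cpow_def_of_ne_zero (mul_ne_zero hp1 hp2), Complex.cpow_def_of_ne_zero hp1,
    Complex.cpow_def_of_ne_zero hp2, Complex.log_mul hp1 hp2 (Ioo_subset_Ioc_self hp), add_mul,
    Complex.exp_add]

/-- The Taylor polynomial of degree `5` of `v ↦ (1 - ξ v) ^ (-a)` at `v = 1`. -/
noncomputable def kernelTaylor (a : ℝ) (ξ v : ℂ) : ℂ :=
  (1 - ξ) ^ (-(a : ℂ)) *
    ∑ j ∈ Finset.range 6, Ring.choose (-(a : ℂ)) j * (-(ξ / (1 - ξ)) * (v - 1)) ^ j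

/-- With `v = 1 / u` one has `1 - ξ v = (1 - ξ) (1 - ξ / (1 - ξ) (v - 1))`, and principal powers may
be factored accordingly near `(ξ₀, 1)`; the binomial series then applies. The condition `1 ≤ ‖u‖`
turns `‖v - 1‖` into `‖u - 1‖`. -/
theorem exists_kernelFactor_sub_kernelTaylor_le_near (a : ℝ) {ξ₀ : ℂ}
    (hξ₀ : 1 - ξ₀ ∈ Complex.slitPlane) :
    ∃ C, 0 ≤ C ∧ ∀ᶠ p : ℂ × ℂ in 𝓝 (ξ₀, 1), 1 ≤ ‖p.2‖ →
      ‖kernelFactor a p.1 p.2 - kernelTaylor a p.1 p.2⁻¹‖ ≤ C * ‖p.2 - 1‖ ^ 6 := by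
  obtain ⟨C, hC, hT⟩ := exists_norm_one_add_cpow_sub_le (-(a : ℂ)) 6
  have hne : (1 : ℂ) - ξ₀ ≠ 0 := Complex.slitPlane_ne_zero hξ₀
  have h1 : ContinuousAt (fun p : ℂ × ℂ => 1 - p.1) (ξ₀, 1) := by fun_prop
  have hq : ContinuousAt (fun p : ℂ × ℂ => 1 + (p.2 - 1) / (1 - p.1)) (ξ₀, 1) :=
    continuousAt_const.add ((by fun_prop : ContinuousAt (fun p : ℂ × ℂ => p.2 - 1) (ξ₀, 1)).div h1
      hne)
  have hinv : ContinuousAt (fun p : ℂ × ℂ => p.2⁻¹) (ξ₀, 1) :=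
    ContinuousAt.inv₀ continuousAt_snd one_ne_zero
  have hfac : ContinuousAt (fun p : ℂ × ℂ => p.1 / (1 - p.1)) (ξ₀, 1) := continuousAt_fst.div h1 hne
  have hw : ContinuousAt (fun p : ℂ × ℂ => -(p.1 / (1 - p.1)) * (p.2⁻¹ - 1)) (ξ₀, 1) :=
    hfac.neg.mul (hinv.sub continuousAt_const)
  have e1 := (h1.prodMk hq).eventually (by simpa using eventually_mul_cpow hξ₀ (-(a : ℂ)))
  have e2 := (hq.prodMk hinv).eventually
    (by simpa using eventually_mul_cpow Complex.one_mem_slitPlane (-(a : ℂ)))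
  have e3 := hw.eventually (p := fun w => ‖(1 + w) ^ (-(a : ℂ)) -
    ∑ j ∈ Finset.range 6, Ring.choose (-(a : ℂ)) j * w ^ j‖ ≤ C * ‖w‖ ^ 6) (by simpa using hT)
  have e4 : ∀ᶠ p : ℂ × ℂ in 𝓝 (ξ₀, 1), p.2 ∈ Complex.slitPlane :=
    continuousAt_snd.eventually (Complex.isOpen_slitPlane.mem_nhds Complex.one_mem_slitPlane)
  have e5 := h1.eventually_ne hne
  have hL : ContinuousAt (fun p : ℂ × ℂ => ‖(1 - p.1) ^ (-(a : ℂ))‖) (ξ₀, 1) :=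
    (h1.cpow continuousAt_const hξ₀).norm
  have e6 := hL.eventually_le_const (lt_add_one _)
  have e7 := hfac.norm.eventually_le_const (lt_add_one _)
  set L := ‖(1 - ξ₀) ^ (-(a : ℂ))‖ + 1 with hLdef
  set N := ‖ξ₀ / (1 - ξ₀)‖ + 1 with hNdef
  refine ⟨L * (C * N ^ 6), by positivity, ?_⟩
  filter_upwards [e1, e2, e3, e4, e5, e6, e7] with p p1 p2 p3 p4 p5 p6 p7 hp
  have hp2 : p.2 ≠ 0 := Complex.slitPlane_ne_zero p4
  have k1 : p.2 - p.1 = (1 - p.1) * (1 + (p.2 - 1) / (1 - p.1)) := by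
    field_simp
    ring
  have k2 : (1 + (p.2 - 1) / (1 - p.1)) * p.2⁻¹ = 1 + -(p.1 / (1 - p.1)) * (p.2⁻¹ - 1) := by
    field_simp
    ring
  have k3 : p.2 ^ (a : ℂ) = (p.2⁻¹) ^ (-(a : ℂ)) := by
    rw [Complex.inv_cpow _ _ (Complex.mem_slitPlane_iff_arg.1 p4).1, Complex.cpow_neg, inv_inv]
  rw [kernelFactor, k1, p1, k3, mul_assoc, ← p2, k2, kernelTaylor, ← mul_sub, norm_mul, mul_assoc]
  refine mul_le_mul p6 (p3.trans ?_) (norm_nonneg _) (by positivity)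
  rw [mul_assoc, ← mul_pow]
  refine mul_le_mul_of_nonneg_left (pow_le_pow_left₀ (norm_nonneg _) ?_ 6) hC
  rw [norm_mul, norm_neg]
  refine mul_le_mul p7 ?_ (norm_nonneg _) (by positivity)
  have k4 : p.2⁻¹ - 1 = -(p.2⁻¹ * (p.2 - 1)) := by
    field_simp
    ring
  rw [k4, norm_neg, norm_mul, norm_inv]
  exact mul_le_of_le_one_left (norm_nonneg _) (inv_le_one_of_one_le₀ hp)

theorem exists_norm_kernelTaylor_le (a : ℝ) {ξ₀ : ℂ} (hξ₀ : 1 - ξ₀ ∈ Complex.slitPlane) :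
    ∃ K, 0 ≤ K ∧ ∀ᶠ ξ in 𝓝 ξ₀, ∀ v : ℂ, ‖v‖ ≤ 1 → ‖kernelTaylor a ξ v‖ ≤ K := by
  have hne : (1 : ℂ) - ξ₀ ≠ 0 := Complex.slitPlane_ne_zero hξ₀
  have h1 : ContinuousAt (fun ξ : ℂ => 1 - ξ) ξ₀ := by fun_prop
  have hfac : ContinuousAt (fun ξ : ℂ => ξ / (1 - ξ)) ξ₀ := continuousAt_id.div h1 hne
  have e6 := (h1.cpow (continuousAt_const (y := -(a : ℂ))) hξ₀).norm.eventually_le_const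
    (lt_add_one _)
  have e7 := hfac.norm.eventually_le_const (lt_add_one _)
  set L := ‖(1 - ξ₀) ^ (-(a : ℂ))‖ + 1 with hLdef
  set N := ‖ξ₀ / (1 - ξ₀)‖ + 1 with hNdef
  refine ⟨L * ∑ j ∈ Finset.range 6, ‖Ring.choose (-(a : ℂ)) j‖ * (N * 2) ^ j, by positivity, ?_⟩
  filter_upwards [e6, e7] with ξ h6 h7 v hv
  rw [kernelTaylor, norm_mul]
  refine mul_le_mul h6 ((norm_sum_le _ _).trans (Finset.sum_le_sum fun j _ => ?_))
    (norm_nonneg _) (by positivity)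
  rw [norm_mul, norm_pow, norm_mul, norm_neg]
  have h8 : ‖v - 1‖ ≤ 2 := (norm_sub_le _ _).trans (by rw [norm_one]; linarith)
  gcongr

/-- The Taylor remainder is of sixth order, uniformly away from the branch point. -/
theorem exists_kernelFactor_sub_kernelTaylor_le {a : ℝ} (ha : 0 < a) {ξ₀ : ℂ}
    (hξ₀ : 1 - ξ₀ ∈ Complex.slitPlane) {d : ℝ} (hd : 0 < d) :
    ∃ C, 0 ≤ C ∧ ∀ᶠ ξ in 𝓝 ξ₀, ∀ u : ℂ, 1 ≤ u.re → d ≤ ‖u - ξ‖ →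
      ‖kernelFactor a ξ u - kernelTaylor a ξ u⁻¹‖ ≤ C * ‖u - 1‖ ^ 6 := by
  obtain ⟨C, hC, h1⟩ := exists_kernelFactor_sub_kernelTaylor_le_near a hξ₀
  obtain ⟨K, hK, h2⟩ := exists_norm_kernelTaylor_le a hξ₀
  rw [nhds_prod_eq] at h1
  obtain ⟨V, hV, W, hW, hVW⟩ := eventually_prod_iff.1 h1
  obtain ⟨δ, hδ, hball⟩ := Metric.eventually_nhds_iff.1 hW
  have e3 := (continuous_norm.tendsto ξ₀).eventually_le_const (lt_add_one _)
  set B := (1 + (‖ξ₀‖ + 1) / d) ^ a with hB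
  have hB0 : 0 ≤ B := by positivity
  refine ⟨C + (B + K) / δ ^ 6, by positivity, ?_⟩
  filter_upwards [hV, h2, e3] with ξ hξ hKξ hξn u hu hdu
  have hu1 : 1 ≤ ‖u‖ := hu.trans (Complex.re_le_norm u)
  have hu0 : u ≠ 0 := norm_pos_iff.1 (by linarith)
  have hn : 0 ≤ ‖u - 1‖ ^ 6 := by positivity
  rcases lt_or_ge (dist u 1) δ with h | h
  · refine (hVW hξ (hball h) hu1).trans ?_
    refine mul_le_mul_of_nonneg_right (le_add_of_nonneg_right (by positivity)) hn
  -- At distance at least `δ` from 1 both terms are bounded, and `‖u - 1‖ ^ 6 / δ ^ 6 ≥ 1` absorbs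
  -- the bound.
  · have h4 : ‖kernelFactor a ξ u‖ ≤ B :=
      (norm_kernelFactor_le ha hd hu0 hdu).trans (by rw [hB]; gcongr)
    have h5 : ‖kernelTaylor a ξ u⁻¹‖ ≤ K := hKξ _ (by
      rw [norm_inv]
      exact inv_le_one_of_one_le₀ hu1)
    rw [dist_eq_norm] at h
    have h6 : δ ^ 6 ≤ ‖u - 1‖ ^ 6 := pow_le_pow_left₀ hδ.le h 6
    calc _ ≤ B + K := (norm_sub_le _ _).trans (add_le_add h4 h5)
      _ = (B + K) / δ ^ 6 * δ ^ 6 := by field_simp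
      _ ≤ (B + K) / δ ^ 6 * ‖u - 1‖ ^ 6 := by gcongr
      _ ≤ _ := mul_le_mul_of_nonneg_right (le_add_of_nonneg_left hC) hn

/-! ### Normalised means on vertical lines and the exact moments of `1 / u`. -/

/-- The integral of `g` over the line `re u = c` against `exp (b u) u ^ (-b)`, normalised so that
the mean of `1` is `1`. -/
noncomputable def verticalMean (b c : ℝ) (g : ℂ → ℂ) : ℂ :=
  ((Real.Gamma b * b ^ (1 - b) / (2 * Real.pi) : ℝ) : ℂ) *
    ∫ τ : ℝ, Complex.exp (b * ((c : ℂ) + τ * Complex.I)) *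
      (((c : ℂ) + τ * Complex.I) ^ (-(b : ℂ)) * g ((c : ℂ) + τ * Complex.I))

theorem integrable_exp_mul_vertical {t c : ℝ} {g : ℝ → ℂ} (hg : Integrable g) :
    Integrable fun τ : ℝ => Complex.exp (t * ((c : ℂ) + τ * Complex.I)) * g τ := by
  refine hg.bdd_mul (c := Real.exp (t * c)) ?_ (Eventually.of_forall fun τ => ?_)
  · exact (by fun_prop : Continuous fun τ : ℝ =>
      Complex.exp (t * ((c : ℂ) + τ * Complex.I))).aestronglyMeasurable
  · rw [Complex.norm_exp]
    simp

/-- The inversion formula at `t = b`; the normalisation `b ^ (1 - b)` cancels `t ^ (b - 1)`. -/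
theorem verticalMean_kernelFactor {a b c : ℝ} (ha : 0 < a) (hab : a < b) (hb : 1 < b) (hc : 0 < c)
    {ξ : ℂ} (hξ : ξ.re < c) :
    verticalMean b c (kernelFactor a ξ) = confluentHypergeometric a b (b * ξ) := by
  have hb0 : 0 < b := ha.trans hab
  have h := confluentHypergeometric_eq_integral_vertical ha hab hb hc hξ hb0
  have hG : (Real.Gamma b : ℂ) ≠ 0 := by exact_mod_cast (Real.Gamma_pos_of_pos hb0).ne'
  have hp : ((b ^ (1 - b) : ℝ) : ℂ) * ((b ^ (b - 1) : ℝ) : ℂ) = 1 := by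
    rw [← Complex.ofReal_mul, ← Real.rpow_add hb0]
    simp
  rw [verticalMean, show ((Real.Gamma b * b ^ (1 - b) / (2 * Real.pi) : ℝ) : ℂ) =
    (Real.Gamma b : ℂ) * ((b ^ (1 - b) : ℝ) : ℂ) * (1 / (2 * (Real.pi : ℂ))) by push_cast; ring,
    mul_assoc, ← h]
  field_simp
  linear_combination confluentHypergeometric a b (b * ξ) * hp

theorem confluentHypergeometric_zero (a b : ℂ) : confluentHypergeometric a b 0 = 1 := by
  rw [confluentHypergeometric, tsum_eq_single 0]
  · simp [confluentTerm]
  · intro k hk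
    simp [confluentTerm, hk]

theorem kernelFactor_zero (a : ℝ) {u : ℂ} (hu : u ≠ 0) : kernelFactor a 0 u = 1 := by
  rw [kernelFactor, sub_zero, ← Complex.cpow_add _ _ hu]
  simp

theorem cpow_neg_add_nat {u : ℂ} (hu : u ≠ 0) (b : ℝ) (k : ℕ) :
    u ^ (-((b + k : ℝ) : ℂ)) = u ^ (-(b : ℂ)) * u⁻¹ ^ k := by
  rw [inv_pow, ← Complex.cpow_natCast, ← Complex.cpow_neg, ← Complex.cpow_add _ _ hu]
  congr 1
  push_cast
  ring

theorem integrable_cpow_mul_inv_pow {b c : ℝ} (hb : 1 < b) (hc : 0 < c) (k : ℕ) :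
    Integrable fun τ : ℝ => ((c : ℂ) + τ * Complex.I) ^ (-(b : ℂ)) *
      ((c : ℂ) + τ * Complex.I)⁻¹ ^ k := by
  have hbk : 1 < b + k := by linarith [(Nat.cast_nonneg k : (0 : ℝ) ≤ k)]
  refine (integrable_kernel_vertical (ξ := 0) one_pos hbk hc (by simpa)).congr
    (Eventually.of_forall fun τ => ?_)
  simp only
  rw [kernelFactor_zero _ (add_mul_I_ne_zero hc τ), mul_one,
    cpow_neg_add_nat (add_mul_I_ne_zero hc τ)]

/-- The inversion formula at `ξ = 0` with `b + k` in place of `b`: the kernel factor is then 1, so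
the choice of its parameter `a = 1` is immaterial. -/
theorem verticalMean_inv_pow {b c : ℝ} (hb : 1 < b) (hc : 0 < c) (k : ℕ) :
    verticalMean b c (fun u => u⁻¹ ^ k) =
      ((b ^ k * Real.Gamma b / Real.Gamma (b + k) : ℝ) : ℂ) := by
  have hb0 : 0 < b := by linarith
  have hk : (0 : ℝ) ≤ k := Nat.cast_nonneg k
  have hbk : 1 < b + k := by linarith
  have h := confluentHypergeometric_eq_integral_vertical (a := 1) (ξ := 0) one_pos hbk hbk hc
    (by simpa) hb0
  have hint : (∫ τ : ℝ, Complex.exp (b * ((c : ℂ) + τ * Complex.I)) *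
      (((c : ℂ) + τ * Complex.I) ^ (-((b + k : ℝ) : ℂ)) *
        kernelFactor 1 0 ((c : ℂ) + τ * Complex.I))) =
      ∫ τ : ℝ, Complex.exp (b * ((c : ℂ) + τ * Complex.I)) *
        (((c : ℂ) + τ * Complex.I) ^ (-(b : ℂ)) * ((c : ℂ) + τ * Complex.I)⁻¹ ^ k) := by
    congr 1 with τ
    rw [kernelFactor_zero _ (add_mul_I_ne_zero hc τ), mul_one,
      cpow_neg_add_nat (add_mul_I_ne_zero hc τ)]
  rw [mul_zero, confluentHypergeometric_zero, hint] at h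
  have hG : (Real.Gamma (b + k) : ℂ) ≠ 0 := by
    exact_mod_cast (Real.Gamma_pos_of_pos (by linarith)).ne'
  have hp : b ^ (1 - b) * b ^ (b + k - 1) = b ^ k := by
    rw [← Real.rpow_add hb0, ← Real.rpow_natCast]
    congr 1
    ring
  rw [verticalMean, show ((Real.Gamma b * b ^ (1 - b) / (2 * Real.pi) : ℝ) : ℂ) =
    (Real.Gamma b : ℂ) * ((b ^ (1 - b) : ℝ) : ℂ) * (1 / (2 * (Real.pi : ℂ))) by push_cast; ring,
    mul_assoc, ← h, ← hp]
  push_cast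
  field_simp

/-- The `k`-th moment of `1 / u`, `b ^ k / (b)_k`. -/
noncomputable def invMoment (b : ℝ) (k : ℕ) : ℝ := b ^ k * Real.Gamma b / Real.Gamma (b + k)

theorem invMoment_zero {b : ℝ} (hb : 0 < b) : invMoment b 0 = 1 := by
  have := (Real.Gamma_pos_of_pos hb).ne'
  simp [invMoment, this]

theorem invMoment_succ {b : ℝ} (hb : 0 < b) (k : ℕ) :
    invMoment b (k + 1) = invMoment b k * (b / (b + k)) := by
  have hbk : 0 < b + k := by positivity
  have h := (Real.Gamma_pos_of_pos hbk).ne'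
  rw [invMoment, invMoment, Nat.cast_succ, ← add_assoc, Real.Gamma_add_one hbk.ne']
  field_simp
  ring

/-- The central moments `E (1 / u - 1) ^ j`. -/
noncomputable def centralMoment (b : ℝ) (j : ℕ) : ℝ :=
  ∑ k ∈ Finset.range (j + 1), invMoment b k * (-1) ^ (j - k) * (j.choose k : ℝ)

theorem integrable_cpow_mul_inv_sub_one_pow {b c : ℝ} (hb : 1 < b) (hc : 0 < c) (j : ℕ) :
    Integrable fun τ : ℝ => ((c : ℂ) + τ * Complex.I) ^ (-(b : ℂ)) *
      (((c : ℂ) + τ * Complex.I)⁻¹ - 1) ^ j := by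
  have h : (fun τ : ℝ => ((c : ℂ) + τ * Complex.I) ^ (-(b : ℂ)) *
      (((c : ℂ) + τ * Complex.I)⁻¹ - 1) ^ j) = fun τ : ℝ => ∑ k ∈ Finset.range (j + 1),
      ((c : ℂ) + τ * Complex.I) ^ (-(b : ℂ)) * ((c : ℂ) + τ * Complex.I)⁻¹ ^ k *
        ((-1) ^ (j - k) * (j.choose k : ℂ)) := by
    funext τ
    rw [sub_eq_add_neg, add_pow, Finset.mul_sum]
    exact Finset.sum_congr rfl fun k _ => by ring
  rw [h]
  exact integrable_finsetSum _ fun k _ => (integrable_cpow_mul_inv_pow hb hc k).mul_const _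

theorem verticalMean_finset_sum {b c : ℝ} {ι : Type*} (s : Finset ι) (g : ι → ℂ → ℂ) (w : ι → ℂ)
    (hg : ∀ i ∈ s, Integrable fun τ : ℝ => ((c : ℂ) + τ * Complex.I) ^ (-(b : ℂ)) *
      g i ((c : ℂ) + τ * Complex.I)) :
    verticalMean b c (fun u => ∑ i ∈ s, w i * g i u) = ∑ i ∈ s, w i * verticalMean b c (g i) := by
  simp only [verticalMean]
  have h : ∀ τ : ℝ, Complex.exp (b * ((c : ℂ) + τ * Complex.I)) *
      (((c : ℂ) + τ * Complex.I) ^ (-(b : ℂ)) * ∑ i ∈ s, w i * g i ((c : ℂ) + τ * Complex.I)) =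
      ∑ i ∈ s, w i * (Complex.exp (b * ((c : ℂ) + τ * Complex.I)) *
      (((c : ℂ) + τ * Complex.I) ^ (-(b : ℂ)) * g i ((c : ℂ) + τ * Complex.I))) := by
    intro τ
    rw [Finset.mul_sum, Finset.mul_sum]
    exact Finset.sum_congr rfl fun k _ => by ring
  simp_rw [h]
  rw [integral_finsetSum _ fun i hi => (integrable_exp_mul_vertical (hg i hi)).const_mul _,
    Finset.mul_sum]
  refine Finset.sum_congr rfl fun i _ => ?_
  rw [integral_const_mul]
  ring

theorem verticalMean_inv_sub_one_pow {b c : ℝ} (hb : 1 < b) (hc : 0 < c) (j : ℕ) :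
    verticalMean b c (fun u => (u⁻¹ - 1) ^ j) = (centralMoment b j : ℂ) := by
  have h : (fun u : ℂ => (u⁻¹ - 1) ^ j) = fun u => ∑ k ∈ Finset.range (j + 1),
      ((-1) ^ (j - k) * (j.choose k : ℂ)) * u⁻¹ ^ k := by
    funext u
    rw [sub_eq_add_neg, add_pow]
    exact Finset.sum_congr rfl fun k _ => by ring
  rw [h, verticalMean_finset_sum (Finset.range (j + 1)) (fun k u => u⁻¹ ^ k)
    (fun k => (-1) ^ (j - k) * (j.choose k : ℂ))
    (fun k _ => integrable_cpow_mul_inv_pow hb hc k)]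
  rw [centralMoment]
  push_cast
  refine Finset.sum_congr rfl fun k _ => ?_
  rw [verticalMean_inv_pow hb hc, invMoment]
  push_cast
  ring

theorem kernelTaylor_eq (a : ℝ) (ξ v : ℂ) : kernelTaylor a ξ v = ∑ j ∈ Finset.range 6,
    ((1 - ξ) ^ (-(a : ℂ)) * (Ring.choose (-(a : ℂ)) j * (-(ξ / (1 - ξ))) ^ j)) * (v - 1) ^ j := by
  rw [kernelTaylor, Finset.mul_sum]
  exact Finset.sum_congr rfl fun k _ => by rw [mul_pow]; ring

theorem integrable_cpow_mul_kernelTaylor (a : ℝ) {b c : ℝ} (hb : 1 < b) (hc : 0 < c) (ξ : ℂ) :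
    Integrable fun τ : ℝ => ((c : ℂ) + τ * Complex.I) ^ (-(b : ℂ)) *
      kernelTaylor a ξ ((c : ℂ) + τ * Complex.I)⁻¹ := by
  simp_rw [kernelTaylor_eq, Finset.mul_sum]
  refine integrable_finsetSum _ fun j _ => ?_
  refine ((integrable_cpow_mul_inv_sub_one_pow hb hc j).const_mul
    ((1 - ξ) ^ (-(a : ℂ)) * (Ring.choose (-(a : ℂ)) j * (-(ξ / (1 - ξ))) ^ j))).congr
      (Eventually.of_forall fun τ => ?_)
  simp only
  ring

theorem verticalMean_kernelTaylor (a : ℝ) {b c : ℝ} (hb : 1 < b) (hc : 0 < c) (ξ : ℂ) :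
    verticalMean b c (fun u => kernelTaylor a ξ u⁻¹) = (1 - ξ) ^ (-(a : ℂ)) *
      ∑ j ∈ Finset.range 6, Ring.choose (-(a : ℂ)) j * (-(ξ / (1 - ξ))) ^ j *
        (centralMoment b j : ℂ) := by
  simp_rw [kernelTaylor_eq]
  rw [verticalMean_finset_sum (Finset.range 6) (fun k u => (u⁻¹ - 1) ^ k)
    (fun j => (1 - ξ) ^ (-(a : ℂ)) * (Ring.choose (-(a : ℂ)) j * (-(ξ / (1 - ξ))) ^ j))
    (fun k _ => integrable_cpow_mul_inv_sub_one_pow hb hc k), Finset.mul_sum]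
  refine Finset.sum_congr rfl fun k _ => ?_
  rw [verticalMean_inv_sub_one_pow hb hc]
  ring

/-- The Taylor polynomial has an exactly known mean, so the whole error is the mean of the Taylor
remainder. -/
theorem confluentHypergeometric_sub_eq_verticalMean {a b c : ℝ} (ha : 0 < a) (hab : a < b)
    (hb : 1 < b) (hc : 0 < c) {ξ : ℂ} (hξ : ξ.re < c) :
    confluentHypergeometric a b (b * ξ) - (1 - ξ) ^ (-(a : ℂ)) *
      ∑ j ∈ Finset.range 6, Ring.choose (-(a : ℂ)) j * (-(ξ / (1 - ξ))) ^ j *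
        (centralMoment b j : ℂ) =
      verticalMean b c (fun u => kernelFactor a ξ u - kernelTaylor a ξ u⁻¹) := by
  rw [← verticalMean_kernelFactor ha hab hb hc hξ, ← verticalMean_kernelTaylor a hb hc ξ]
  simp only [verticalMean]
  rw [← mul_sub, ← integral_sub (integrable_exp_mul_vertical
    (integrable_kernel_vertical ha hb hc hξ)) (integrable_exp_mul_vertical
    (integrable_cpow_mul_kernelTaylor a hb hc ξ))]
  congr 2 with τ
  ring

theorem centralMoment_values {b : ℝ} (hb : 0 < b) :
    centralMoment b 0 = 1 ∧ centralMoment b 1 = 0 ∧ centralMoment b 2 = -1 / (b + 1) ∧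
    centralMoment b 3 = 4 / ((b + 1) * (b + 2)) ∧
    centralMoment b 4 = (3 * b - 18) / ((b + 1) * (b + 2) * (b + 3)) ∧
    centralMoment b 5 = (96 - 40 * b) / ((b + 1) * (b + 2) * (b + 3) * (b + 4)) := by
  have c0 := invMoment_zero hb
  have c1 : invMoment b 1 = 1 := by
    rw [invMoment_succ hb 0, c0]
    field_simp
    simp
  have c2 : invMoment b 2 = b / (b + 1) := by
    rw [invMoment_succ hb 1, c1]
    simp
  have c3 : invMoment b 3 = b / (b + 1) * (b / (b + 2)) := by
    rw [invMoment_succ hb 2, c2]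
    simp
  have c4 : invMoment b 4 = b / (b + 1) * (b / (b + 2)) * (b / (b + 3)) := by
    rw [invMoment_succ hb 3, c3]
    simp
  have c5 : invMoment b 5 = b / (b + 1) * (b / (b + 2)) * (b / (b + 3)) * (b / (b + 4)) := by
    rw [invMoment_succ hb 4, c4]
    simp
  refine ⟨?_, ?_, ?_, ?_, ?_, ?_⟩ <;>
    simp only [centralMoment, Finset.sum_range_succ, Finset.sum_range_zero, c0, c1, c2, c3, c4, c5]
      <;> norm_num [Nat.choose] <;> field_simp <;> ring

theorem abs_centralMoment_two_sub_le {b : ℝ} (hb : 0 < b) :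
    |centralMoment b 2 - (-1 / b + 1 / b ^ 2)| ≤ 1 / b ^ 3 := by
  rw [(centralMoment_values hb).2.2.1,
    show -1 / (b + 1) - (-1 / b + 1 / b ^ 2) = -(1 / (b ^ 2 * (b + 1))) by field_simp; ring, abs_neg,
    abs_of_pos (by positivity)]
  refine one_div_le_one_div_of_le (by positivity) ?_
  nlinarith [sq_nonneg b]

theorem abs_centralMoment_three_sub_le {b : ℝ} (hb : 0 < b) :
    |centralMoment b 3 - 4 / b ^ 2| ≤ 12 / b ^ 3 := by
  rw [(centralMoment_values hb).2.2.2.1,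
    show 4 / ((b + 1) * (b + 2)) - 4 / b ^ 2 =
      -(4 * (3 * b + 2) / (b ^ 2 * ((b + 1) * (b + 2)))) by field_simp; ring, abs_neg,
    abs_of_pos (by positivity), div_le_div_iff₀ (by positivity) (by positivity)]
  have h : 0 < b ^ 2 * (28 * b + 24) := by positivity
  nlinarith

theorem abs_centralMoment_four_sub_le {b : ℝ} (hb : 0 < b) :
    |centralMoment b 4 - 3 / b ^ 2| ≤ 36 / b ^ 3 := by
  rw [(centralMoment_values hb).2.2.2.2.1,
    show (3 * b - 18) / ((b + 1) * (b + 2) * (b + 3)) - 3 / b ^ 2 =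
      -((36 * b ^ 2 + 33 * b + 18) / (b ^ 2 * ((b + 1) * (b + 2) * (b + 3)))) by
        field_simp; ring, abs_neg,
    abs_of_pos (by positivity), div_le_div_iff₀ (by positivity) (by positivity)]
  have h : 0 ≤ b ^ 2 * (36 * 6 * b ^ 2 + 36 * 11 * b + 36 * 6 - 33 * b ^ 2 - 18 * b) := by
    refine mul_nonneg (by positivity) ?_
    nlinarith
  nlinarith

/-- Cancellation in the exact moment: the numerator is only linear in `b`, so this term falls into
the error `O(b⁻³)`. -/
theorem abs_centralMoment_five_le {b : ℝ} (hb : 0 < b) :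
    |centralMoment b 5| ≤ 40 / b ^ 3 := by
  rw [(centralMoment_values hb).2.2.2.2.2, abs_div, abs_of_pos (by positivity :
    0 < (b + 1) * (b + 2) * (b + 3) * (b + 4)), div_le_div_iff₀ (by positivity) (by positivity)]
  have h : |96 - 40 * b| ≤ 96 + 40 * b := by
    rw [abs_le]
    constructor <;> linarith
  have h2 : |96 - 40 * b| * b ^ 3 ≤ (96 + 40 * b) * b ^ 3 := by gcongr
  have h3 : 0 ≤ 304 * b ^ 3 + 1400 * b ^ 2 + 2000 * b + 960 := by positivity
  nlinarith

/-! ### The sixth absolute moment on the line `re u = 1`. -/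

/-- Bernoulli's inequality, which needs `b ≥ 8`, gives `X = 1 + b τ ^ 2 / 8 ≤ (1 + τ ^ 2) ^ (b /
8)`, and the weight is the inverse fourth power of the right side. Three factors `X` absorb `τ ^ 6`;
the fourth keeps the bound integrable. -/
theorem norm_one_add_mul_I_rpow_mul_le {b : ℝ} (hb : 8 ≤ b) (τ : ℝ) :
    ‖(1 : ℂ) + τ * Complex.I‖ ^ (-b) * |τ| ^ 6 ≤ (8 / b) ^ 3 * (1 + (√(b / 8) * τ) ^ 2)⁻¹ := by
  have hb0 : 0 < b := by linarith
  have h1 : ‖(1 : ℂ) + τ * Complex.I‖ ^ 2 = 1 + τ ^ 2 := by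
    have := sq_norm_add_mul_I 1 τ
    rw [Complex.ofReal_one] at this
    rw [this, one_pow]
  set X := 1 + (√(b / 8) * τ) ^ 2 with hX
  have hXeq : X = 1 + b / 8 * τ ^ 2 := by
    rw [hX, mul_pow, Real.sq_sqrt (by positivity)]
  have hXpos : 0 < X := by positivity
  have h2 : X ≤ (1 + τ ^ 2) ^ (b / 8) := by
    rw [hXeq]
    exact one_add_mul_self_le_rpow_one_add (by linarith [sq_nonneg τ]) (by linarith)
  have h3 : ‖(1 : ℂ) + τ * Complex.I‖ ^ (-b) = (((1 + τ ^ 2) ^ (b / 8)) ^ 4)⁻¹ := by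
    rw [← h1, ← Real.rpow_natCast, ← Real.rpow_natCast, ← Real.rpow_mul (norm_nonneg _),
      ← Real.rpow_mul (norm_nonneg _), ← Real.rpow_neg (norm_nonneg _)]
    congr 1
    push_cast
    ring
  have h4 : |τ| ^ 6 ≤ (8 / b) ^ 3 * X ^ 3 := by
    rw [← mul_pow, show |τ| ^ 6 = (|τ| ^ 2) ^ 3 by ring, sq_abs]
    refine pow_le_pow_left₀ (sq_nonneg τ) ?_ 3
    rw [hXeq]
    field_simp
    linarith
  rw [h3]
  calc (((1 + τ ^ 2) ^ (b / 8)) ^ 4)⁻¹ * |τ| ^ 6 ≤ (X ^ 4)⁻¹ * ((8 / b) ^ 3 * X ^ 3) := by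
        gcongr
    _ = (8 / b) ^ 3 * X⁻¹ := by field_simp

theorem integrable_inv_one_add_sq_mul {k : ℝ} (hk : 0 < k) :
    Integrable fun τ : ℝ => (1 + (k * τ) ^ 2)⁻¹ :=
  integrable_inv_one_add_sq.comp_mul_left' hk.ne'

theorem integrable_norm_one_add_mul_I_rpow_mul {b : ℝ} (hb : 8 ≤ b) :
    Integrable fun τ : ℝ => ‖(1 : ℂ) + τ * Complex.I‖ ^ (-b) * |τ| ^ 6 := by
  refine ((integrable_inv_one_add_sq_mul (k := √(b / 8)) (by positivity)).const_mul
    ((8 / b) ^ 3)).mono' ?_ (Eventually.of_forall fun τ => ?_)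
  · refine Measurable.aestronglyMeasurable ?_
    fun_prop
  · rw [Real.norm_of_nonneg (by positivity)]
    exact norm_one_add_mul_I_rpow_mul_le hb τ

theorem integral_norm_one_add_mul_I_rpow_mul_le {b : ℝ} (hb : 8 ≤ b) :
    ∫ τ : ℝ, ‖(1 : ℂ) + τ * Complex.I‖ ^ (-b) * |τ| ^ 6 ≤ (8 / b) ^ 3 * (√(b / 8))⁻¹ * Real.pi := by
  have hk : 0 < √(b / 8) := by positivity
  refine (integral_mono (integrable_norm_one_add_mul_I_rpow_mul hb)
    ((integrable_inv_one_add_sq_mul hk).const_mul _)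
    (fun τ => norm_one_add_mul_I_rpow_mul_le hb τ)).trans (le_of_eq ?_)
  rw [integral_const_mul, Measure.integral_comp_mul_left (fun x : ℝ => (1 + x ^ 2)⁻¹),
    integral_univ_inv_one_add_sq, abs_of_pos (by positivity), smul_eq_mul, mul_assoc]

theorem verticalMean_const_pos {b : ℝ} (hb : 0 < b) :
    0 < Real.Gamma b * b ^ (1 - b) / (2 * Real.pi) := by
  have := Real.Gamma_pos_of_pos hb
  positivity

/-- By Stirling the left side is `√b exp (stirlingRemainder b) / √(2π)`, and the exponential is at
most `2 ≤ √(2π)`. The `√b` offsets the width `b ^ (-1/2)` of the saddle. -/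
theorem verticalMean_const_mul_exp_le {b : ℝ} (hb : 2 ≤ b) :
    Real.Gamma b * b ^ (1 - b) / (2 * Real.pi) * Real.exp b ≤ √b := by
  have hb0 : 0 < b := by linarith
  have h1 := abs_le.1 (abs_exp_stirlingRemainder_sub_le hb)
  have h2 : Real.exp (stirlingRemainder b) ≤ 2 := by
    have h3 : 1 / (12 * b) ≤ 1 / 24 := by
      rw [div_le_div_iff₀ (by positivity) (by norm_num)]
      linarith
    have h4 : 2 / b ^ 2 ≤ 1 / 2 := by
      rw [div_le_div_iff₀ (by positivity) (by norm_num)]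
      nlinarith
    linarith [h1.2]
  have h5 : b ^ (b - 1 / 2) * b ^ (1 - b) = √b := by
    rw [← Real.rpow_add hb0, Real.sqrt_eq_rpow]
    congr 1
    ring
  have h6 : Real.exp (-b) * Real.exp b = 1 := by
    rw [← Real.exp_add]
    simp
  have h7 : 2 * Real.pi = √(2 * Real.pi) * √(2 * Real.pi) :=
    (Real.mul_self_sqrt (by positivity)).symm
  have h8 : 2 ≤ √(2 * Real.pi) := by
    rw [Real.le_sqrt' two_pos]
    linarith [Real.pi_gt_three]
  have h9 : Real.Gamma b * b ^ (1 - b) / (2 * Real.pi) * Real.exp b =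
      √b * (Real.exp (stirlingRemainder b) / √(2 * Real.pi)) := by
    rw [Gamma_eq_mul_exp_stirlingRemainder hb0]
    calc _ = (b ^ (b - 1 / 2) * b ^ (1 - b)) * (Real.exp (-b) * Real.exp b) *
          (Real.exp (stirlingRemainder b) * (√(2 * Real.pi) / (2 * Real.pi))) := by ring
      _ = _ := by
        rw [h5, h6, h7]
        field_simp
        norm_num
  rw [h9]
  refine mul_le_of_le_one_right (Real.sqrt_nonneg _) ?_
  rw [div_le_one (by positivity)]
  exact h2.trans h8

theorem norm_exp_mul_cpow_mul (b : ℝ) (u z : ℂ) :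
    ‖Complex.exp (b * u) * (u ^ (-(b : ℂ)) * z)‖ =
      Real.exp (b * u.re) * (‖u‖ ^ (-b) * ‖z‖) := by
  rw [norm_mul, norm_mul, Complex.norm_exp, ← Complex.ofReal_neg, Complex.norm_cpow_real]
  simp

/-- Sixth absolute moment on the line `re u = 1`. -/
theorem integral_norm_line_one_le {b C : ℝ} (hb : 8 ≤ b) (hC : 0 ≤ C) {s : Set ℝ}
    (hs : MeasurableSet s) {g : ℂ → ℂ}
    (hg : ∀ τ ∈ s, ‖g ((1 : ℂ) + τ * Complex.I)‖ ≤ C * |τ| ^ 6) :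
    Real.Gamma b * b ^ (1 - b) / (2 * Real.pi) *
      ‖∫ τ in s, Complex.exp (b * ((1 : ℂ) + τ * Complex.I)) *
      (((1 : ℂ) + τ * Complex.I) ^ (-(b : ℂ)) * g ((1 : ℂ) + τ * Complex.I))‖ ≤
      C * (512 * √8 * Real.pi) / b ^ 3 := by
  have hb0 : 0 < b := by linarith
  have hI := (integrable_norm_one_add_mul_I_rpow_mul hb).const_mul (Real.exp b * C)
  have h1 : ‖∫ τ in s, Complex.exp (b * ((1 : ℂ) + τ * Complex.I)) *
      (((1 : ℂ) + τ * Complex.I) ^ (-(b : ℂ)) * g ((1 : ℂ) + τ * Complex.I))‖ ≤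
      ∫ τ in s, Real.exp b * C * (‖(1 : ℂ) + τ * Complex.I‖ ^ (-b) * |τ| ^ 6) := by
    refine norm_integral_le_of_norm_le hI.integrableOn ?_
    filter_upwards [ae_restrict_mem hs] with τ hτ
    rw [norm_exp_mul_cpow_mul]
    have hre : ((1 : ℂ) + τ * Complex.I).re = 1 := by simp
    rw [hre, mul_one, mul_assoc, mul_left_comm C]
    have := hg τ hτ
    gcongr
  have h2 : ∫ τ in s, Real.exp b * C * (‖(1 : ℂ) + τ * Complex.I‖ ^ (-b) * |τ| ^ 6) ≤
      ∫ τ : ℝ, Real.exp b * C * (‖(1 : ℂ) + τ * Complex.I‖ ^ (-b) * |τ| ^ 6) :=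
    setIntegral_le_integral hI (Eventually.of_forall fun τ => by positivity)
  rw [integral_const_mul (μ := volume)] at h2
  have h3 := integral_norm_one_add_mul_I_rpow_mul_le hb
  have h4 := verticalMean_const_mul_exp_le (b := b) (by linarith)
  have h5 := verticalMean_const_pos hb0
  set κ := Real.Gamma b * b ^ (1 - b) / (2 * Real.pi)
  calc κ * ‖∫ τ in s, Complex.exp (b * ((1 : ℂ) + τ * Complex.I)) *
      (((1 : ℂ) + τ * Complex.I) ^ (-(b : ℂ)) * g ((1 : ℂ) + τ * Complex.I))‖
      ≤ κ * (Real.exp b * C * ((8 / b) ^ 3 * (√(b / 8))⁻¹ * Real.pi)) :=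
        mul_le_mul_of_nonneg_left ((h1.trans h2).trans (by gcongr)) h5.le
    _ = κ * Real.exp b * (C * ((8 / b) ^ 3 * (√(b / 8))⁻¹ * Real.pi)) := by ring
    _ ≤ √b * (C * ((8 / b) ^ 3 * (√(b / 8))⁻¹ * Real.pi)) := by gcongr
    _ = C * (512 * √8 * Real.pi) / b ^ 3 := by
        rw [Real.sqrt_div hb0.le]
        have : 0 < √b := Real.sqrt_pos.2 hb0
        field_simp
        norm_num

theorem norm_verticalMean_one_le {b C : ℝ} (hb : 8 ≤ b) (hC : 0 ≤ C) {g : ℂ → ℂ}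
    (hg : ∀ τ : ℝ, ‖g ((1 : ℂ) + τ * Complex.I)‖ ≤ C * |τ| ^ 6) :
    ‖verticalMean b 1 g‖ ≤ C * (512 * √8 * Real.pi) / b ^ 3 := by
  have h := integral_norm_line_one_le hb hC MeasurableSet.univ (g := g) (fun τ _ => hg τ)
  rw [setIntegral_univ] at h
  rw [verticalMean, norm_mul, Complex.norm_real, Real.norm_of_nonneg
    (verticalMean_const_pos (by linarith)).le, Complex.ofReal_one]
  exact h

/-! ### Moving the contour below `ξ`. -/

theorem exists_sqrt_mul_rpow_le {q : ℝ} (hq0 : 0 < q) (hq1 : q < 1) :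
    ∃ C, 0 ≤ C ∧ ∀ b : ℝ, 1 ≤ b → √b * q ^ b ≤ C / b ^ 3 := by
  set l := -Real.log q with hl
  have hlpos : 0 < l := neg_pos.2 (Real.log_neg hq0 hq1)
  refine ⟨24 / l ^ 4, by positivity, fun b hb => ?_⟩
  have hb0 : 0 < b := by linarith
  have h1 : q ^ b = (Real.exp (l * b))⁻¹ := by
    rw [Real.rpow_def_of_pos hq0, ← Real.exp_neg, hl]
    congr 1
    ring
  have h2 := Real.pow_div_factorial_le_exp (l * b) (by positivity) 4
  have h3 : √b ≤ b := by
    rw [Real.sqrt_le_left (by linarith)]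
    nlinarith
  calc √b * q ^ b ≤ b * ((l * b) ^ 4 / (Nat.factorial 4 : ℕ))⁻¹ := by
        rw [h1]
        gcongr
    _ = 24 / l ^ 4 / b ^ 3 := by
        rw [show ((Nat.factorial 4 : ℕ) : ℝ) = 24 by norm_num [Nat.factorial]]
        field_simp

theorem norm_sub_one_le_norm {u : ℂ} (hu : 1 ≤ u.re) : ‖u - 1‖ ≤ ‖u‖ := by
  refine le_of_sq_le_sq ?_ (norm_nonneg _)
  rw [← Complex.normSq_eq_norm_sq, ← Complex.normSq_eq_norm_sq, Complex.normSq_apply,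
    Complex.normSq_apply, Complex.sub_re, Complex.sub_im, Complex.one_re, Complex.one_im]
  nlinarith

theorem norm_exp_mul_cpow_mul_le {b C : ℝ} {u z : ℂ} (hC : 0 ≤ C) (hu : 1 ≤ u.re)
    (hz : ‖z‖ ≤ C * ‖u - 1‖ ^ 6) :
    ‖Complex.exp (b * u) * (u ^ (-(b : ℂ)) * z)‖ ≤
      C * (Real.exp (b * u.re) * (‖u‖ ^ (-b) * ‖u‖ ^ 6)) := by
  rw [norm_exp_mul_cpow_mul]
  have h : ‖z‖ ≤ C * ‖u‖ ^ 6 := hz.trans (by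
    have := norm_sub_one_le_norm hu
    gcongr)
  calc _ ≤ Real.exp (b * u.re) * (‖u‖ ^ (-b) * (C * ‖u‖ ^ 6)) := by gcongr
    _ = _ := by ring

/-- Moving the lower part of the line `re u = c` to `re u = 1`. -/
theorem norm_setIntegral_Iic_vertical_le {b C c η : ℝ} (hb : 8 ≤ b) (hC : 0 ≤ C) (hc : 1 < c)
    {g : ℂ → ℂ} (hmeas : Measurable g)
    (hint : Integrable fun τ : ℝ => ((c : ℂ) + τ * Complex.I) ^ (-(b : ℂ)) *
      g ((c : ℂ) + τ * Complex.I))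
    (hdiff : DifferentiableOn ℂ g {u | 1 ≤ u.re ∧ u.im ≤ η})
    (hg : ∀ u : ℂ, 1 ≤ u.re → u.im ≤ η → ‖g u‖ ≤ C * ‖u - 1‖ ^ 6) :
    ‖∫ τ in Iic η, Complex.exp (b * ((c : ℂ) + τ * Complex.I)) *
      (((c : ℂ) + τ * Complex.I) ^ (-(b : ℂ)) * g ((c : ℂ) + τ * Complex.I))‖ ≤
    ‖∫ τ in Iic η, Complex.exp (b * ((1 : ℂ) + τ * Complex.I)) *
      (((1 : ℂ) + τ * Complex.I) ^ (-(b : ℂ)) * g ((1 : ℂ) + τ * Complex.I))‖ +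
    ‖∫ r in (1 : ℝ)..c, Complex.exp (b * ((r : ℂ) + η * Complex.I)) *
      (((r : ℂ) + η * Complex.I) ^ (-(b : ℂ)) * g ((r : ℂ) + η * Complex.I))‖ := by
  set G : ℂ → ℂ := fun u => Complex.exp (b * u) * (u ^ (-(b : ℂ)) * g u) with hG
  have hGmeas : Measurable G := by fun_prop
  have hGdiff : DifferentiableOn ℂ G {u | 1 ≤ u.re ∧ u.im ≤ η} := by
    refine DifferentiableOn.mul (by fun_prop) (DifferentiableOn.mul ?_ hdiff)
    intro u hu
    refine DifferentiableAt.differentiableWithinAt ?_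
    exact differentiableAt_id.cpow_const (Or.inl (by simpa using one_pos.trans_le hu.1))
  have hG1 : ∀ u : ℂ, 1 ≤ u.re → u.im ≤ η →
      ‖G u‖ ≤ C * (Real.exp (b * u.re) * (‖u‖ ^ (-b) * ‖u‖ ^ 6)) := fun u h1 h2 =>
    norm_exp_mul_cpow_mul_le hC h1 (hg u h1 h2)
  have hIc : IntegrableOn (fun τ : ℝ => G ((c : ℂ) + τ * Complex.I)) (Iic η) :=
    (integrable_exp_mul_vertical hint).integrableOn
  have hI1 : IntegrableOn (fun τ : ℝ => G ((1 : ℂ) + τ * Complex.I)) (Iic η) := by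
    refine ((integrable_norm_one_add_mul_I_rpow_mul hb).const_mul
      (Real.exp b * C)).integrableOn.mono'
      (hGmeas.comp (by fun_prop)).aestronglyMeasurable ?_
    filter_upwards [ae_restrict_mem measurableSet_Iic] with τ hτ
    rw [hG, norm_exp_mul_cpow_mul]
    have h2 := hg ((1 : ℂ) + τ * Complex.I) (by simp) (by simpa using hτ)
    have h3 : ‖(1 : ℂ) + τ * Complex.I - 1‖ = |τ| := by simp
    rw [h3] at h2
    have h4 : b * ((1 : ℂ) + τ * Complex.I).re = b := by simp
    rw [h4, mul_assoc, mul_left_comm C]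
    gcongr
  -- Cauchy's theorem on the rectangle `[1, c] × [-N, η]`.
  have hrect : ∀ N : ℝ, -N ≤ η → ‖∫ τ in (-N)..η, G ((c : ℂ) + τ * Complex.I)‖ ≤
      ‖∫ τ in (-N)..η, G ((1 : ℂ) + τ * Complex.I)‖ +
      ‖∫ r in (1 : ℝ)..c, G ((r : ℂ) + η * Complex.I)‖ +
      ‖∫ r in (1 : ℝ)..c, G ((r : ℂ) + (-N : ℝ) * Complex.I)‖ := by
    intro N hN
    have h := Complex.integral_boundary_rect_eq_zero_of_differentiableOn G
      (((1 : ℝ) : ℂ) + (-N : ℝ) * Complex.I) ((c : ℂ) + η * Complex.I) (hGdiff.mono ?_)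
    · have e1 : (((1 : ℝ) : ℂ) + (-N : ℝ) * Complex.I).re = 1 := by simp
      have e2 : (((1 : ℝ) : ℂ) + (-N : ℝ) * Complex.I).im = -N := by simp
      have e3 : ((c : ℂ) + η * Complex.I).re = c := by simp
      have e4 : ((c : ℂ) + η * Complex.I).im = η := by simp
      rw [e1, e2, e3, e4, smul_eq_mul, smul_eq_mul, Complex.ofReal_one] at h
      set A := ∫ τ in (-N)..η, G ((c : ℂ) + τ * Complex.I)
      set A1 := ∫ τ in (-N)..η, G ((1 : ℂ) + τ * Complex.I)
      set B := ∫ r in (1 : ℝ)..c, G ((r : ℂ) + η * Complex.I)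
      set D := ∫ r in (1 : ℝ)..c, G ((r : ℂ) + (-N : ℝ) * Complex.I)
      have h2 : Complex.I * A = Complex.I * A1 + B - D := by linear_combination h
      have h3 : ‖Complex.I * A‖ = ‖A‖ := by simp
      have h4 : ‖Complex.I * A1‖ = ‖A1‖ := by simp
      rw [← h3, h2, ← h4]
      exact (norm_sub_le _ _).trans (by gcongr; exact norm_add_le _ _)
    · intro u hu
      obtain ⟨h1, h2⟩ := hu
      simp only [mem_preimage, Complex.add_re, Complex.add_im, Complex.mul_re, Complex.mul_im,
        Complex.ofReal_re, Complex.ofReal_im, Complex.I_re, Complex.I_im, mul_zero, mul_one,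
        sub_zero, add_zero, zero_add] at h1 h2
      rw [uIcc_of_le hc.le] at h1
      rw [uIcc_of_le hN] at h2
      exact ⟨h1.1, h2.2⟩
  -- The bottom side is `O(N ^ (-(b - 6)))`: `g` grows at most like `‖u‖ ^ 6`, and `b ≥ 8`.
  have hbot : Tendsto (fun N : ℝ => ‖∫ r in (1 : ℝ)..c, G ((r : ℂ) + (-N : ℝ) * Complex.I)‖)
      atTop (𝓝 0) := by
    have hup : Tendsto (fun N : ℝ => C * Real.exp (b * c) * N ^ (-(b - 6)) * |c - 1|) atTop
        (𝓝 0) := by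
      simpa using ((tendsto_rpow_neg_atTop (y := b - 6) (by linarith)).const_mul
        (C * Real.exp (b * c))).mul_const |c - 1|
    refine tendsto_of_tendsto_of_tendsto_of_le_of_le' tendsto_const_nhds hup
      (Eventually.of_forall fun _ => norm_nonneg _) ?_
    filter_upwards [eventually_gt_atTop 0, eventually_ge_atTop (-η)] with N hN hN2
    refine intervalIntegral.norm_integral_le_of_norm_le_const fun r hr => ?_
    rw [uIoc_of_le hc.le] at hr
    have e1 : ((r : ℂ) + (-N : ℝ) * Complex.I).re = r := by simp
    have e2 : ((r : ℂ) + (-N : ℝ) * Complex.I).im = -N := by simp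
    have h1 := hG1 ((r : ℂ) + (-N : ℝ) * Complex.I) (by rw [e1]; exact hr.1.le)
      (by rw [e2]; linarith)
    rw [e1] at h1
    have h2 : N ≤ ‖(r : ℂ) + (-N : ℝ) * Complex.I‖ := by
      have := Complex.abs_im_le_norm ((r : ℂ) + (-N : ℝ) * Complex.I)
      rwa [e2, abs_neg, abs_of_pos hN] at this
    set u := (r : ℂ) + (-N : ℝ) * Complex.I
    have hu : 0 < ‖u‖ := hN.trans_le h2
    have h3 : ‖u‖ ^ (-b) * ‖u‖ ^ 6 = ‖u‖ ^ (-(b - 6)) := by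
      rw [← Real.rpow_natCast, ← Real.rpow_add hu]
      congr 1
      push_cast
      ring
    rw [h3] at h1
    have h4 : ‖u‖ ^ (-(b - 6)) ≤ N ^ (-(b - 6)) :=
      Real.rpow_le_rpow_of_nonpos hN h2 (by linarith)
    have h5 : Real.exp (b * r) ≤ Real.exp (b * c) := by
      have := hr.2
      gcongr
    refine h1.trans ?_
    rw [mul_assoc]
    gcongr
  have l1 := (intervalIntegral_tendsto_integral_Iic η hIc tendsto_neg_atTop_atBot).norm
  have l2 := (intervalIntegral_tendsto_integral_Iic η hI1 tendsto_neg_atTop_atBot).norm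
  have l3 := (l2.add_const ‖∫ r in (1 : ℝ)..c, G ((r : ℂ) + η * Complex.I)‖).add hbot
  rw [add_zero] at l3
  refine le_of_tendsto_of_tendsto l1 l3 ?_
  filter_upwards [eventually_ge_atTop (-η)] with N hN
  exact hrect N (by linarith)

/-- The path goes up `re u = 1` to height `η`, right to `re u = c`, then up. The first piece is
controlled by the sixth moment; on the other two `‖exp (u - 1) / u‖ ≤ q`, which yields the term in
`q ^ b`. -/
theorem norm_verticalMean_shift_le {b C c η q : ℝ} (hb : 8 ≤ b) (hC : 0 ≤ C) (hc : 1 < c)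
    (hη : 0 < η) (hq0 : 0 < q)
    (hq : ∀ r ∈ Icc 1 c, Real.exp (r - 1) ≤ q * ‖(r : ℂ) + η * Complex.I‖)
    {g : ℂ → ℂ} (hmeas : Measurable g)
    (hint : Integrable fun τ : ℝ => ((c : ℂ) + τ * Complex.I) ^ (-(b : ℂ)) *
      g ((c : ℂ) + τ * Complex.I))
    (hdiff : DifferentiableOn ℂ g {u | 1 ≤ u.re ∧ u.im ≤ η})
    (hg : ∀ u : ℂ, 1 ≤ u.re → u.im ≤ η → ‖g u‖ ≤ C * ‖u - 1‖ ^ 6)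
    (hg' : ∀ τ : ℝ, η ≤ τ →
      ‖g ((c : ℂ) + τ * Complex.I)‖ ≤ C * ‖(c : ℂ) + τ * Complex.I - 1‖ ^ 6) :
    ‖verticalMean b c g‖ ≤ C * (512 * √8 * Real.pi) / b ^ 3 + √b * q ^ b *
      (C * ((c + η) ^ 6 * (c - 1) + Real.exp (c - 1) ^ 8 / q ^ 8 *
        ∫ τ : ℝ, ‖(c : ℂ) + τ * Complex.I‖ ^ (-2 : ℝ))) := by
  have hb0 : 0 < b := by linarith
  set G : ℂ → ℂ := fun u => Complex.exp (b * u) * (u ^ (-(b : ℂ)) * g u) with hG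
  have hIc : Integrable fun τ : ℝ => G ((c : ℂ) + τ * Complex.I) := integrable_exp_mul_vertical hint
  have hdecay : ∀ (p : ℝ) (u : ℂ), 0 ≤ p → 0 < ‖u‖ → Real.exp (u.re - 1) ≤ q * ‖u‖ →
      Real.exp (p * (u.re - 1)) * ‖u‖ ^ (-p) ≤ q ^ p := by
    intro p u hp hu h
    rw [mul_comm p, Real.exp_mul, Real.rpow_neg hu.le, ← div_eq_mul_inv, ← Real.div_rpow
      (Real.exp_pos _).le hu.le]
    exact Real.rpow_le_rpow (by positivity) ((div_le_iff₀ hu).2 h) hp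
  have hhor : ‖∫ r in (1 : ℝ)..c, G ((r : ℂ) + η * Complex.I)‖ ≤
      Real.exp b * (q ^ b * (C * ((c + η) ^ 6 * (c - 1)))) := by
    refine (intervalIntegral.norm_integral_le_of_norm_le_const
      (C := Real.exp b * (q ^ b * (C * (c + η) ^ 6))) fun r hr => ?_).trans (le_of_eq ?_)
    · rw [uIoc_of_le hc.le] at hr
      have e1 : ((r : ℂ) + η * Complex.I).re = r := by simp
      have e2 : ((r : ℂ) + η * Complex.I).im = η := by simp
      have hr1 : 1 ≤ ((r : ℂ) + η * Complex.I).re := by rw [e1]; exact hr.1.le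
      have h1 := norm_exp_mul_cpow_mul_le (b := b) hC hr1 (hg _ hr1 e2.le)
      have hu : 0 < ‖(r : ℂ) + η * Complex.I‖ := one_pos.trans_le (hr1.trans (Complex.re_le_norm _))
      have h2 := hdecay b ((r : ℂ) + η * Complex.I) hb0.le hu
        (by rw [e1]; exact hq r ⟨hr.1.le, hr.2⟩)
      have h3 : ‖(r : ℂ) + η * Complex.I‖ ≤ c + η := by
        refine (norm_add_le _ _).trans ?_
        simp only [norm_mul, Complex.norm_real, Complex.norm_I, mul_one, Real.norm_eq_abs]
        rw [abs_of_pos hη, abs_of_pos (by linarith [hr.1])]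
        linarith [hr.2]
      set u := (r : ℂ) + η * Complex.I
      have h4 : Real.exp (b * u.re) = Real.exp b * Real.exp (b * (u.re - 1)) := by
        rw [← Real.exp_add]
        congr 1
        ring
      calc ‖G u‖ ≤ C * (Real.exp (b * u.re) * (‖u‖ ^ (-b) * ‖u‖ ^ 6)) := h1
        _ = Real.exp b * (Real.exp (b * (u.re - 1)) * ‖u‖ ^ (-b) * (C * ‖u‖ ^ 6)) := by
            rw [h4]
            ring
        _ ≤ _ := by gcongr
    · rw [abs_of_pos (by linarith)]
      ring
  have hver : ‖∫ τ in Ioi η, G ((c : ℂ) + τ * Complex.I)‖ ≤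
      Real.exp b * (q ^ b * (C * (Real.exp (c - 1) ^ 8 / q ^ 8 *
        ∫ τ : ℝ, ‖(c : ℂ) + τ * Complex.I‖ ^ (-2 : ℝ)))) := by
    have hI2 := (integrable_norm_vertical_rpow (b := 2) (by linarith : 0 < c) (by norm_num)).const_mul
      (Real.exp b * (q ^ b * (C * (Real.exp (c - 1) ^ 8 / q ^ 8))))
    have h1 : ‖∫ τ in Ioi η, G ((c : ℂ) + τ * Complex.I)‖ ≤ ∫ τ in Ioi η,
        Real.exp b * (q ^ b * (C * (Real.exp (c - 1) ^ 8 / q ^ 8))) *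
          ‖(c : ℂ) + τ * Complex.I‖ ^ (-2 : ℝ) := by
      refine norm_integral_le_of_norm_le hI2.integrableOn ?_
      filter_upwards [ae_restrict_mem measurableSet_Ioi] with τ hτ
      have e1 : ((c : ℂ) + τ * Complex.I).re = c := by simp
      have hr1 : 1 ≤ ((c : ℂ) + τ * Complex.I).re := by rw [e1]; exact hc.le
      have h2 := norm_exp_mul_cpow_mul_le (b := b) hC hr1 (hg' τ (le_of_lt hτ))
      have hu : 0 < ‖(c : ℂ) + τ * Complex.I‖ := one_pos.trans_le (hr1.trans (Complex.re_le_norm _))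
      -- Going up with `re u = c` fixed only increases `‖u‖`, so the bound by `q` at the corner
      -- persists.
      have h3 : ‖(c : ℂ) + η * Complex.I‖ ≤ ‖(c : ℂ) + τ * Complex.I‖ := by
        refine le_of_sq_le_sq ?_ (norm_nonneg _)
        rw [sq_norm_add_mul_I, sq_norm_add_mul_I]
        have : η < τ := hτ
        nlinarith
      -- Only `b - 8` powers are spent on `q`. Of the other eight powers of `1 / ‖u‖`, six cancel
      -- the growth of `g` and two leave the integrable `‖u‖ ^ (-2)`; hence the factor `exp (c - 1)
      -- ^ 8 / q ^ 8`.
      have h4 := hdecay (b - 8) ((c : ℂ) + τ * Complex.I) (by linarith) hu (by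
        rw [e1]
        refine (hq c ⟨hc.le, le_rfl⟩).trans ?_
        gcongr)
      rw [e1] at h2 h4
      set u := (c : ℂ) + τ * Complex.I
      have h5 : Real.exp (b * c) = Real.exp b * (Real.exp ((b - 8) * (c - 1)) *
          Real.exp (c - 1) ^ 8) := by
        rw [← Real.exp_nat_mul, ← Real.exp_add, ← Real.exp_add]
        congr 1
        push_cast
        ring
      have h6 : ‖u‖ ^ (-b) * ‖u‖ ^ 6 = ‖u‖ ^ (-(b - 8)) * ‖u‖ ^ (-2 : ℝ) := by
        rw [← Real.rpow_natCast, ← Real.rpow_add hu, ← Real.rpow_add hu]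
        congr 1
        push_cast
        ring
      have h7 : q ^ (b - 8) = q ^ b / q ^ 8 := by
        rw [Real.rpow_sub hq0]
        norm_cast
      rw [h7] at h4
      calc ‖G u‖ ≤ C * (Real.exp (b * c) * (‖u‖ ^ (-b) * ‖u‖ ^ 6)) := h2
        _ = (Real.exp ((b - 8) * (c - 1)) * ‖u‖ ^ (-(b - 8))) *
            (Real.exp b * C * Real.exp (c - 1) ^ 8 * ‖u‖ ^ (-2 : ℝ)) := by
            rw [h5, h6]
            ring
        _ ≤ q ^ b / q ^ 8 * (Real.exp b * C * Real.exp (c - 1) ^ 8 * ‖u‖ ^ (-2 : ℝ)) := by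
            gcongr
        _ = _ := by ring
    refine h1.trans ((setIntegral_le_integral hI2
      (Eventually.of_forall fun τ => by positivity)).trans (le_of_eq ?_))
    rw [integral_const_mul]
    ring
  have hlow := norm_setIntegral_Iic_vertical_le hb hC hc hmeas hint hdiff hg
  have hone := integral_norm_line_one_le hb hC (measurableSet_Iic (a := η)) (g := g)
    (fun τ hτ => (hg _ (by simp) (by simpa using hτ)).trans (le_of_eq (by simp)))
  have hκ := verticalMean_const_pos hb0
  have hκe := verticalMean_const_mul_exp_le (b := b) (by linarith)
  have hsplit : ∫ τ : ℝ, G ((c : ℂ) + τ * Complex.I) = (∫ τ in Iic η, G ((c : ℂ) + τ * Complex.I)) +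
      ∫ τ in Ioi η, G ((c : ℂ) + τ * Complex.I) :=
    (intervalIntegral.integral_Iic_add_Ioi hIc.integrableOn hIc.integrableOn).symm
  rw [verticalMean, norm_mul, Complex.norm_real, Real.norm_of_nonneg hκ.le]
  change _ * ‖∫ τ : ℝ, G ((c : ℂ) + τ * Complex.I)‖ ≤ _
  rw [hsplit]
  set κ := Real.Gamma b * b ^ (1 - b) / (2 * Real.pi)
  set J1 := ‖∫ τ in Iic η, Complex.exp (b * ((1 : ℂ) + τ * Complex.I)) *
      (((1 : ℂ) + τ * Complex.I) ^ (-(b : ℂ)) * g ((1 : ℂ) + τ * Complex.I))‖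
  set K1 := (c + η) ^ 6 * (c - 1)
  set K2 := Real.exp (c - 1) ^ 8 / q ^ 8 * ∫ τ : ℝ, ‖(c : ℂ) + τ * Complex.I‖ ^ (-2 : ℝ)
  have hK1 : 0 ≤ K1 := mul_nonneg (by positivity) (by linarith)
  have hK2 : 0 ≤ K2 := mul_nonneg (by positivity) (integral_nonneg fun τ => by positivity)
  calc κ * ‖(∫ τ in Iic η, G ((c : ℂ) + τ * Complex.I)) +
      ∫ τ in Ioi η, G ((c : ℂ) + τ * Complex.I)‖
      ≤ κ * ((J1 + Real.exp b * (q ^ b * (C * K1))) + Real.exp b * (q ^ b * (C * K2))) := by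
        refine mul_le_mul_of_nonneg_left ((norm_add_le _ _).trans (add_le_add (hlow.trans ?_) hver))
          hκ.le
        exact add_le_add le_rfl hhor
    _ = κ * J1 + κ * Real.exp b * (q ^ b * (C * (K1 + K2))) := by ring
    _ ≤ C * (512 * √8 * Real.pi) / b ^ 3 + √b * (q ^ b * (C * (K1 + K2))) := by gcongr
    _ = _ := by ring

/-! ### The error bound near each point of `𝒜`. -/

theorem measurable_kernelRemainder (a : ℝ) (ξ : ℂ) :
    Measurable fun u => kernelFactor a ξ u - kernelTaylor a ξ u⁻¹ := by
  unfold kernelFactor kernelTaylor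
  fun_prop

/-- The error of the sixth order approximation to `₁F₁(a; b; b ξ)` by central moments. -/
noncomputable def kummerError (a b : ℝ) (ξ : ℂ) : ℂ :=
  confluentHypergeometric a b (b * ξ) - (1 - ξ) ^ (-(a : ℂ)) *
    ∑ j ∈ Finset.range 6, Ring.choose (-(a : ℂ)) j * (-(ξ / (1 - ξ))) ^ j * (centralMoment b j : ℂ)

/-- The line `re u = 1` already lies to the right of all `ξ` near `ξ₀`, at distance at least `d`, so
no contour has to be moved. -/
theorem exists_norm_kummerError_le_of_re_lt_one {a : ℝ} (ha : 0 < a) {ξ₀ : ℂ} (hξ₀ : ξ₀.re < 1) :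
    ∃ C, ∀ᶠ ξ in 𝓝 ξ₀, ∀ b : ℝ, max 8 (a + 1) ≤ b → ‖kummerError a b ξ‖ ≤ C / b ^ 3 := by
  set d := (1 - ξ₀.re) / 2 with hd
  have hd0 : 0 < d := by rw [hd]; linarith
  have hslit : 1 - ξ₀ ∈ Complex.slitPlane := Or.inl (by simpa using hξ₀)
  obtain ⟨C, hC, h⟩ := exists_kernelFactor_sub_kernelTaylor_le ha hslit hd0
  refine ⟨C * (512 * √8 * Real.pi), ?_⟩
  have hre : ∀ᶠ ξ : ℂ in 𝓝 ξ₀, ξ.re < 1 - d :=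
    Complex.continuous_re.continuousAt.eventually_lt_const (by rw [hd]; linarith)
  filter_upwards [h, hre] with ξ h1 h2 b hb
  have hb8 : 8 ≤ b := (le_max_left _ _).trans hb
  have hab : a < b := by linarith [(le_max_right _ _).trans hb]
  have hξ : ξ.re < 1 := by linarith
  rw [kummerError, confluentHypergeometric_sub_eq_verticalMean ha hab (by linarith) one_pos hξ]
  refine norm_verticalMean_one_le hb8 hC fun τ => ?_
  have e1 : ((1 : ℂ) + τ * Complex.I).re = 1 := by simp
  refine (h1 _ e1.ge ?_).trans (le_of_eq (by simp))
  have := sub_re_le_norm_vertical 1 ξ τ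
  rw [Complex.ofReal_one] at this
  linarith

/-- On the horizontal segment `‖exp (u - 1) / u‖` is largest at the right end. With `h = c - r` this
reduces to `(r + h) ^ 2 + η ^ 2 ≤ exp (2 h) (r ^ 2 + η ^ 2)`, which follows from `exp (2 h) ≥ 1 + 2
h + 2 h ^ 2` and `r ≥ 1`. -/
theorem exp_sub_one_le_mul_norm {c η r : ℝ} (hη : 0 < η) (hr : r ∈ Icc 1 c) :
    Real.exp (r - 1) ≤ Real.exp (c - 1) / ‖(c : ℂ) + η * Complex.I‖ * ‖(r : ℂ) + η * Complex.I‖ := by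
  have hpos : ∀ x : ℝ, 0 < ‖(x : ℂ) + η * Complex.I‖ := by
    intro x
    rw [norm_pos_iff]
    intro h
    have := congrArg Complex.im h
    simp at this
    exact hη.ne' this
  have hc := hpos c
  rw [div_mul_eq_mul_div, le_div_iff₀ hc]
  refine le_of_sq_le_sq ?_ (by positivity)
  rw [mul_pow, mul_pow, sq_norm_add_mul_I, sq_norm_add_mul_I]
  obtain ⟨h1, h2⟩ := hr
  set h := c - r with hh
  have hh0 : 0 ≤ h := by linarith
  have he : Real.exp (c - 1) = Real.exp (r - 1) * Real.exp h := by
    rw [← Real.exp_add]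
    congr 1
    rw [hh]
    ring
  rw [he, mul_pow, mul_assoc]
  refine mul_le_mul_of_nonneg_left ?_ (by positivity)
  have h3 := Real.quadratic_le_exp_of_nonneg (x := 2 * h) (by positivity)
  have h4 : Real.exp h ^ 2 = Real.exp (2 * h) := by
    rw [← Real.exp_nat_mul]
    norm_num
  have hcr : c = r + h := by rw [hh]; ring
  rw [h4]
  have h5 : (1 + 2 * h + (2 * h) ^ 2 / 2) * (r ^ 2 + η ^ 2) ≤
      Real.exp (2 * h) * (r ^ 2 + η ^ 2) := by gcongr
  refine le_trans ?_ h5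
  rw [hcr]
  have h6 : 0 ≤ h * (r - 1) * r := mul_nonneg (mul_nonneg hh0 (by linarith)) (by linarith)
  have h7 : 0 ≤ h * η ^ 2 := by positivity
  have h8 : 0 ≤ h ^ 2 * η ^ 2 := by positivity
  have h9 : h ^ 2 ≤ h ^ 2 * r ^ 2 := le_mul_of_one_le_right (by positivity) (one_le_pow₀ h1)
  nlinarith

/-- The hypothesis says `exp (re ξ₀ - 1) < ‖ξ₀‖`. By continuity it persists at a corner `c + iη`
slightly to the right of and below `ξ₀`, and there it is the statement `q < 1`. -/
theorem exists_norm_kummerError_le_of_im_pos {a : ℝ} (ha : 0 < a) {ξ₀ : ℂ} (hre : 1 ≤ ξ₀.re)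
    (him : 0 < ξ₀.im) (h : ξ₀.re - 1 - 1 / 2 * Real.log (ξ₀.re ^ 2 + ξ₀.im ^ 2) < 0) :
    ∃ C, ∀ᶠ ξ in 𝓝 ξ₀, ∀ b : ℝ, max 8 (a + 1) ≤ b → ‖kummerError a b ξ‖ ≤ C / b ^ 3 := by
  obtain ⟨s, hs0, hsim, hs⟩ : ∃ s : ℝ, 0 < s ∧ s < ξ₀.im ∧
      Real.exp (2 * (ξ₀.re + s - 1)) < (ξ₀.re + s) ^ 2 + (ξ₀.im - s) ^ 2 := by
    have h0 : Real.exp (2 * (ξ₀.re + 0 - 1)) < (ξ₀.re + 0) ^ 2 + (ξ₀.im - 0) ^ 2 := by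
      rw [add_zero, sub_zero, ← Real.lt_log_iff_exp_lt (by positivity)]
      linarith
    have hc1 : ContinuousAt (fun s : ℝ => Real.exp (2 * (ξ₀.re + s - 1))) 0 := by fun_prop
    have hc2 : ContinuousAt (fun s : ℝ => (ξ₀.re + s) ^ 2 + (ξ₀.im - s) ^ 2) 0 := by fun_prop
    have ev := (hc1.eventually_lt hc2 h0).filter_mono (nhdsWithin_le_nhds (s := Ioi 0))
    obtain ⟨s, ⟨h1, h2⟩, h3⟩ := ((ev.and ((eventually_lt_nhds him).filter_mono
      nhdsWithin_le_nhds)).and self_mem_nhdsWithin).exists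
    exact ⟨s, h3, h2, h1⟩
  set c := ξ₀.re + s with hcdef
  set η := ξ₀.im - s with hηdef
  have hc : 1 < c := by linarith
  have hη : 0 < η := by linarith
  set q := Real.exp (c - 1) / ‖(c : ℂ) + η * Complex.I‖ with hq
  have hnorm : 0 < ‖(c : ℂ) + η * Complex.I‖ :=
    norm_pos_iff.2 (add_mul_I_ne_zero (by linarith) η)
  have hq0 : 0 < q := by positivity
  have hq1 : q < 1 := by
    rw [hq, div_lt_one hnorm]
    refine lt_of_pow_lt_pow_left₀ 2 hnorm.le ?_
    rw [sq_norm_add_mul_I, ← Real.exp_nat_mul]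
    exact_mod_cast hs
  set d := s / 2 with hd
  have hd0 : 0 < d := by positivity
  have hslit : 1 - ξ₀ ∈ Complex.slitPlane := Or.inr (by simpa using him.ne')
  obtain ⟨C, hC, hT⟩ := exists_kernelFactor_sub_kernelTaylor_le ha hslit hd0
  obtain ⟨D, hD, hexp⟩ := exists_sqrt_mul_rpow_le hq0 hq1
  set K := C * ((c + η) ^ 6 * (c - 1) + Real.exp (c - 1) ^ 8 / q ^ 8 *
        ∫ τ : ℝ, ‖(c : ℂ) + τ * Complex.I‖ ^ (-2 : ℝ)) with hK
  have hK0 : 0 ≤ K := by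
    refine mul_nonneg hC (add_nonneg (mul_nonneg (by positivity) (by linarith))
      (mul_nonneg (by positivity) (integral_nonneg fun τ => by positivity)))
  refine ⟨C * (512 * √8 * Real.pi) + D * K, ?_⟩
  have e1 : ∀ᶠ ξ : ℂ in 𝓝 ξ₀, ξ.re < c - d :=
    Complex.continuous_re.continuousAt.eventually_lt_const (by rw [hd, hcdef]; linarith)
  have e2 : ∀ᶠ ξ : ℂ in 𝓝 ξ₀, η + d < ξ.im :=
    Complex.continuous_im.continuousAt.eventually_const_lt (by rw [hd, hηdef]; linarith)
  filter_upwards [hT, e1, e2] with ξ h1 h2 h3 b hb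
  have hb8 : 8 ≤ b := (le_max_left _ _).trans hb
  have hab : a < b := by linarith [(le_max_right _ _).trans hb]
  have hξ : ξ.re < c := by linarith
  have hc0 : 0 < c := by linarith
  have hlow : ∀ u : ℂ, u.im ≤ η → d ≤ ‖u - ξ‖ := by
    intro u hu
    have := (abs_le.1 (Complex.abs_im_le_norm (u - ξ))).1
    rw [Complex.sub_im] at this
    linarith
  rw [kummerError, confluentHypergeometric_sub_eq_verticalMean ha hab (by linarith) hc0 hξ]
  refine (norm_verticalMean_shift_le hb8 hC hc hη hq0
    (fun r hr => exp_sub_one_le_mul_norm hη hr) (measurable_kernelRemainder a ξ) ?_ ?_ ?_ ?_).trans ?_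
  · simp_rw [mul_sub]
    exact (integrable_kernel_vertical ha (by linarith) hc0 hξ).sub
      (integrable_cpow_mul_kernelTaylor a (by linarith) hc0 ξ)
  -- The cut of `(u - ξ) ^ (-a)` runs leftwards from `ξ` at height `im ξ > η`, hence above the
  -- region swept by the contour.
  · intro u hu
    refine DifferentiableAt.differentiableWithinAt ?_
    have hu0 : u ∈ Complex.slitPlane := Or.inl (one_pos.trans_le hu.1)
    have huξ : u - ξ ∈ Complex.slitPlane := by
      refine Or.inr ?_
      rw [Complex.sub_im]
      have := hu.2
      intro h0
      linarith
    have hne := Complex.slitPlane_ne_zero hu0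
    refine DifferentiableAt.sub ?_ ?_
    · have h4 : DifferentiableAt ℂ (fun u : ℂ => (u - ξ) ^ (-(a : ℂ))) u :=
        DifferentiableAt.cpow_const (by fun_prop) huξ
      exact h4.mul (differentiableAt_fun_id.cpow_const hu0)
    · simp_rw [kernelTaylor_eq]
      refine DifferentiableAt.fun_sum fun j _ => ?_
      exact (((differentiableAt_inv hne).sub_const 1).pow j).const_mul _
  · exact fun u hu1 hu2 => h1 u hu1 (hlow u hu2)
  · intro τ _
    refine h1 _ (by simpa using hc.le) ?_
    have := sub_re_le_norm_vertical c ξ τ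
    linarith
  · have hb1 : 1 ≤ b := by linarith
    calc _ ≤ C * (512 * √8 * Real.pi) / b ^ 3 + D / b ^ 3 * K :=
          add_le_add le_rfl (mul_le_mul_of_nonneg_right (hexp b hb1) hK0)
      _ = _ := by ring

theorem confluentHypergeometric_conj (a b : ℝ) (z : ℂ) :
    confluentHypergeometric a b (conj z) = conj (confluentHypergeometric a b z) := by
  have hasc : ∀ (x : ℝ) (k : ℕ), conj ((ascPochhammer ℂ k).eval (x : ℂ)) =
      (ascPochhammer ℂ k).eval (x : ℂ) := by
    intro x k
    induction k with
    | zero => simp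
    | succ k ih => simp [ascPochhammer_succ_eval, ih]
  rw [confluentHypergeometric, confluentHypergeometric, Complex.conj_tsum]
  refine tsum_congr fun k => ?_
  simp [confluentTerm, hasc]

theorem kummerError_conj (a b : ℝ) {ξ : ℂ} (hξ : 1 - ξ ∈ Complex.slitPlane) :
    kummerError a b (conj ξ) = conj (kummerError a b ξ) := by
  have h1 : (b : ℂ) * conj ξ = conj (b * ξ) := by simp
  have h2 : (1 - conj ξ) ^ (-(a : ℂ)) = conj ((1 - ξ) ^ (-(a : ℂ))) := by
    have h3 : (1 : ℂ) - conj ξ = conj (1 - ξ) := by simp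
    rw [h3, Complex.conj_cpow _ _ (Complex.mem_slitPlane_iff_arg.1 hξ).1]
    simp
  have h4 : ∀ j, conj (Ring.choose (-(a : ℂ)) j) = Ring.choose (-(a : ℂ)) j := by
    intro j
    rw [← Complex.ofReal_neg, ← Complex.ofReal_choose, Complex.conj_ofReal]
  rw [kummerError, kummerError, h1, confluentHypergeometric_conj, h2]
  simp [h4]

/-- Only real `ξ ≥ 1` could fail, and `log x ≤ x - 1` excludes them from `𝒜`. -/
theorem regionA_one_sub_mem_slitPlane {ξ : ℂ} (h : ξ ∈ regionA) : 1 - ξ ∈ Complex.slitPlane := by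
  rcases lt_or_ge ξ.re 1 with h1 | h1
  · exact Or.inl (by simpa using h1)
  · refine Or.inr fun h2 => ?_
    have him : ξ.im = 0 := by simpa using h2
    rcases h with h | h
    · linarith
    · rw [him, zero_pow two_ne_zero, add_zero, Real.log_pow] at h
      have := Real.log_le_sub_one_of_pos (one_pos.trans_le h1)
      push_cast at h
      linarith

/-- For `re ξ₀ ≥ 1` the lower half plane is reflected to the upper one, since all coefficients are
real; a real `ξ₀` cannot occur. -/
theorem exists_norm_kummerError_le {a : ℝ} (ha : 0 < a) {ξ₀ : ℂ} (h : ξ₀ ∈ regionA) :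
    ∃ C, ∀ᶠ ξ in 𝓝 ξ₀, ∀ b : ℝ, max 8 (a + 1) ≤ b → ‖kummerError a b ξ‖ ≤ C / b ^ 3 := by
  have hslit := regionA_one_sub_mem_slitPlane h
  rcases lt_or_ge ξ₀.re 1 with h1 | h1
  · exact exists_norm_kummerError_le_of_re_lt_one ha h1
  have h2 : ξ₀.re - 1 - 1 / 2 * Real.log (ξ₀.re ^ 2 + ξ₀.im ^ 2) < 0 := by
    rcases h with h | h
    · linarith
    · exact h
  rcases lt_trichotomy ξ₀.im 0 with him | him | him
  · obtain ⟨C, hC⟩ := exists_norm_kummerError_le_of_im_pos ha (ξ₀ := conj ξ₀) (by simpa using h1)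
      (by simpa using him) (by simpa using h2)
    refine ⟨C, ?_⟩
    have e1 := Complex.continuous_conj.continuousAt.eventually hC
    have e2 : ∀ᶠ ξ : ℂ in 𝓝 ξ₀, 1 - ξ ∈ Complex.slitPlane :=
      (by fun_prop : ContinuousAt (fun ξ : ℂ => 1 - ξ) ξ₀).eventually
        (Complex.isOpen_slitPlane.mem_nhds hslit)
    filter_upwards [e1, e2] with ξ h3 h4 b hb
    have := h3 b hb
    rwa [kummerError_conj a b h4, Complex.norm_conj] at this
  · exfalso
    rcases hslit with h3 | h3
    · have : ξ₀.re < 1 := by simpa using h3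
      linarith
    · exact h3 (by simpa using him)
  · exact exists_norm_kummerError_le_of_im_pos ha h1 him h2

/-! ### The expansion on `𝒜` and passage to compact sets. -/

theorem ringChoose_neg_values (s : ℂ) : Ring.choose (-s) 2 = s * (s + 1) / 2 ∧
    Ring.choose (-s) 3 = -(s * (s + 1) * (s + 2) / 6) ∧
    Ring.choose (-s) 4 = s * (s + 1) * (s + 2) * (s + 3) / 24 := by
  have h2 : Ring.choose (-s) 2 = s * (s + 1) / 2 := by
    rw [ringChoose_succ, ringChoose_one]
    push_cast
    ring
  have h3 : Ring.choose (-s) 3 = -(s * (s + 1) * (s + 2) / 6) := by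
    rw [ringChoose_succ, h2]
    push_cast
    ring
  refine ⟨h2, h3, ?_⟩
  rw [ringChoose_succ, h3]
  push_cast
  ring

/-- The sum of central moments agrees with the three term expansion to third order. -/
theorem norm_sum_centralMoment_sub_le (a : ℝ) {b : ℝ} (hb : 0 < b) (W : ℂ) :
    ‖∑ j ∈ Finset.range 6, Ring.choose (-(a : ℂ)) j * (-W) ^ j * (centralMoment b j : ℂ) -
      (1 - (a : ℂ) * (a + 1) / 2 * W ^ 2 / (b : ℂ)
        + ((a : ℂ) * (a + 1) * (a + 2) * (a + 3) / 8 * W ^ 4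
          + 2 * (a : ℂ) * (a + 1) * (a + 2) / 3 * W ^ 3
          + (a : ℂ) * (a + 1) / 2 * W ^ 2) / (b : ℂ) ^ 2)‖ ≤
      (‖Ring.choose (-(a : ℂ)) 2 * W ^ 2‖ + 12 * ‖Ring.choose (-(a : ℂ)) 3 * W ^ 3‖ +
        36 * ‖Ring.choose (-(a : ℂ)) 4 * W ^ 4‖ + 40 * ‖Ring.choose (-(a : ℂ)) 5 * W ^ 5‖) /
        b ^ 3 := by
  obtain ⟨v0, v1, -⟩ := centralMoment_values hb
  obtain ⟨c2, c3, c4⟩ := ringChoose_neg_values (a : ℂ)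
  have hbne : (b : ℂ) ≠ 0 := by exact_mod_cast hb.ne'
  -- Up to `O(b⁻³)` the second to fifth central moments are `-1/b + 1/b²`, `4/b²`, `3/b²` and `0`;
  -- inserting these values reproduces the stated coefficients exactly.
  have hdec : ∑ j ∈ Finset.range 6, Ring.choose (-(a : ℂ)) j * (-W) ^ j * (centralMoment b j : ℂ) -
      (1 - (a : ℂ) * (a + 1) / 2 * W ^ 2 / (b : ℂ)
        + ((a : ℂ) * (a + 1) * (a + 2) * (a + 3) / 8 * W ^ 4
          + 2 * (a : ℂ) * (a + 1) * (a + 2) / 3 * W ^ 3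
          + (a : ℂ) * (a + 1) / 2 * W ^ 2) / (b : ℂ) ^ 2) =
      Ring.choose (-(a : ℂ)) 2 * W ^ 2 * ((centralMoment b 2 - (-1 / b + 1 / b ^ 2) : ℝ) : ℂ) -
      Ring.choose (-(a : ℂ)) 3 * W ^ 3 * ((centralMoment b 3 - 4 / b ^ 2 : ℝ) : ℂ) +
      Ring.choose (-(a : ℂ)) 4 * W ^ 4 * ((centralMoment b 4 - 3 / b ^ 2 : ℝ) : ℂ) -
      Ring.choose (-(a : ℂ)) 5 * W ^ 5 * ((centralMoment b 5 : ℝ) : ℂ) := by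
    simp only [Finset.sum_range_succ, Finset.sum_range_zero, v0, v1, c2, c3, c4]
    push_cast
    rw [Ring.choose_zero_right]
    field_simp
    ring
  rw [hdec]
  have n2 := abs_centralMoment_two_sub_le hb
  have n3 := abs_centralMoment_three_sub_le hb
  have n4 := abs_centralMoment_four_sub_le hb
  have n5 := abs_centralMoment_five_le hb
  refine (norm_sub_le _ _).trans ?_
  refine (add_le_add ((norm_add_le _ _).trans (add_le_add (norm_sub_le _ _) le_rfl)) le_rfl).trans ?_
  rw [norm_mul _ (Complex.ofReal _), norm_mul _ (Complex.ofReal _), norm_mul _ (Complex.ofReal _),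
    norm_mul _ (Complex.ofReal _), Complex.norm_real, Complex.norm_real, Complex.norm_real,
    Complex.norm_real, Real.norm_eq_abs, Real.norm_eq_abs, Real.norm_eq_abs, Real.norm_eq_abs]
  set A2 := ‖Ring.choose (-(a : ℂ)) 2 * W ^ 2‖
  set A3 := ‖Ring.choose (-(a : ℂ)) 3 * W ^ 3‖
  set A4 := ‖Ring.choose (-(a : ℂ)) 4 * W ^ 4‖
  set A5 := ‖Ring.choose (-(a : ℂ)) 5 * W ^ 5‖
  calc _ ≤ A2 * (1 / b ^ 3) + A3 * (12 / b ^ 3) + A4 * (36 / b ^ 3) + A5 * (40 / b ^ 3) := by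
        gcongr
    _ = _ := by ring

/-- Passing from local bounds to bounds on compact sets. -/
theorem exists_forall_isCompact {U K : Set ℂ} (hK : IsCompact K) (hKU : K ⊆ U) {b₀ : ℝ}
    (hb₀ : 0 < b₀) (n : ℕ) {P : ℝ → ℂ → ℂ → Prop}
    (h : ∀ ξ₀ ∈ U, ∃ C, ∀ᶠ ξ in 𝓝 ξ₀, ∀ b : ℝ, b₀ ≤ b → ∃ R : ℂ, ‖R‖ ≤ C / b ^ n ∧ P b ξ R) :
    ∃ C b₀ : ℝ, 0 < b₀ ∧ ∀ b : ℝ, b₀ ≤ b → ∀ ξ ∈ K, ∃ R : ℂ, ‖R‖ ≤ C / b ^ n ∧ P b ξ R := by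
  have key : ∃ C, ∀ ξ ∈ K, ∀ b : ℝ, b₀ ≤ b → ∃ R : ℂ, ‖R‖ ≤ C / b ^ n ∧ P b ξ R := by
    refine hK.induction_on (p := fun s => ∃ C, ∀ ξ ∈ s, ∀ b : ℝ, b₀ ≤ b →
      ∃ R : ℂ, ‖R‖ ≤ C / b ^ n ∧ P b ξ R) ⟨0, by simp⟩ ?_ ?_ ?_
    · rintro s t hst ⟨C, hC⟩
      exact ⟨C, fun ξ hξ => hC ξ (hst hξ)⟩
    · rintro s t ⟨C, hC⟩ ⟨D, hD⟩
      refine ⟨max C D, fun ξ hξ b hb => ?_⟩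
      have hb0 : 0 < b := hb₀.trans_le hb
      rcases hξ with hξ | hξ
      · obtain ⟨R, h1, h2⟩ := hC ξ hξ b hb
        exact ⟨R, h1.trans (by gcongr; exact le_max_left _ _), h2⟩
      · obtain ⟨R, h1, h2⟩ := hD ξ hξ b hb
        exact ⟨R, h1.trans (by gcongr; exact le_max_right _ _), h2⟩
    · intro ξ hξ
      obtain ⟨C, hC⟩ := h ξ (hKU hξ)
      exact ⟨_, mem_nhdsWithin_of_mem_nhds hC, C, fun ξ hξ => hξ⟩
  obtain ⟨C, hC⟩ := key
  exact ⟨C, b₀, hb₀, fun b hb ξ hξ => hC ξ hξ b hb⟩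

theorem confluentHypergeometric_expansion_regionA {a : ℝ} (ha : 0 < a) {ξ₀ : ℂ}
    (h : ξ₀ ∈ regionA) :
    ∃ C, ∀ᶠ ξ in 𝓝 ξ₀, ∀ b : ℝ, max 8 (a + 1) ≤ b → ∃ R : ℂ, ‖R‖ ≤ C / b ^ 3 ∧
      confluentHypergeometric (a : ℂ) (b : ℂ) ((b : ℂ) * ξ) =
          (1 - ξ) ^ (-(a : ℂ)) *
            (1 - (a : ℂ) * (a + 1) / 2 * (ξ / (1 - ξ)) ^ 2 / (b : ℂ)
              + ((a : ℂ) * (a + 1) * (a + 2) * (a + 3) / 8 * (ξ / (1 - ξ)) ^ 4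
                  + 2 * (a : ℂ) * (a + 1) * (a + 2) / 3 * (ξ / (1 - ξ)) ^ 3
                  + (a : ℂ) * (a + 1) / 2 * (ξ / (1 - ξ)) ^ 2) / (b : ℂ) ^ 2
              + R) := by
  have hslit := regionA_one_sub_mem_slitPlane h
  obtain ⟨C, hC⟩ := exists_norm_kummerError_le ha h
  have hne : (1 : ℂ) - ξ₀ ≠ 0 := Complex.slitPlane_ne_zero hslit
  have h1 : ContinuousAt (fun ξ : ℂ => 1 - ξ) ξ₀ := by fun_prop
  have hfac : ContinuousAt (fun ξ : ℂ => ξ / (1 - ξ)) ξ₀ := continuousAt_id.div h1 hne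
  have e1 := (h1.cpow (continuousAt_const (y := (a : ℂ))) hslit).norm.eventually_le_const
    (lt_add_one _)
  have e2 := hfac.norm.eventually_le_const (lt_add_one _)
  set L := ‖(1 - ξ₀) ^ (a : ℂ)‖ + 1 with hL
  set N := ‖ξ₀ / (1 - ξ₀)‖ + 1 with hN
  refine ⟨L * C + (‖Ring.choose (-(a : ℂ)) 2‖ * N ^ 2 + 12 * (‖Ring.choose (-(a : ℂ)) 3‖ * N ^ 3) +
    36 * (‖Ring.choose (-(a : ℂ)) 4‖ * N ^ 4) + 40 * (‖Ring.choose (-(a : ℂ)) 5‖ * N ^ 5)), ?_⟩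
  filter_upwards [hC, e1, e2, h1.eventually_ne hne] with ξ h2 h3 h4 h5 b hb
  have hb0 : 0 < b := by linarith [(le_max_left _ _).trans hb]
  have hpow : (1 - ξ) ^ (a : ℂ) * (1 - ξ) ^ (-(a : ℂ)) = 1 := by
    rw [← Complex.cpow_add _ _ h5]
    simp
  set W := ξ / (1 - ξ) with hW
  set M := 1 - (a : ℂ) * (a + 1) / 2 * W ^ 2 / (b : ℂ)
              + ((a : ℂ) * (a + 1) * (a + 2) * (a + 3) / 8 * W ^ 4
                  + 2 * (a : ℂ) * (a + 1) * (a + 2) / 3 * W ^ 3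
                  + (a : ℂ) * (a + 1) / 2 * W ^ 2) / (b : ℂ) ^ 2 with hM
  set S := ∑ j ∈ Finset.range 6, Ring.choose (-(a : ℂ)) j * (-W) ^ j * (centralMoment b j : ℂ)
    with hS
  have hE : kummerError a b ξ = confluentHypergeometric a b (b * ξ) - (1 - ξ) ^ (-(a : ℂ)) * S := rfl
  -- The error is stated relative to the prefactor, so it is multiplied by the inverse power, which
  -- is bounded near `ξ₀`.
  refine ⟨(1 - ξ) ^ (a : ℂ) * kummerError a b ξ + (S - M), ?_, ?_⟩
  · refine (norm_add_le _ _).trans ?_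
    rw [add_div]
    refine add_le_add ?_ ((norm_sum_centralMoment_sub_le a hb0 W).trans ?_)
    · rw [norm_mul, mul_div_assoc]
      exact mul_le_mul h3 (h2 b hb) (norm_nonneg _) (by positivity)
    · simp only [norm_mul, norm_pow]
      gcongr
  · rw [hE]
    linear_combination -(confluentHypergeometric a b (b * ξ) - (1 - ξ) ^ (-(a : ℂ)) * S) * hpow

/-! ### Region `ℬ`: Euler's integral split at a point `X < re ξ`. -/

/-- The part over `[0, X]` of the integral of `exp (-b σ) σ ^ (b - a - 1) (ξ - σ) ^ (a - 1)`. -/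
noncomputable def innerPart (a b X : ℝ) (ξ : ℂ) : ℂ :=
  ∫ σ in Ioc 0 X, ((σ ^ (b - a - 1) * Real.exp (-(b * σ)) : ℝ) : ℂ) * (ξ - σ) ^ ((a : ℂ) - 1)

/-- The part over the segment from `X` to `ξ` of the integral of
`exp (-b σ) σ ^ (b - a - 1) (ξ - σ) ^ (a - 1)`. -/
noncomputable def tailPart (a b X : ℝ) (ξ : ℂ) : ℂ :=
  (ξ - X) ^ (a : ℂ) * ∫ τ in Ioc (0 : ℝ) 1, (((1 - τ) ^ (a - 1) : ℝ) : ℂ) *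
    (Complex.exp (-(b * (X + (ξ - X) * τ))) * (X + (ξ - X) * τ) ^ (((b - a - 1 : ℝ)) : ℂ))

theorem integrableOn_one_sub_rpow {a : ℝ} (ha : 0 < a) :
    IntegrableOn (fun τ : ℝ => (1 - τ) ^ (a - 1)) (Ioc 0 1) := by
  have h := (intervalIntegrable_iff_integrableOn_Ioc_of_le zero_le_one).1
    (intervalIntegrable_beta one_pos ha)
  simpa using h

theorem integrableOn_rpow_Ioc {p X : ℝ} (hp : 0 ≤ p) (hX : 0 < X) :
    IntegrableOn (fun σ : ℝ => σ ^ p) (Ioc 0 X) :=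
  (intervalIntegrable_iff_integrableOn_Ioc_of_le hX.le).1
    (intervalIntegral.intervalIntegrable_rpow (Or.inl hp))

/-- A bound insensitive to the sign of the exponent, needed because `a - 1` may have either sign. -/
theorem rpow_le_add_rpow {x m M : ℝ} (p : ℝ) (hm : 0 < m) (h1 : m ≤ x) (h2 : x ≤ M) :
    x ^ p ≤ m ^ p + M ^ p := by
  have hM : 0 < M := by linarith
  rcases le_total 0 p with hp | hp
  · have := Real.rpow_le_rpow (by linarith) h2 hp
    have := Real.rpow_nonneg hm.le p
    linarith
  · have := Real.rpow_le_rpow_of_nonpos hm h1 hp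
    have := Real.rpow_nonneg hM.le p
    linarith

theorem isOpen_lt_re (X : ℝ) : IsOpen {ξ : ℂ | X < ξ.re} :=
  isOpen_lt continuous_const Complex.continuous_re

theorem re_gt_of_mem_ball {X : ℝ} {z w : ℂ} (hw : w ∈ Metric.ball z ((z.re - X) / 2)) :
    X + (z.re - X) / 2 < w.re := by
  have h1 := (Complex.abs_re_le_norm (w - z)).trans_lt (mem_ball_iff_norm.1 hw)
  rw [Complex.sub_re] at h1
  linarith [(abs_lt.1 h1).1]

theorem norm_cpow_sub_one (a : ℝ) (z : ℂ) : ‖z ^ ((a : ℂ) - 1)‖ = ‖z‖ ^ (a - 1) := by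
  have : (a : ℂ) - 1 = ((a - 1 : ℝ) : ℂ) := by push_cast; rfl
  rw [this, Complex.norm_cpow_real]

theorem differentiableOn_innerPart {a b X : ℝ} (hab : a + 1 ≤ b) (hb : 0 < b) (hX : 0 < X) :
    DifferentiableOn ℂ (innerPart a b X) {ξ | X < ξ.re} := by
  refine differentiableOn_integral_of_locally_dominated (isOpen_lt_re X) (fun z _ => ?_) ?_
    fun z hz => ?_
  · refine Measurable.aestronglyMeasurable ?_
    fun_prop
  · filter_upwards [ae_restrict_mem measurableSet_Ioc] with σ hσ ξ hξ
    have h : ξ - σ ∈ Complex.slitPlane := by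
      left
      have h1 : X < ξ.re := hξ
      simp only [Complex.sub_re, Complex.ofReal_re]
      linarith [hσ.2]
    have h2 : DifferentiableAt ℂ (fun ξ : ℂ => (ξ - σ) ^ ((a : ℂ) - 1)) ξ :=
      DifferentiableAt.cpow_const (by fun_prop) h
    exact (h2.const_mul _).differentiableWithinAt
  · have hz' : X < z.re := hz
    set r := (z.re - X) / 2 with hr
    have hr0 : 0 < r := by rw [hr]; linarith
    refine ⟨r, hr0, _, (integrableOn_rpow_Ioc (p := b - a - 1) (by linarith) hX).mul_const
      (r ^ (a - 1) + (‖z‖ + r + X) ^ (a - 1)), ?_⟩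
    filter_upwards [ae_restrict_mem measurableSet_Ioc] with σ hσ w hw
    have h1 := re_gt_of_mem_ball hw
    have h2 : r ≤ ‖w - σ‖ := by
      have := Complex.re_le_norm (w - σ)
      simp only [Complex.sub_re, Complex.ofReal_re] at this
      linarith [hσ.2]
    have h3 : ‖w - σ‖ ≤ ‖z‖ + r + X := by
      have e1 := norm_sub_le w (σ : ℂ)
      rw [Complex.norm_real, Real.norm_of_nonneg hσ.1.le] at e1
      have e2 := norm_le_norm_add_norm_sub' w z
      linarith [mem_ball_iff_norm.1 hw, hσ.2]
    have hσ0 : 0 ≤ σ ^ (b - a - 1) := Real.rpow_nonneg hσ.1.le _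
    rw [norm_mul, norm_cpow_sub_one, Complex.norm_real, Real.norm_of_nonneg
      (mul_nonneg hσ0 (Real.exp_pos _).le)]
    have h4 := rpow_le_add_rpow (a - 1) hr0 h2 h3
    have h5 : Real.exp (-(b * σ)) ≤ 1 := by
      rw [Real.exp_le_one_iff]
      have := mul_pos hb hσ.1
      linarith
    exact mul_le_mul (mul_le_of_le_one_right hσ0 h5) h4 (by positivity) hσ0

theorem segment_re_ge {X : ℝ} {ξ : ℂ} (hξ : X ≤ ξ.re) {τ : ℝ} (hτ : 0 ≤ τ) :
    X ≤ ((X : ℂ) + (ξ - X) * τ).re := by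
  simp only [Complex.add_re, Complex.mul_re, Complex.sub_re, Complex.ofReal_re, Complex.ofReal_im,
    mul_zero, sub_zero]
  have := mul_nonneg (sub_nonneg.2 hξ) hτ
  linarith

theorem segment_norm_le {X : ℝ} (hX : 0 ≤ X) {ξ : ℂ} {τ M : ℝ} (hτ : τ ∈ Icc (0 : ℝ) 1)
    (hXM : X ≤ M) (hξM : ‖ξ‖ ≤ M) : ‖(X : ℂ) + (ξ - X) * τ‖ ≤ M := by
  have h1 : (X : ℂ) + (ξ - X) * τ = ((1 - τ : ℝ) : ℂ) * X + (τ : ℂ) * ξ := by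
    push_cast
    ring
  rw [h1]
  refine (norm_add_le _ _).trans ?_
  rw [norm_mul, norm_mul, Complex.norm_real, Complex.norm_real, Complex.norm_real,
    Real.norm_of_nonneg (sub_nonneg.2 hτ.2), Real.norm_of_nonneg hτ.1, Real.norm_of_nonneg hX]
  nlinarith [mul_le_mul_of_nonneg_left hXM (sub_nonneg.2 hτ.2),
    mul_le_mul_of_nonneg_left hξM hτ.1]

/-- In the parameter `τ` the end point singularity is `(1 - τ) ^ (a - 1)`, integrable and
independent of `ξ`; all that depends on `ξ` is holomorphic and locally bounded. -/
theorem differentiableOn_tailPart {a b X : ℝ} (ha : 0 < a) (hab : a + 1 ≤ b) (hX : 0 < X) :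
    DifferentiableOn ℂ (tailPart a b X) {ξ | X < ξ.re} := by
  refine DifferentiableOn.mul ?_ ?_
  · intro ξ hξ
    refine DifferentiableAt.differentiableWithinAt ?_
    exact DifferentiableAt.cpow_const (by fun_prop) (Or.inl (by simpa using hξ))
  refine differentiableOn_integral_of_locally_dominated (isOpen_lt_re X) (fun z _ => ?_) ?_
    fun z hz => ?_
  · refine Measurable.aestronglyMeasurable ?_
    fun_prop
  · filter_upwards [ae_restrict_mem measurableSet_Ioc] with τ hτ ξ hξ
    have h : (X : ℂ) + (ξ - X) * τ ∈ Complex.slitPlane :=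
      Or.inl (hX.trans_le (segment_re_ge (le_of_lt hξ) hτ.1.le))
    have h2 : DifferentiableAt ℂ (fun ξ : ℂ => ((X : ℂ) + (ξ - X) * τ) ^
        (((b - a - 1 : ℝ)) : ℂ)) ξ :=
      DifferentiableAt.cpow_const (by fun_prop) h
    have h3 : DifferentiableAt ℂ (fun ξ : ℂ => Complex.exp (-(b * (X + (ξ - X) * τ)))) ξ := by
      fun_prop
    exact ((h3.mul h2).const_mul _).differentiableWithinAt
  · have hz' : X < z.re := hz
    set r := (z.re - X) / 2 with hr
    have hr0 : 0 < r := by rw [hr]; linarith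
    refine ⟨r, hr0, _, (integrableOn_one_sub_rpow ha).mul_const
      (1 * (‖z‖ + r + X) ^ (b - a - 1)), ?_⟩
    filter_upwards [ae_restrict_mem measurableSet_Ioc] with τ hτ w hw
    have h1 := re_gt_of_mem_ball hw
    have h2 := segment_re_ge (by linarith : X ≤ w.re) hτ.1.le
    have h3 : ‖w‖ ≤ ‖z‖ + r := by
      have e2 := norm_le_norm_add_norm_sub' w z
      linarith [mem_ball_iff_norm.1 hw]
    have h4 := segment_norm_le hX.le (M := ‖z‖ + r + X) (ξ := w) ⟨hτ.1.le, hτ.2⟩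
      (by linarith [norm_nonneg z]) (by linarith)
    have hτ0 : 0 ≤ (1 - τ) ^ (a - 1) := Real.rpow_nonneg (sub_nonneg.2 hτ.2) _
    rw [norm_mul, norm_mul, Complex.norm_real, Real.norm_of_nonneg hτ0, Complex.norm_cpow_real,
      Complex.norm_exp]
    refine mul_le_mul_of_nonneg_left (mul_le_mul ?_ ?_ (by positivity) zero_le_one) hτ0
    · rw [Real.exp_le_one_iff, Complex.neg_re, Complex.re_ofReal_mul]
      have : 0 ≤ b * ((X : ℂ) + (w - X) * τ).re := mul_nonneg (by linarith) (by linarith)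
      linarith
    · exact Real.rpow_le_rpow (norm_nonneg _) h4 (by linarith)

/-- For real `x` this is Euler's integral after `s = x - σ`, cut at `X`, with `[X, x]` rescaled to
`[0, 1]`. -/
theorem innerPart_add_tailPart_real {a b X x : ℝ} (ha : 0 < a) (hab : a + 1 ≤ b) (hX : 0 < X)
    (hx : X < x) :
    ((x ^ (b - 1) : ℝ) : ℂ) * Complex.exp (-(b * x)) * ((Real.Gamma a : ℂ) *
      (Real.Gamma (b - a) : ℂ) / (Real.Gamma b : ℂ) * confluentHypergeometric a b (b * x)) =
      innerPart a b X x + tailPart a b X x := by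
  have hx0 : 0 < x := hX.trans hx
  have hba : 0 < b - a := by linarith
  set f : ℝ → ℂ := fun σ => ((σ ^ (b - a - 1) * Real.exp (-(b * σ)) : ℝ) : ℂ) *
    (((x - σ) ^ (a - 1) : ℝ) : ℂ) with hf
  have hfI : IntervalIntegrable f volume 0 x := by
    have h1 := (intervalIntegrable_beta hba ha).comp_mul_left (c := x⁻¹)
    simp only [zero_div, one_div, inv_inv] at h1
    have h2 : IntervalIntegrable (fun σ : ℝ => (((x⁻¹ * σ) ^ (b - a - 1) *
        (1 - x⁻¹ * σ) ^ (a - 1) : ℝ) : ℂ)) volume 0 x :=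
      ⟨h1.1.ofReal, h1.2.ofReal⟩
    have h3 := h2.mul_continuousOn (g := fun σ : ℝ => ((x ^ (b - a - 1) * x ^ (a - 1) : ℝ) : ℂ) *
      ((Real.exp (-(b * σ)) : ℝ) : ℂ)) (by fun_prop)
    refine h3.congr fun σ hσ => ?_
    rw [uIoc_of_le hx0.le] at hσ
    have e1 : σ ^ (b - a - 1) = x ^ (b - a - 1) * (x⁻¹ * σ) ^ (b - a - 1) := by
      rw [← Real.mul_rpow hx0.le (mul_nonneg (inv_pos.2 hx0).le hσ.1.le),
        mul_inv_cancel_left₀ hx0.ne']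
    have e2 : (x - σ) ^ (a - 1) = x ^ (a - 1) * (1 - x⁻¹ * σ) ^ (a - 1) := by
      have h5 : x⁻¹ * σ ≤ 1 := by
        rw [inv_mul_le_iff₀ hx0, mul_one]
        exact hσ.2
      rw [← Real.mul_rpow hx0.le (sub_nonneg.2 h5)]
      congr 1
      field_simp
    simp only [hf]
    rw [e1, e2]
    push_cast
    ring
  have h0 := integral_beta_mul_cexp_scaled ha (by linarith : a < b) hx0 (b : ℂ)
  have h1 : ∫ s : ℝ in 0..x, ((s ^ (a - 1) * (x - s) ^ (b - a - 1) : ℝ) : ℂ) *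
      Complex.exp (b * s) = Complex.exp (b * x) * ∫ σ in 0..x, f σ := by
    have h2 := intervalIntegral.integral_comp_sub_left (a := 0) (b := x) (fun s : ℝ =>
      ((s ^ (a - 1) * (x - s) ^ (b - a - 1) : ℝ) : ℂ) * Complex.exp (b * s)) x
    rw [sub_self, sub_zero] at h2
    rw [← h2, ← intervalIntegral.integral_const_mul]
    refine intervalIntegral.integral_congr fun σ _ => ?_
    have h3 : Complex.exp (b * ((x - σ : ℝ) : ℂ)) = Complex.exp (b * x) *
        Complex.exp (-(b * σ)) := by
      rw [← Complex.exp_add]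
      congr 1
      push_cast
      ring
    simp only [hf]
    rw [h3, sub_sub_cancel]
    push_cast
    ring
  have hsplit : ∫ σ in 0..x, f σ = (∫ σ in 0..X, f σ) + ∫ σ in X..x, f σ := by
    refine (intervalIntegral.integral_add_adjacent_intervals ?_ ?_).symm
    · exact hfI.mono_set (by rw [uIcc_of_le hX.le, uIcc_of_le hx0.le]; gcongr)
    · exact hfI.mono_set (by rw [uIcc_of_le hx.le, uIcc_of_le hx0.le]; gcongr)
  have hin : ∫ σ in 0..X, f σ = innerPart a b X x := by
    rw [intervalIntegral.integral_of_le hX.le, innerPart]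
    refine setIntegral_congr_fun measurableSet_Ioc fun σ hσ => ?_
    simp only [hf]
    rw [Complex.ofReal_cpow (by linarith [hσ.2])]
    push_cast
    rfl
  have htail : ∫ σ in X..x, f σ = tailPart a b X x := by
    have h2 := intervalIntegral.smul_integral_comp_add_mul (a := 0) (b := 1) f (x - X) X
    rw [mul_zero, add_zero, mul_one, add_sub_cancel] at h2
    rw [← h2, Complex.real_smul, tailPart]
    have hxX : 0 < x - X := sub_pos.2 hx
    have e0 : ((x : ℂ) - X) ^ (a : ℂ) = ((x - X : ℝ) : ℂ) * (((x - X) ^ (a - 1) : ℝ) : ℂ) := by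
      rw [← Complex.ofReal_mul, ← Complex.ofReal_sub, ← Complex.ofReal_cpow hxX.le]
      congr 1
      rw [← Real.rpow_one_add' hxX.le (by simpa using ha.ne')]
      simp
    rw [e0, mul_assoc]
    congr 1
    rw [intervalIntegral.integral_of_le zero_le_one, ← integral_const_mul]
    refine setIntegral_congr_fun measurableSet_Ioc fun τ hτ => ?_
    have e1 : x - (X + (x - X) * τ) = (x - X) * (1 - τ) := by ring
    have e2 : 0 ≤ X + (x - X) * τ := add_nonneg hX.le (mul_nonneg hxX.le hτ.1.le)
    simp only [hf]
    rw [e1, Real.mul_rpow hxX.le (sub_nonneg.2 hτ.2)]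
    have e3 : (X : ℂ) + ((x : ℂ) - X) * τ = ((X + (x - X) * τ : ℝ) : ℂ) := by push_cast; rfl
    rw [e3, ← Complex.ofReal_cpow e2]
    push_cast
    ring
  rw [← hin, ← htail, ← hsplit]
  have h4 : Complex.exp (-(b * x)) * Complex.exp (b * x) = 1 := by
    rw [← Complex.exp_add]
    simp
  rw [h1, mul_comm (x : ℂ) (b : ℂ)] at h0
  linear_combination (-Complex.exp (-(b * x))) * h0 + (∫ σ in 0..x, f σ) * h4

/-- Both sides are holomorphic for `re ξ > X` and agree at real points; the identity theorem stands
in for a contour deformation. -/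
theorem innerPart_add_tailPart {a b X : ℝ} (ha : 0 < a) (hab : a + 1 ≤ b) (hX : 0 < X)
    {ξ : ℂ} (hξ : X < ξ.re) :
    ξ ^ ((b : ℂ) - 1) * Complex.exp (-(b * ξ)) * ((Real.Gamma a : ℂ) *
      (Real.Gamma (b - a) : ℂ) / (Real.Gamma b : ℂ) * confluentHypergeometric a b (b * ξ)) =
      innerPart a b X ξ + tailPart a b X ξ := by
  set U := {ξ : ℂ | X < ξ.re} with hU
  have hUo : IsOpen U := isOpen_lt_re X
  have hL : AnalyticOnNhd ℂ (fun ξ : ℂ => ξ ^ ((b : ℂ) - 1) * Complex.exp (-(b * ξ)) *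
      ((Real.Gamma a : ℂ) * (Real.Gamma (b - a) : ℂ) / (Real.Gamma b : ℂ) *
        confluentHypergeometric a b (b * ξ))) U := by
    refine DifferentiableOn.analyticOnNhd (fun ξ hξ => ?_) hUo
    have h1 : ξ ∈ Complex.slitPlane := Or.inl (hX.trans hξ)
    have h2 : DifferentiableAt ℂ (fun ξ : ℂ => confluentHypergeometric a b (b * ξ)) ξ :=
      (differentiable_confluentHypergeometric ha (by linarith : a < b)).differentiableAt.comp ξ
        (f := fun ξ : ℂ => (b : ℂ) * ξ) (by fun_prop)
    have h3 : DifferentiableAt ℂ (fun ξ : ℂ => ξ ^ ((b : ℂ) - 1)) ξ :=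
      differentiableAt_id.cpow_const h1
    exact ((h3.mul (by fun_prop)).mul (h2.const_mul _)).differentiableWithinAt
  have hR : AnalyticOnNhd ℂ (fun ξ => innerPart a b X ξ + tailPart a b X ξ) U :=
    ((differentiableOn_innerPart hab (by linarith) hX).add
      (differentiableOn_tailPart ha hab hX)).analyticOnNhd hUo
  have hlim : Tendsto (fun n : ℕ => ((X + 1 : ℝ) : ℂ) + ((1 / ((n : ℝ) + 1) : ℝ) : ℂ)) atTop
      (𝓝[≠] ((X + 1 : ℝ) : ℂ)) := by
    refine tendsto_nhdsWithin_iff.2 ⟨?_, Eventually.of_forall fun n => ?_⟩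
    · have := (Complex.continuous_ofReal.tendsto 0).comp
        (tendsto_one_div_add_atTop_nhds_zero_nat (𝕜 := ℝ))
      simpa using this.const_add ((X + 1 : ℝ) : ℂ)
    · have : (1 / ((n : ℝ) + 1) : ℝ) ≠ 0 := by positivity
      rw [mem_compl_iff, mem_singleton_iff, add_eq_left]
      exact Complex.ofReal_ne_zero.2 this
  have hfreq := hlim.frequently (p := fun ξ : ℂ => ξ ^ ((b : ℂ) - 1) * Complex.exp (-(b * ξ)) *
      ((Real.Gamma a : ℂ) * (Real.Gamma (b - a) : ℂ) / (Real.Gamma b : ℂ) *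
        confluentHypergeometric a b (b * ξ)) = innerPart a b X ξ + tailPart a b X ξ)
    (Frequently.of_forall fun n => by
      have hn : 0 < 1 / ((n : ℝ) + 1) := by positivity
      have h := innerPart_add_tailPart_real ha hab hX
        (by linarith : X < X + 1 + 1 / ((n : ℝ) + 1))
      rw [Complex.ofReal_cpow (by linarith)] at h
      simpa only [Complex.ofReal_add, Complex.ofReal_sub, Complex.ofReal_one] using h)
  exact hL.eqOn_of_preconnected_of_frequently_eq hR (convex_halfSpace_re_gt X).isPreconnected
    (z₀ := ((X + 1 : ℝ) : ℂ)) (by simp [hU]) hfreq hξ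

/-! ### Moments of the Gamma weight about 1. -/

/-- The density of the Gamma law of shape `b - a` and rate `b`, up to normalisation. -/
noncomputable def gammaWeight (a b σ : ℝ) : ℝ := σ ^ (b - a - 1) * Real.exp (-(b * σ))

/-- The total mass of `gammaWeight a b` on `(0, ∞)`. -/
noncomputable def gammaMass (a b : ℝ) : ℝ := (1 / b) ^ (b - a) * Real.Gamma (b - a)

theorem gammaMass_pos {a b : ℝ} (hb : 0 < b) (hab : a < b) : 0 < gammaMass a b :=
  mul_pos (Real.rpow_pos_of_pos (by positivity) _) (Real.Gamma_pos_of_pos (sub_pos.2 hab))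

theorem gammaWeight_nonneg (a b : ℝ) {σ : ℝ} (hσ : 0 ≤ σ) : 0 ≤ gammaWeight a b σ :=
  mul_nonneg (Real.rpow_nonneg hσ _) (Real.exp_nonneg _)

theorem gammaWeight_mul_pow (a b : ℝ) (k : ℕ) {σ : ℝ} (hσ : 0 < σ) :
    gammaWeight a b σ * σ ^ k = σ ^ (b - a + k - 1) * Real.exp (-(b * σ)) := by
  rw [gammaWeight, mul_right_comm, ← Real.rpow_add_natCast hσ.ne']
  congr 2
  ring

theorem integrableOn_gammaWeight_mul_pow {a b : ℝ} (hb : 0 < b) (hab : a < b) (k : ℕ) :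
    IntegrableOn (fun σ => gammaWeight a b σ * σ ^ k) (Ioi 0) := by
  have h := integrableOn_rpow_mul_exp_neg_mul (s := b - a + k) (r := b)
    (by have : (0 : ℝ) ≤ k := k.cast_nonneg
        linarith) hb
  exact h.congr_fun (fun σ hσ => (gammaWeight_mul_pow a b k hσ).symm) measurableSet_Ioi

theorem integral_gammaWeight_mul_pow {a b : ℝ} (hb : 0 < b) (hab : a < b) (k : ℕ) :
    ∫ σ in Ioi 0, gammaWeight a b σ * σ ^ k =
      gammaMass a b * (∏ i ∈ Finset.range k, (b - a + i)) / b ^ k := by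
  have hba : 0 < b - a := sub_pos.2 hab
  rw [setIntegral_congr_fun measurableSet_Ioi fun σ hσ => gammaWeight_mul_pow a b k hσ,
    Real.integral_rpow_mul_exp_neg_mul_Ioi (by positivity) hb]
  have h : ∀ k : ℕ, Real.Gamma (b - a + k) =
      Real.Gamma (b - a) * ∏ i ∈ Finset.range k, (b - a + i) := by
    intro k
    induction k with
    | zero => simp
    | succ k ih =>
      rw [Finset.prod_range_succ, ← mul_assoc, ← ih, Nat.cast_succ, ← add_assoc,
        Real.Gamma_add_one (by positivity), mul_comm]
  rw [h, Real.rpow_add_natCast (by positivity), gammaMass, one_div, inv_pow]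
  ring

theorem one_sub_pow_eq_sum (σ : ℝ) (j : ℕ) :
    (1 - σ) ^ j = ∑ i ∈ Finset.range (j + 1), (-1) ^ i * (j.choose i : ℝ) * σ ^ i := by
  rw [sub_eq_neg_add, add_pow]
  refine Finset.sum_congr rfl fun i _ => ?_
  rw [neg_pow, one_pow]
  ring

theorem integrableOn_gammaWeight_mul_one_sub_pow {a b : ℝ} (hb : 0 < b) (hab : a < b) (j : ℕ) :
    IntegrableOn (fun σ => gammaWeight a b σ * (1 - σ) ^ j) (Ioi 0) := by
  have h := integrable_finsetSum (μ := volume.restrict (Ioi 0)) (Finset.range (j + 1))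
    (f := fun i σ => (-1) ^ i * (j.choose i : ℝ) * (gammaWeight a b σ * σ ^ i)) fun i _ =>
      (integrableOn_gammaWeight_mul_pow hb hab i).const_mul _
  refine h.congr (ae_of_all _ fun σ => ?_)
  simp only [one_sub_pow_eq_sum, Finset.mul_sum]
  exact Finset.sum_congr rfl fun i _ => by ring

theorem integral_gammaWeight_mul_one_sub_pow {a b : ℝ} (hb : 0 < b) (hab : a < b) (j : ℕ) :
    ∫ σ in Ioi 0, gammaWeight a b σ * (1 - σ) ^ j = gammaMass a b *
      ∑ i ∈ Finset.range (j + 1), (-1) ^ i * (j.choose i : ℝ) *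
        ((∏ l ∈ Finset.range i, (b - a + l)) / b ^ i) := by
  have h := integral_finsetSum (μ := volume.restrict (Ioi 0)) (Finset.range (j + 1))
    (f := fun i σ => (-1) ^ i * (j.choose i : ℝ) * (gammaWeight a b σ * σ ^ i)) fun i _ =>
      (integrableOn_gammaWeight_mul_pow hb hab i).const_mul _
  rw [Finset.mul_sum]
  calc _ = ∫ σ in Ioi 0, ∑ i ∈ Finset.range (j + 1),
        (-1) ^ i * (j.choose i : ℝ) * (gammaWeight a b σ * σ ^ i) := by
        congr 1
        ext σ
        rw [one_sub_pow_eq_sum, Finset.mul_sum]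
        exact Finset.sum_congr rfl fun i _ => by ring
    _ = _ := by
        rw [h]
        refine Finset.sum_congr rfl fun i _ => ?_
        rw [integral_const_mul, integral_gammaWeight_mul_pow hb hab]
        ring

theorem integral_gammaWeight {a b : ℝ} (hb : 0 < b) (hab : a < b) :
    ∫ σ in Ioi 0, gammaWeight a b σ = gammaMass a b := by
  simpa using integral_gammaWeight_mul_pow hb hab 0

/-- The law has mean `1 - a / b`, not 1; this offset produces the `a (a - 1) / (ξ - 1)` part of the
first correction. -/
theorem integral_gammaWeight_mul_one_sub {a b : ℝ} (hb : 0 < b) (hab : a < b) :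
    ∫ σ in Ioi 0, gammaWeight a b σ * (1 - σ) ^ 1 = gammaMass a b * (a / b) := by
  rw [integral_gammaWeight_mul_one_sub_pow hb hab]
  simp only [Finset.sum_range_succ, Finset.prod_range_succ, Finset.range_zero, Finset.sum_empty,
    Finset.prod_empty]
  simp [Nat.choose]
  left
  field_simp
  ring

theorem integral_gammaWeight_mul_one_sub_sq {a b : ℝ} (hb : 0 < b) (hab : a < b) :
    ∫ σ in Ioi 0, gammaWeight a b σ * (1 - σ) ^ 2 =
      gammaMass a b * ((b + a ^ 2 - a) / b ^ 2) := by
  rw [integral_gammaWeight_mul_one_sub_pow hb hab]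
  simp only [Finset.sum_range_succ, Finset.prod_range_succ, Finset.range_zero, Finset.sum_empty,
    Finset.prod_empty]
  simp [Nat.choose]
  left
  field_simp
  ring

theorem integral_gammaWeight_mul_one_sub_cube {a b : ℝ} (hb : 0 < b) (hab : a < b) :
    ∫ σ in Ioi 0, gammaWeight a b σ * (1 - σ) ^ 3 =
      gammaMass a b * ((a ^ 3 + 3 * a * (b - a) - 2 * (b - a)) / b ^ 3) := by
  rw [integral_gammaWeight_mul_one_sub_pow hb hab]
  simp only [Finset.sum_range_succ, Finset.prod_range_succ, Finset.range_zero, Finset.sum_empty,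
    Finset.prod_empty]
  simp [Nat.choose]
  left
  field_simp
  ring

theorem integral_gammaWeight_mul_one_sub_pow_four {a b : ℝ} (hb : 0 < b) (hab : a < b) :
    ∫ σ in Ioi 0, gammaWeight a b σ * (1 - σ) ^ 4 = gammaMass a b *
      ((a ^ 4 + 6 * a ^ 2 * (b - a) + 3 * (b - a) ^ 2 - 8 * a * (b - a) + 6 * (b - a)) /
        b ^ 4) := by
  rw [integral_gammaWeight_mul_one_sub_pow hb hab]
  simp only [Finset.sum_range_succ, Finset.prod_range_succ, Finset.range_zero, Finset.sum_empty,
    Finset.prod_empty]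
  simp [Nat.choose]
  left
  field_simp
  ring

theorem integral_gammaWeight_mul_one_sub_pow_four_le {a b : ℝ} (ha : 0 < a) (hb : 1 ≤ b)
    (hab : a < b) : ∫ σ in Ioi 0, gammaWeight a b σ * (1 - σ) ^ 4 ≤
      gammaMass a b * ((a ^ 4 + 6 * a ^ 2 + 9) / b ^ 2) := by
  have hb0 : 0 < b := by linarith
  rw [integral_gammaWeight_mul_one_sub_pow_four hb0 hab]
  refine mul_le_mul_of_nonneg_left ?_ (gammaMass_pos hb0 hab).le
  rw [div_le_div_iff₀ (by positivity) (by positivity)]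
  have h1 : a ^ 4 + 6 * a ^ 2 * (b - a) + 3 * (b - a) ^ 2 - 8 * a * (b - a) + 6 * (b - a) ≤
      (a ^ 4 + 6 * a ^ 2 + 9) * b ^ 2 := by
    have e1 : b ≤ b ^ 2 := by nlinarith
    have e2 : 1 ≤ b ^ 2 := by nlinarith
    have e3 : (b - a) ^ 2 ≤ b ^ 2 := by nlinarith
    have e4 : a ^ 4 ≤ a ^ 4 * b ^ 2 := le_mul_of_one_le_right (by positivity) e2
    have e5 : a ^ 2 * (b - a) ≤ a ^ 2 * b ^ 2 :=
      mul_le_mul_of_nonneg_left (by linarith) (by positivity)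
    have e6 : 0 ≤ a * (b - a) := mul_nonneg ha.le (by linarith)
    linarith
  calc _ ≤ (a ^ 4 + 6 * a ^ 2 + 9) * b ^ 2 * b ^ 2 := by gcongr
    _ = _ := by ring

/-- The numerator is linear in `b`, so the third moment is `O(b⁻²)`, better than the third absolute
moment; this is why the Taylor polynomial is cubic. -/
theorem abs_central_third_moment_le {a b : ℝ} (ha : 0 < a) (hb : 1 ≤ b) (hab : a < b) :
    |(a ^ 3 + 3 * a * (b - a) - 2 * (b - a)) / b ^ 3| ≤ (a ^ 3 + 3 * a + 2) / b ^ 2 := by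
  have hb0 : 0 < b := by linarith
  rw [abs_div, abs_of_pos (by positivity : 0 < b ^ 3),
    div_le_div_iff₀ (by positivity) (by positivity)]
  have h1 : |a ^ 3 + 3 * a * (b - a) - 2 * (b - a)| ≤ (a ^ 3 + 3 * a + 2) * b := by
    have e1 : a ^ 3 ≤ a ^ 3 * b := le_mul_of_one_le_right (by positivity) hb
    have e2 : 0 ≤ a * (b - a) := mul_nonneg ha.le (by linarith)
    have e3 : 0 < a * a := mul_pos ha ha
    have e4 : 0 < a ^ 3 := by positivity
    rw [abs_le]
    constructor <;> nlinarith
  calc _ ≤ (a ^ 3 + 3 * a + 2) * b * b ^ 2 := by gcongr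
    _ = _ := by ring

/-! ### Taylor expansion of `(ξ - σ) ^ (a - 1)` at the saddle `σ = 1`. -/

/-- The Taylor polynomial of degree `3` of `σ ↦ (ξ - σ) ^ (a - 1)` at `σ = 1`. -/
noncomputable def powerTaylor (a : ℝ) (ξ : ℂ) (σ : ℝ) : ℂ :=
  (ξ - 1) ^ ((a : ℂ) - 1) *
    ∑ j ∈ Finset.range 4, Ring.choose ((a : ℂ) - 1) j * ((1 - σ : ℝ) / (ξ - 1)) ^ j

theorem gammaWeight_mul_powerTaylor (a b : ℝ) (ξ : ℂ) (σ : ℝ) :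
    (gammaWeight a b σ : ℂ) * powerTaylor a ξ σ = ∑ j ∈ Finset.range 4,
      (ξ - 1) ^ ((a : ℂ) - 1) * Ring.choose ((a : ℂ) - 1) j / (ξ - 1) ^ j *
        ((gammaWeight a b σ * (1 - σ) ^ j : ℝ) : ℂ) := by
  rw [powerTaylor, Finset.mul_sum, Finset.mul_sum]
  refine Finset.sum_congr rfl fun j _ => ?_
  push_cast
  rw [div_pow]
  ring

theorem integrableOn_gammaWeight_mul_powerTaylor {a b : ℝ} (hb : 0 < b) (hab : a < b) (ξ : ℂ) :
    IntegrableOn (fun σ => (gammaWeight a b σ : ℂ) * powerTaylor a ξ σ) (Ioi 0) := by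
  simp only [gammaWeight_mul_powerTaylor]
  exact integrable_finsetSum _ fun j _ =>
    ((integrableOn_gammaWeight_mul_one_sub_pow hb hab j).ofReal).const_mul _

theorem integral_gammaWeight_mul_powerTaylor {a b : ℝ} (hb : 0 < b) (hab : a < b) (ξ : ℂ) :
    ∫ σ in Ioi 0, (gammaWeight a b σ : ℂ) * powerTaylor a ξ σ =
      gammaMass a b * (ξ - 1) ^ ((a : ℂ) - 1) *
        (1 + (a * (a - 1) / (ξ - 1) + ((a : ℂ) - 1) * (a - 2) / 2 / (ξ - 1) ^ 2) / b +
          (((a : ℂ) - 1) * (a - 2) / 2 / (ξ - 1) ^ 2 * (((a ^ 2 - a) / b ^ 2 : ℝ) : ℂ) +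
            ((a : ℂ) - 1) * (a - 2) * (a - 3) / 6 / (ξ - 1) ^ 3 *
              (((a ^ 3 + 3 * a * (b - a) - 2 * (b - a)) / b ^ 3 : ℝ) : ℂ))) := by
  simp only [gammaWeight_mul_powerTaylor]
  rw [integral_finsetSum _ fun j _ =>
    ((integrableOn_gammaWeight_mul_one_sub_pow hb hab j).ofReal).const_mul _]
  simp only [integral_const_mul, integral_complex_ofReal]
  have h0 := integral_gammaWeight hb hab
  have h1 := integral_gammaWeight_mul_one_sub hb hab
  have h2 := integral_gammaWeight_mul_one_sub_sq hb hab
  have h3 := integral_gammaWeight_mul_one_sub_cube hb hab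
  have hb' : (b : ℂ) ≠ 0 := Complex.ofReal_ne_zero.2 hb.ne'
  have hsplit : ((b + a ^ 2 - a) / b ^ 2 : ℝ) = 1 / b + (a ^ 2 - a) / b ^ 2 := by
    field_simp
    ring
  rw [Finset.sum_range_succ, Finset.sum_range_succ, Finset.sum_range_succ, Finset.sum_range_one,
    h1, h2, h3, hsplit]
  simp only [pow_zero, mul_one, h0, ringChoose_succ, Ring.choose_zero_right]
  push_cast
  ring

/-- Near `(ξ₀, 1)` the principal power of `ξ - σ = (ξ - 1) (1 + (1 - σ) / (ξ - 1))` factors, and the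
binomial series bounds the rest uniformly in `ξ`. -/
theorem exists_cpow_sub_powerTaylor_le_near (a : ℝ) {ξ₀ : ℂ} (hξ₀ : ξ₀ - 1 ∈ Complex.slitPlane) :
    ∃ C, 0 ≤ C ∧ ∀ᶠ p : ℂ × ℝ in 𝓝 (ξ₀, 1),
      ‖(p.1 - p.2) ^ ((a : ℂ) - 1) - powerTaylor a p.1 p.2‖ ≤ C * (1 - p.2) ^ 4 := by
  obtain ⟨C, hC, hT⟩ := exists_norm_one_add_cpow_sub_le ((a : ℂ) - 1) 4
  have hne : ξ₀ - 1 ≠ 0 := Complex.slitPlane_ne_zero hξ₀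
  have h1 : ContinuousAt (fun p : ℂ × ℝ => p.1 - 1) (ξ₀, 1) := by fun_prop
  have hw : ContinuousAt (fun p : ℂ × ℝ => ((1 - p.2 : ℝ) : ℂ) / (p.1 - 1)) (ξ₀, 1) :=
    ContinuousAt.div (by fun_prop) h1 hne
  have hq : ContinuousAt (fun p : ℂ × ℝ => 1 + ((1 - p.2 : ℝ) : ℂ) / (p.1 - 1)) (ξ₀, 1) :=
    continuousAt_const.add hw
  have hi : ContinuousAt (fun p : ℂ × ℝ => (p.1 - 1)⁻¹) (ξ₀, 1) := h1.inv₀ hne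
  have e1 := (h1.prodMk hq).eventually
    (by simpa using eventually_mul_cpow hξ₀ ((a : ℂ) - 1))
  have e3 := hw.eventually (p := fun w => ‖(1 + w) ^ ((a : ℂ) - 1) -
    ∑ j ∈ Finset.range 4, Ring.choose ((a : ℂ) - 1) j * w ^ j‖ ≤ C * ‖w‖ ^ 4) (by simpa using hT)
  have e5 := h1.eventually_ne hne
  have e6 := (h1.cpow (continuousAt_const (y := (a : ℂ) - 1)) hξ₀).norm.eventually_le_const
    (lt_add_one _)
  have e7 := hi.norm.eventually_le_const (lt_add_one _)
  set L := ‖(ξ₀ - 1) ^ ((a : ℂ) - 1)‖ + 1 with hLdef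
  set N := ‖(ξ₀ - 1)⁻¹‖ + 1 with hNdef
  refine ⟨L * (C * N ^ 4), by positivity, ?_⟩
  filter_upwards [e1, e3, e5, e6, e7] with p p1 p3 p5 p6 p7
  have k1 : p.1 - p.2 = (p.1 - 1) * (1 + ((1 - p.2 : ℝ) : ℂ) / (p.1 - 1)) := by
    rw [mul_add, mul_one, mul_div_cancel₀ _ p5]
    push_cast
    ring
  rw [k1, p1, powerTaylor, ← mul_sub, norm_mul, mul_assoc]
  refine mul_le_mul p6 (p3.trans ?_) (norm_nonneg _) (by positivity)
  rw [mul_assoc, norm_div, div_pow, Complex.norm_real, Real.norm_eq_abs,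
    Even.pow_abs (by decide : Even 4), div_eq_mul_inv, mul_comm ((1 - p.2) ^ 4), ← inv_pow,
    ← norm_inv]
  gcongr

/-- For `δ ≤ |1 - σ|` and `δ ≤ 1`, each power `|1 - σ| ^ j` with `j ≤ 4` is at most `(|1 - σ| / δ) ^
4`. This covers unbounded `σ` as well. -/
theorem exists_norm_powerTaylor_le (a : ℝ) {ξ₀ : ℂ} (hξ₀ : ξ₀ - 1 ∈ Complex.slitPlane) :
    ∃ K, 0 ≤ K ∧ ∀ᶠ ξ in 𝓝 ξ₀, ∀ δ σ : ℝ, 0 < δ → δ ≤ 1 → δ ≤ |1 - σ| →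
      ‖powerTaylor a ξ σ‖ ≤ K / δ ^ 4 * (1 - σ) ^ 4 := by
  have hne : ξ₀ - 1 ≠ 0 := Complex.slitPlane_ne_zero hξ₀
  have h1 : ContinuousAt (fun ξ : ℂ => ξ - 1) ξ₀ := by fun_prop
  have hi : ContinuousAt (fun ξ : ℂ => (ξ - 1)⁻¹) ξ₀ := h1.inv₀ hne
  have e6 := (h1.cpow (continuousAt_const (y := (a : ℂ) - 1)) hξ₀).norm.eventually_le_const
    (lt_add_one _)
  have e7 := hi.norm.eventually_le_const (lt_add_one _)
  set L := ‖(ξ₀ - 1) ^ ((a : ℂ) - 1)‖ + 1 with hLdef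
  set N := ‖(ξ₀ - 1)⁻¹‖ + 1 with hNdef
  refine ⟨L * ∑ j ∈ Finset.range 4, ‖Ring.choose ((a : ℂ) - 1) j‖ * N ^ j, by positivity, ?_⟩
  filter_upwards [e6, e7] with ξ h6 h7 δ σ hδ hδ1 hσ
  rw [powerTaylor, norm_mul, mul_div_assoc, mul_assoc]
  refine mul_le_mul h6 ((norm_sum_le _ _).trans ?_) (norm_nonneg _) (by positivity)
  rw [Finset.sum_div, Finset.sum_mul]
  refine Finset.sum_le_sum fun j hj => ?_
  have hj4 : j ≤ 4 := (Finset.mem_range.1 hj).le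
  have h8 : |1 - σ| ^ j ≤ (1 - σ) ^ 4 / δ ^ 4 := by
    have e1 : 1 ≤ |1 - σ| / δ := (one_le_div hδ).2 hσ
    have e2 : |1 - σ| ≤ |1 - σ| / δ := le_div_self (abs_nonneg _) hδ hδ1
    calc |1 - σ| ^ j ≤ (|1 - σ| / δ) ^ j := by gcongr
      _ ≤ (|1 - σ| / δ) ^ 4 := pow_le_pow_right₀ e1 hj4
      _ = _ := by rw [div_pow, Even.pow_abs (by decide : Even 4)]
  rw [norm_mul, norm_pow, norm_div, Complex.norm_real, Real.norm_eq_abs, div_eq_mul_inv |1 - σ|,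
    mul_pow, ← norm_inv]
  calc _ ≤ ‖Ring.choose ((a : ℂ) - 1) j‖ * ((1 - σ) ^ 4 / δ ^ 4 * N ^ j) := by gcongr
    _ = _ := by ring

theorem exists_cpow_sub_powerTaylor_le (a : ℝ) {ξ₀ : ℂ} {X : ℝ} (hX : 1 < X) (hξ₀ : X < ξ₀.re) :
    ∃ C, 0 ≤ C ∧ ∀ᶠ ξ in 𝓝 ξ₀,
      (∀ σ ∈ Ioc 0 X, ‖(ξ - (σ : ℝ)) ^ ((a : ℂ) - 1) - powerTaylor a ξ σ‖ ≤ C * (1 - σ) ^ 4) ∧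
      ∀ σ ∈ Ioi X, ‖powerTaylor a ξ σ‖ ≤ C * (1 - σ) ^ 4 := by
  have hs : ξ₀ - 1 ∈ Complex.slitPlane := Or.inl (by simp; linarith)
  obtain ⟨C, hC, h1⟩ := exists_cpow_sub_powerTaylor_le_near a hs
  obtain ⟨K, hK, h2⟩ := exists_norm_powerTaylor_le a hs
  rw [nhds_prod_eq] at h1
  obtain ⟨V, hV, W, hW, hVW⟩ := eventually_prod_iff.1 h1
  obtain ⟨δ', hδ', hball⟩ := Metric.eventually_nhds_iff.1 hW
  -- The bound `δ ≤ X - 1` ensures that every `σ > X` is at least `δ` away from 1.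
  set δ := min δ' (min 1 (X - 1)) with hδdef
  have hδ : 0 < δ := lt_min hδ' (lt_min one_pos (sub_pos.2 hX))
  have hδ1 : δ ≤ 1 := (min_le_right _ _).trans (min_le_left _ _)
  have hδX : δ ≤ X - 1 := (min_le_right _ _).trans (min_le_right _ _)
  have e3 := (continuous_norm.tendsto ξ₀).eventually_le_const (lt_add_one _)
  have e4 := (Complex.continuous_re.tendsto ξ₀).eventually_const_lt
    (by linarith : X + (ξ₀.re - X) / 2 < ξ₀.re)
  set d := (ξ₀.re - X) / 2 with hd
  have hd0 : 0 < d := by rw [hd]; linarith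
  set B := d ^ (a - 1) + (‖ξ₀‖ + 1 + X) ^ (a - 1) with hB
  have hX0 : 0 < X := by linarith
  have hB0 : 0 ≤ B := by positivity
  have hC' : C ≤ C + (B + K) / δ ^ 4 := le_add_of_nonneg_right (by positivity)
  refine ⟨C + (B + K) / δ ^ 4, by positivity, ?_⟩
  filter_upwards [hV, h2, e3, e4] with ξ hξ hKξ hξn hξX
  refine ⟨fun σ hσ => ?_, fun σ hσ => ?_⟩
  · have hn : 0 ≤ (1 - σ) ^ 4 := Even.pow_nonneg (by decide) _
    rcases lt_or_ge |1 - σ| δ with h | h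
    · refine (hVW hξ (hball ?_)).trans (mul_le_mul_of_nonneg_right hC' hn)
      rw [dist_comm, Real.dist_eq]
      exact h.trans_le (min_le_left _ _)
    · have h4 : ‖(ξ - (σ : ℝ)) ^ ((a : ℂ) - 1)‖ ≤ B := by
        have k1 : d ≤ ‖ξ - (σ : ℝ)‖ := by
          refine le_trans ?_ (Complex.re_le_norm _)
          rw [Complex.sub_re, Complex.ofReal_re]
          linarith [hσ.2]
        have k2 : ‖ξ - (σ : ℝ)‖ ≤ ‖ξ₀‖ + 1 + X := by
          refine (norm_sub_le _ _).trans ?_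
          rw [Complex.norm_real, Real.norm_of_nonneg hσ.1.le]
          linarith [hσ.2]
        rw [norm_cpow_sub_one]
        exact rpow_le_add_rpow _ hd0 k1 k2
      have h6 : δ ^ 4 ≤ (1 - σ) ^ 4 := by
        rw [← Even.pow_abs (by decide : Even 4) (1 - σ)]
        exact pow_le_pow_left₀ hδ.le h 4
      calc _ ≤ B / δ ^ 4 * δ ^ 4 + K / δ ^ 4 * (1 - σ) ^ 4 := by
            refine (norm_sub_le _ _).trans (add_le_add (h4.trans_eq (by field_simp)) ?_)
            exact hKξ δ σ hδ hδ1 h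
        _ ≤ B / δ ^ 4 * (1 - σ) ^ 4 + K / δ ^ 4 * (1 - σ) ^ 4 := by gcongr
        _ = (B + K) / δ ^ 4 * (1 - σ) ^ 4 := by ring
        _ ≤ _ := mul_le_mul_of_nonneg_right (le_add_of_nonneg_left hC) hn
  · have hn : 0 ≤ (1 - σ) ^ 4 := Even.pow_nonneg (by decide) _
    have h : δ ≤ |1 - σ| := by
      rw [abs_sub_comm]
      exact le_trans (by linarith [mem_Ioi.1 hσ]) (le_abs_self _)
    refine (hKξ δ σ hδ hδ1 h).trans (mul_le_mul_of_nonneg_right ?_ hn)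
    refine le_add_of_nonneg_of_le hC ?_
    gcongr
    linarith

/-- The contribution of the saddle point. -/
theorem exists_innerPart_sub_le {a : ℝ} (ha : 0 < a) {ξ₀ : ℂ} {X : ℝ} (hX : 1 < X)
    (hξ₀ : X < ξ₀.re) : ∃ C, 0 ≤ C ∧ ∀ᶠ ξ in 𝓝 ξ₀, ∀ b, a + 1 ≤ b →
      ‖innerPart a b X ξ - ∫ σ in Ioi 0, (gammaWeight a b σ : ℂ) * powerTaylor a ξ σ‖ ≤
        gammaMass a b * (C / b ^ 2) := by
  obtain ⟨C, hC, h⟩ := exists_cpow_sub_powerTaylor_le a hX hξ₀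
  refine ⟨C * (a ^ 4 + 6 * a ^ 2 + 9), by positivity, ?_⟩
  have e4 := (Complex.continuous_re.tendsto ξ₀).eventually_const_lt hξ₀
  filter_upwards [h, e4] with ξ hξ hξX b hb
  have hb0 : 0 < b := by linarith
  have hab : a < b := by linarith
  have hX0 : 0 < X := by linarith
  have hI := integrableOn_gammaWeight_mul_powerTaylor hb0 hab ξ
  have h4 := integrableOn_gammaWeight_mul_one_sub_pow hb0 hab 4
  have hIoc : IntegrableOn (fun σ => (gammaWeight a b σ : ℂ) * powerTaylor a ξ σ) (Ioc 0 X) :=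
    hI.mono_set Ioc_subset_Ioi_self
  have hIoi : IntegrableOn (fun σ => (gammaWeight a b σ : ℂ) * powerTaylor a ξ σ) (Ioi X) :=
    hI.mono_set (Ioi_subset_Ioi hX0.le)
  have hin : IntegrableOn (fun σ => (gammaWeight a b σ : ℂ) * (ξ - (σ : ℝ)) ^ ((a : ℂ) - 1))
      (Ioc 0 X) := by
    have hd : IntegrableOn (fun σ => C * (gammaWeight a b σ * (1 - σ) ^ 4) +
        ‖(gammaWeight a b σ : ℂ) * powerTaylor a ξ σ‖) (Ioc 0 X) :=
      ((h4.mono_set Ioc_subset_Ioi_self).const_mul C).add hIoc.norm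
    refine hd.mono' ?_ ?_
    · refine (ContinuousOn.aestronglyMeasurable ?_ measurableSet_Ioc)
      refine ContinuousOn.mul ?_ ?_
      · unfold gammaWeight
        refine Complex.continuous_ofReal.comp_continuousOn (ContinuousOn.mul ?_ (by fun_prop))
        exact continuousOn_id.rpow_const fun σ hσ => Or.inl hσ.1.ne'
      · refine ContinuousOn.cpow_const (by fun_prop) fun σ hσ => Or.inl ?_
        rw [Complex.sub_re, Complex.ofReal_re]
        linarith [hσ.2]
    · filter_upwards [ae_restrict_mem measurableSet_Ioc] with σ hσ
      have h1 := hξ.1 σ hσ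
      have h2 := gammaWeight_nonneg a b hσ.1.le
      rw [norm_mul, norm_mul, Complex.norm_real, Real.norm_of_nonneg h2]
      have h3 := norm_le_norm_add_norm_sub' ((ξ - (σ : ℝ)) ^ ((a : ℂ) - 1)) (powerTaylor a ξ σ)
      calc _ ≤ gammaWeight a b σ * (‖powerTaylor a ξ σ‖ + C * (1 - σ) ^ 4) := by
            gcongr
            linarith
        _ = _ := by ring
  have hsplit : ∫ σ in Ioi 0, (gammaWeight a b σ : ℂ) * powerTaylor a ξ σ =
      (∫ σ in Ioc 0 X, (gammaWeight a b σ : ℂ) * powerTaylor a ξ σ) +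
        ∫ σ in Ioi X, (gammaWeight a b σ : ℂ) * powerTaylor a ξ σ := by
    rw [← setIntegral_union (Ioc_disjoint_Ioi le_rfl) measurableSet_Ioi hIoc hIoi,
      Ioc_union_Ioi_eq_Ioi hX0.le]
  have hdef : innerPart a b X ξ =
      ∫ σ in Ioc 0 X, (gammaWeight a b σ : ℂ) * (ξ - (σ : ℝ)) ^ ((a : ℂ) - 1) := rfl
  have h5 : ‖∫ σ in Ioc 0 X, ((gammaWeight a b σ : ℂ) * (ξ - (σ : ℝ)) ^ ((a : ℂ) - 1) -
      (gammaWeight a b σ : ℂ) * powerTaylor a ξ σ)‖ ≤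
      ∫ σ in Ioc 0 X, C * (gammaWeight a b σ * (1 - σ) ^ 4) := by
    refine norm_integral_le_of_norm_le ((h4.mono_set Ioc_subset_Ioi_self).const_mul C) ?_
    filter_upwards [ae_restrict_mem measurableSet_Ioc] with σ hσ
    have h2 := gammaWeight_nonneg a b hσ.1.le
    rw [← mul_sub, norm_mul, Complex.norm_real, Real.norm_of_nonneg h2, mul_left_comm]
    exact mul_le_mul_of_nonneg_left (hξ.1 σ hσ) h2
  have h6 : ‖∫ σ in Ioi X, (gammaWeight a b σ : ℂ) * powerTaylor a ξ σ‖ ≤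
      ∫ σ in Ioi X, C * (gammaWeight a b σ * (1 - σ) ^ 4) := by
    refine norm_integral_le_of_norm_le ((h4.mono_set (Ioi_subset_Ioi hX0.le)).const_mul C) ?_
    filter_upwards [ae_restrict_mem measurableSet_Ioi] with σ hσ
    have h2 := gammaWeight_nonneg a b (hX0.trans hσ).le
    rw [norm_mul, Complex.norm_real, Real.norm_of_nonneg h2, mul_left_comm]
    exact mul_le_mul_of_nonneg_left (hξ.2 σ hσ) h2
  -- The Taylor error on `(0, X]` and the polynomial's own tail beyond `X` have the same majorant,
  -- so together they cost one full fourth moment.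
  have h7 : (∫ σ in Ioc 0 X, C * (gammaWeight a b σ * (1 - σ) ^ 4)) +
      ∫ σ in Ioi X, C * (gammaWeight a b σ * (1 - σ) ^ 4) =
      C * ∫ σ in Ioi 0, gammaWeight a b σ * (1 - σ) ^ 4 := by
    rw [← setIntegral_union (Ioc_disjoint_Ioi le_rfl) measurableSet_Ioi
      ((h4.mono_set Ioc_subset_Ioi_self).const_mul C)
      ((h4.mono_set (Ioi_subset_Ioi hX0.le)).const_mul C), Ioc_union_Ioi_eq_Ioi hX0.le,
      integral_const_mul]
  rw [hsplit, hdef, ← sub_sub, ← integral_sub hin hIoc]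
  refine (norm_sub_le _ _).trans ((add_le_add h5 h6).trans ?_)
  rw [h7]
  calc _ ≤ C * (gammaMass a b * ((a ^ 4 + 6 * a ^ 2 + 9) / b ^ 2)) :=
        mul_le_mul_of_nonneg_left
          (integral_gammaWeight_mul_one_sub_pow_four_le ha (by linarith) hab) hC
    _ = _ := by ring

/-! ### The segment from `X` to `ξ` is negligible. -/

/-- On the segment `re w ≥ X` and `1 ≤ ‖w‖ ≤ ‖ξ‖`, so the integrand is at most `exp (-b X) ‖ξ‖ ^ b`
times `(1 - τ) ^ (a - 1)`. -/
theorem norm_tailPart_le {a b X ε : ℝ} (ha : 0 < a) (hab : a + 1 ≤ b) (hX : 1 ≤ X) {ξ : ℂ}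
    (hξ : X ≤ ξ.re) (hlog : Real.log ‖ξ‖ ≤ X - 1 - ε) :
    ‖tailPart a b X ξ‖ ≤ ‖ξ - X‖ ^ a *
      ((∫ τ in Ioc (0 : ℝ) 1, (1 - τ) ^ (a - 1)) * Real.exp (-(b * (1 + ε)))) := by
  have hb : 0 < b := by linarith
  have hξn : X ≤ ‖ξ‖ := hξ.trans (Complex.re_le_norm ξ)
  rw [tailPart, norm_mul, Complex.norm_cpow_real, ← integral_mul_const]
  refine mul_le_mul_of_nonneg_left ?_ (Real.rpow_nonneg (norm_nonneg _) _)
  refine norm_integral_le_of_norm_le ((integrableOn_one_sub_rpow ha).mul_const _) ?_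
  filter_upwards [ae_restrict_mem measurableSet_Ioc] with τ hτ
  have hτ0 : 0 ≤ (1 - τ) ^ (a - 1) := Real.rpow_nonneg (sub_nonneg.2 hτ.2) _
  rw [norm_mul, norm_mul, Complex.norm_real, Real.norm_of_nonneg hτ0, Complex.norm_cpow_real,
    Complex.norm_exp]
  refine mul_le_mul_of_nonneg_left ?_ hτ0
  have h1 := segment_re_ge hξ hτ.1.le
  have h2 := segment_norm_le (by linarith : 0 ≤ X) ⟨hτ.1.le, hτ.2⟩ hξn le_rfl
  set w := (X : ℂ) + (ξ - X) * τ with hw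
  have h3 : 1 ≤ ‖w‖ := (hX.trans h1).trans (Complex.re_le_norm w)
  calc Real.exp (-((b : ℂ) * w)).re * ‖w‖ ^ (b - a - 1)
      ≤ Real.exp (-(b * X)) * ‖ξ‖ ^ b := by
        refine mul_le_mul (Real.exp_le_exp.2 ?_) ?_ (by positivity) (by positivity)
        · rw [Complex.neg_re, Complex.re_ofReal_mul]
          have := mul_le_mul_of_nonneg_left h1 hb.le
          linarith
        · exact (Real.rpow_le_rpow_of_exponent_le h3 (by linarith)).trans
            (Real.rpow_le_rpow (norm_nonneg _) h2 hb.le)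
    _ = Real.exp (-(b * X) + Real.log ‖ξ‖ * b) := by
        rw [Real.rpow_def_of_pos (by linarith), Real.exp_add]
    _ ≤ _ := by
        refine Real.exp_le_exp.2 ?_
        have := mul_le_mul_of_nonneg_left hlog hb.le
        linarith

/-- Keeping only the window `(1, 1 + η]`, where the power of `σ` is at least 1, bounds the mass
below without an asymptotic formula for `Γ(b - a)`. -/
theorem mul_exp_le_gammaMass {a b η : ℝ} (ha : 0 < a) (hab : a + 1 ≤ b) (hη : 0 ≤ η) :
    η * Real.exp (-(b * (1 + η))) ≤ gammaMass a b := by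
  have hb : 0 < b := by linarith
  have hI : IntegrableOn (gammaWeight a b) (Ioi 0) := by
    simpa using integrableOn_gammaWeight_mul_pow hb (by linarith : a < b) 0
  have hsub : Ioc 1 (1 + η) ⊆ Ioi (0 : ℝ) := fun σ hσ => one_pos.trans hσ.1
  rw [← integral_gammaWeight hb (by linarith : a < b)]
  calc η * Real.exp (-(b * (1 + η))) = ∫ _ in Ioc 1 (1 + η), Real.exp (-(b * (1 + η))) := by
        simp [hη]
    _ ≤ ∫ σ in Ioc 1 (1 + η), gammaWeight a b σ := by
        refine setIntegral_mono_on (by simp) (hI.mono_set hsub) measurableSet_Ioc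
          fun σ hσ => ?_
        refine le_trans ?_ (mul_le_mul_of_nonneg_right
          (Real.one_le_rpow hσ.1.le (by linarith : 0 ≤ b - a - 1)) (Real.exp_nonneg _))
        rw [one_mul, Real.exp_le_exp, neg_le_neg_iff]
        exact mul_le_mul_of_nonneg_left hσ.2 hb.le
    _ ≤ _ := by
        refine setIntegral_mono_set hI ?_ hsub.eventuallyLE
        filter_upwards [ae_restrict_mem measurableSet_Ioi] with σ hσ
        exact gammaWeight_nonneg a b (le_of_lt hσ)

theorem log_norm_eq (ξ : ℂ) : Real.log ‖ξ‖ = 1 / 2 * Real.log (ξ.re ^ 2 + ξ.im ^ 2) := by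
  have h : ξ.re ^ 2 + ξ.im ^ 2 = ‖ξ‖ ^ 2 := by
    rw [Complex.sq_norm, Complex.normSq_apply]
    ring
  rw [h, Real.log_pow]
  push_cast
  ring

theorem exists_norm_tailPart_le {a : ℝ} (ha : 0 < a) {ξ₀ : ℂ} (h : ξ₀ ∈ regionB) :
    ∃ X, 1 < X ∧ X < ξ₀.re ∧ ∃ C, 0 ≤ C ∧ ∀ᶠ ξ in 𝓝 ξ₀, ∀ b, a + 1 ≤ b →
      ‖tailPart a b X ξ‖ ≤ gammaMass a b * (C / b ^ 2) := by
  obtain ⟨h1, h2⟩ := h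
  rw [← log_norm_eq] at h2
  -- The gap `6 η` is spent in thirds: on moving `X` left of `re ξ₀`, on the variation of `log ‖ξ‖`
  -- near `ξ₀`, and on the decay margin `ε = 2 η`, half of which pays for the lower bound of the
  -- mass.
  set η := (ξ₀.re - 1 - Real.log ‖ξ₀‖) / 6 with hη
  have hη0 : 0 < η := by rw [hη]; linarith
  set s := min (2 * η) ((ξ₀.re - 1) / 2) with hs
  have hs0 : 0 < s := lt_min (by linarith) (by linarith)
  have hs1 : s ≤ 2 * η := min_le_left _ _
  have hs2 : s ≤ (ξ₀.re - 1) / 2 := min_le_right _ _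
  set X := ξ₀.re - s with hX
  have hX1 : 1 < X := by linarith
  have hn0 : ‖ξ₀‖ ≠ 0 := by
    have := Complex.re_le_norm ξ₀
    linarith
  set A := ∫ τ in Ioc (0 : ℝ) 1, (1 - τ) ^ (a - 1) with hA
  have hA0 : 0 ≤ A := setIntegral_nonneg measurableSet_Ioc fun τ hτ =>
    Real.rpow_nonneg (sub_nonneg.2 hτ.2) _
  set D := (‖ξ₀‖ + 1 + X) ^ a with hD
  have hD0 : 0 ≤ D := by positivity
  refine ⟨X, hX1, by linarith, D * A / η * (2 / η ^ 2), by positivity, ?_⟩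
  have e1 := (Complex.continuous_re.tendsto ξ₀).eventually_const_lt (by linarith : X < ξ₀.re)
  have e2 : ∀ᶠ ξ in 𝓝 ξ₀, Real.log ‖ξ‖ < Real.log ‖ξ₀‖ + 2 * η :=
    (continuous_norm.continuousAt.log hn0).eventually_lt_const (by linarith)
  have e3 := (continuous_norm.tendsto ξ₀).eventually_le_const (lt_add_one _)
  filter_upwards [e1, e2, e3] with ξ p1 p2 p3 b hb
  have hb0 : 0 < b := by linarith
  have h3 := norm_tailPart_le (ε := 2 * η) ha hb hX1.le p1.le (by linarith)
  have h4 := mul_exp_le_gammaMass ha hb hη0.le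
  have h5 : ‖ξ - X‖ ^ a ≤ D := by
    refine Real.rpow_le_rpow (norm_nonneg _) ((norm_sub_le _ _).trans ?_) ha.le
    rw [Complex.norm_real, Real.norm_of_nonneg (by linarith)]
    linarith
  have h6 : Real.exp (-(b * η)) ≤ 2 / η ^ 2 / b ^ 2 := by
    have e4 := Real.quadratic_le_exp_of_nonneg (by positivity : 0 ≤ b * η)
    rw [Real.exp_neg, div_div, inv_le_comm₀ (Real.exp_pos _) (by positivity), inv_div]
    have : 0 < b * η := by positivity
    calc η ^ 2 * b ^ 2 / 2 = (b * η) ^ 2 / 2 := by ring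
      _ ≤ _ := by linarith
  have h7 : Real.exp (-(b * (1 + 2 * η))) =
      Real.exp (-(b * (1 + η))) * Real.exp (-(b * η)) := by
    rw [← Real.exp_add]
    congr 1
    ring
  calc _ ≤ D * (A * (Real.exp (-(b * (1 + η))) * Real.exp (-(b * η)))) := by
        rw [← h7]
        exact h3.trans (mul_le_mul_of_nonneg_right h5 (by positivity))
    _ = η * Real.exp (-(b * (1 + η))) * (D * A / η * Real.exp (-(b * η))) := by
        field_simp
    _ ≤ gammaMass a b * (D * A / η * (2 / η ^ 2 / b ^ 2)) := by
        refine mul_le_mul h4 ?_ (by positivity) ?_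
        · gcongr
        · exact (gammaMass_pos hb0 (by linarith)).le
    _ = _ := by ring

/-! ### The expansion on `ℬ` and the conclusion. -/

/-- The coefficient of `1 / b` contributed by the saddle point. -/
noncomputable def saddleCoeff (a : ℝ) (ξ : ℂ) : ℂ :=
  a * (a - 1) / (ξ - 1) + ((a : ℂ) - 1) * (a - 2) / 2 / (ξ - 1) ^ 2

theorem exists_norm_saddleCoeff_le (a : ℝ) {ξ₀ : ℂ} (h : ξ₀ ≠ 1) :
    ∃ S, 0 ≤ S ∧ ∀ᶠ ξ in 𝓝 ξ₀, ‖saddleCoeff a ξ‖ ≤ S := by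
  have hne : ξ₀ - 1 ≠ 0 := sub_ne_zero.2 h
  have h1 : ContinuousAt (saddleCoeff a) ξ₀ := by
    unfold saddleCoeff
    refine ContinuousAt.add (ContinuousAt.div ?_ ?_ hne) (ContinuousAt.div ?_ ?_ (pow_ne_zero 2 hne))
      <;> fun_prop
  exact ⟨_, by positivity, h1.norm.eventually_le_const (lt_add_one _)⟩

theorem exists_integral_powerTaylor_eq {a : ℝ} (ha : 0 < a) {ξ₀ : ℂ} (h : ξ₀ ≠ 1) :
    ∃ C, 0 ≤ C ∧ ∀ᶠ ξ in 𝓝 ξ₀, ∀ b, a + 1 ≤ b → ∃ R : ℂ, ‖R‖ ≤ C / b ^ 2 ∧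
      ∫ σ in Ioi 0, (gammaWeight a b σ : ℂ) * powerTaylor a ξ σ =
        gammaMass a b * (ξ - 1) ^ ((a : ℂ) - 1) * (1 + saddleCoeff a ξ / b + R) := by
  have hne : ξ₀ - 1 ≠ 0 := sub_ne_zero.2 h
  have h1 : ContinuousAt (fun ξ : ℂ => ((a : ℂ) - 1) * (a - 2) / 2 / (ξ - 1) ^ 2) ξ₀ :=
    ContinuousAt.div (by fun_prop) (by fun_prop) (pow_ne_zero 2 hne)
  have h2 : ContinuousAt (fun ξ : ℂ => ((a : ℂ) - 1) * (a - 2) * (a - 3) / 6 / (ξ - 1) ^ 3) ξ₀ :=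
    ContinuousAt.div (by fun_prop) (by fun_prop) (pow_ne_zero 3 hne)
  have e1 := h1.norm.eventually_le_const (lt_add_one _)
  have e2 := h2.norm.eventually_le_const (lt_add_one _)
  set P := ‖((a : ℂ) - 1) * (a - 2) / 2 / (ξ₀ - 1) ^ 2‖ + 1 with hP
  set Q := ‖((a : ℂ) - 1) * (a - 2) * (a - 3) / 6 / (ξ₀ - 1) ^ 3‖ + 1 with hQ
  have hP0 : 0 ≤ P := by positivity
  have hQ0 : 0 ≤ Q := by positivity
  refine ⟨P * |a ^ 2 - a| + Q * (a ^ 3 + 3 * a + 2), by positivity, ?_⟩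
  filter_upwards [e1, e2] with ξ p1 p2 b hb
  have hb0 : 0 < b := by linarith
  refine ⟨_, ?_, integral_gammaWeight_mul_powerTaylor hb0 (by linarith) ξ⟩
  refine (norm_add_le _ _).trans ?_
  rw [norm_mul, norm_mul, Complex.norm_real, Complex.norm_real, Real.norm_eq_abs, Real.norm_eq_abs,
    add_div, mul_div_assoc P, mul_div_assoc Q]
  refine add_le_add (mul_le_mul p1 ?_ (abs_nonneg _) hP0) (mul_le_mul p2
    (abs_central_third_moment_le ha (by linarith) (by linarith)) (abs_nonneg _) hQ0)
  rw [abs_div, abs_of_pos (by positivity : 0 < b ^ 2)]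

/-- The errors are measured against `gammaMass`; dividing also by `(ξ - 1) ^ (a - 1)`, whose inverse
is bounded near `ξ₀`, makes them relative. -/
theorem exists_innerPart_add_tailPart_eq {a : ℝ} (ha : 0 < a) {ξ₀ : ℂ} (h : ξ₀ ∈ regionB) :
    ∃ X, 0 < X ∧ X < ξ₀.re ∧ ∃ C, 0 ≤ C ∧ ∀ᶠ ξ in 𝓝 ξ₀, ∀ b, a + 1 ≤ b →
      ∃ R : ℂ, ‖R‖ ≤ C / b ^ 2 ∧ innerPart a b X ξ + tailPart a b X ξ =
        gammaMass a b * (ξ - 1) ^ ((a : ℂ) - 1) * (1 + saddleCoeff a ξ / b + R) := by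
  obtain ⟨X, hX1, hX, C₁, hC₁, h1⟩ := exists_norm_tailPart_le ha h
  obtain ⟨C₂, hC₂, h2⟩ := exists_innerPart_sub_le ha hX1 hX
  have hξ₀ : ξ₀ ≠ 1 := fun h3 => by
    rw [h3, Complex.one_re] at hX
    linarith
  obtain ⟨C₃, hC₃, h3⟩ := exists_integral_powerTaylor_eq ha hξ₀
  have hs : ξ₀ - 1 ∈ Complex.slitPlane := Or.inl (by simp; linarith)
  have h4 : ContinuousAt (fun ξ : ℂ => (ξ - 1) ^ (-((a : ℂ) - 1))) ξ₀ :=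
    ContinuousAt.cpow (by fun_prop) continuousAt_const hs
  have e4 := h4.norm.eventually_le_const (lt_add_one _)
  have e5 : ∀ᶠ ξ : ℂ in 𝓝 ξ₀, ξ ≠ 1 := eventually_ne_nhds hξ₀
  set L := ‖(ξ₀ - 1) ^ (-((a : ℂ) - 1))‖ + 1 with hL
  have hL0 : 0 ≤ L := by positivity
  refine ⟨X, by linarith, hX, C₃ + L * (C₁ + C₂), by positivity, ?_⟩
  filter_upwards [h1, h2, h3, e4, e5] with ξ p1 p2 p3 p4 p5 b hb
  obtain ⟨R, hR, hEq⟩ := p3 b hb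
  have hm : 0 < gammaMass a b := gammaMass_pos (by linarith) (by linarith)
  have hm' : (gammaMass a b : ℂ) ≠ 0 := Complex.ofReal_ne_zero.2 hm.ne'
  set E := innerPart a b X ξ + tailPart a b X ξ -
    ∫ σ in Ioi 0, (gammaWeight a b σ : ℂ) * powerTaylor a ξ σ with hE
  have hEn : ‖E‖ ≤ gammaMass a b * ((C₁ + C₂) / b ^ 2) := by
    have h6 : E = tailPart a b X ξ + (innerPart a b X ξ -
        ∫ σ in Ioi 0, (gammaWeight a b σ : ℂ) * powerTaylor a ξ σ) := by
      rw [hE]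
      ring
    rw [h6]
    refine (norm_add_le _ _).trans ((add_le_add (p1 b hb) (p2 b hb)).trans_eq ?_)
    ring
  have hone : (ξ - 1) ^ ((a : ℂ) - 1) * (ξ - 1) ^ (-((a : ℂ) - 1)) = 1 := by
    rw [← Complex.cpow_add _ _ (sub_ne_zero.2 p5), add_neg_cancel, Complex.cpow_zero]
  refine ⟨R + (ξ - 1) ^ (-((a : ℂ) - 1)) * (E / gammaMass a b), ?_, ?_⟩
  · refine (norm_add_le _ _).trans ?_
    rw [add_div, mul_div_assoc]
    refine add_le_add hR ?_
    rw [norm_mul, norm_div, Complex.norm_real, Real.norm_of_nonneg hm.le]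
    refine mul_le_mul p4 ?_ (by positivity) hL0
    rwa [div_le_iff₀' hm]
  · have h7 : innerPart a b X ξ + tailPart a b X ξ =
        (∫ σ in Ioi 0, (gammaWeight a b σ : ℂ) * powerTaylor a ξ σ) + E := by
      rw [hE]
      ring
    have h8 : (gammaMass a b : ℂ) * (E / gammaMass a b) = E := mul_div_cancel₀ _ hm'
    rw [h7, hEq]
    linear_combination (-(gammaMass a b : ℂ) * (E / gammaMass a b)) * hone - h8

/-- `Γ(b - a)` cancels, leaving `Γ(b) b ^ (a - b) / Γ(a)`, so Stirling's formula is used for `Γ(b)`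
alone. -/
theorem gamma_div_mul_gammaMass {a b : ℝ} (ha : 0 < a) (hb : 0 < b) (hab : a < b) :
    Real.Gamma b / (Real.Gamma a * Real.Gamma (b - a)) * gammaMass a b =
      b ^ (a - 1 / 2) * (√(2 * Real.pi) / Real.Gamma a) * Real.exp (-b) *
        Real.exp (stirlingRemainder b) := by
  have h1 : Real.Gamma (b - a) ≠ 0 := (Real.Gamma_pos_of_pos (sub_pos.2 hab)).ne'
  have h2 : Real.Gamma a ≠ 0 := (Real.Gamma_pos_of_pos ha).ne'
  have h3 : b ^ (b - 1 / 2) * (1 / b) ^ (b - a) = b ^ (a - 1 / 2) := by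
    rw [one_div b, Real.inv_rpow hb.le, ← Real.rpow_neg hb.le, ← Real.rpow_add hb]
    congr 1
    ring
  rw [gammaMass, Gamma_eq_mul_exp_stirlingRemainder hb, ← h3]
  field_simp

theorem confluentHypergeometric_expansion_regionB {a : ℝ} (ha : 0 < a) {ξ₀ : ℂ}
    (h : ξ₀ ∈ regionB) :
    ∃ C, ∀ᶠ ξ in 𝓝 ξ₀, ∀ b : ℝ, a + 2 ≤ b → ∃ R : ℂ, ‖R‖ ≤ C / b ^ 2 ∧
        confluentHypergeometric (a : ℂ) (b : ℂ) ((b : ℂ) * ξ) =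
          Complex.exp ((b : ℂ) * (ξ - 1 - Complex.log ξ)) *
            ((b ^ (a - 1 / 2) : ℝ) : ℂ) *
            ((Real.sqrt (2 * Real.pi) / Real.Gamma a : ℝ) : ℂ) *
            (ξ * (ξ - 1) ^ ((a : ℂ) - 1)) *
            (1 + 1 / (12 * (b : ℂ)) *
                (1 + 12 * (a : ℂ) * (a - 1) / (ξ - 1)
                  + 6 * ((a : ℂ) - 1) * (a - 2) / (ξ - 1) ^ 2)
              + R) := by
  obtain ⟨X, hX0, hX, C, hC, h1⟩ := exists_innerPart_add_tailPart_eq ha h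
  have hξ₀ : ξ₀ ≠ 1 := fun h3 => by
    have h4 := h.1
    rw [h3, Complex.one_re] at h4
    exact lt_irrefl _ h4
  obtain ⟨S, hS, h2⟩ := exists_norm_saddleCoeff_le a hξ₀
  have e3 := (Complex.continuous_re.tendsto ξ₀).eventually_const_lt hX
  refine ⟨S / 12 + 2 * C + 2 * (1 + S), ?_⟩
  filter_upwards [h1, h2, e3] with ξ p1 p2 p3 b hb
  have hb2 : 2 ≤ b := by linarith
  have hb0 : 0 < b := by linarith
  have hb' : (b : ℂ) ≠ 0 := Complex.ofReal_ne_zero.2 hb0.ne'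
  obtain ⟨R, hR, hEq⟩ := p1 b (by linarith)
  have hξ : ξ ≠ 0 := fun h3 => by
    rw [h3, Complex.zero_re] at p3
    linarith
  set μ : ℂ := ((Real.exp (stirlingRemainder b) : ℝ) : ℂ) with hμ
  set ρ : ℂ := ((Real.exp (stirlingRemainder b) - (1 + 1 / (12 * b)) : ℝ) : ℂ) with hρ
  have hρn : ‖ρ‖ ≤ 2 / b ^ 2 := by
    rw [hρ, Complex.norm_real, Real.norm_eq_abs]
    exact abs_exp_stirlingRemainder_sub_le hb2
  have hμρ : μ = 1 + 1 / (12 * b) + ρ := by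
    rw [hμ, hρ]
    push_cast
    ring
  have hbinv : ‖(1 / (12 * b) : ℂ)‖ = 1 / 12 / b := by
    rw [norm_div, norm_mul, Complex.norm_real, Real.norm_of_nonneg hb0.le]
    norm_num
    ring
  have hμn : ‖μ‖ ≤ 2 := by
    rw [hμρ]
    refine (norm_add₃_le).trans ?_
    rw [hbinv, norm_one]
    have k1 : 1 / 12 / b ≤ 1 / 12 := div_le_self (by norm_num) (by linarith)
    have k2 : 2 / b ^ 2 ≤ 2 / 2 ^ 2 := by gcongr
    linarith
  have hid := innerPart_add_tailPart ha (by linarith : a + 1 ≤ b) hX0 p3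
  have hG := gamma_div_mul_gammaMass ha hb0 (by linarith : a < b)
  have hGa : (Real.Gamma a : ℂ) ≠ 0 := Complex.ofReal_ne_zero.2 (Real.Gamma_pos_of_pos ha).ne'
  have hGba : (Real.Gamma (b - a) : ℂ) ≠ 0 :=
    Complex.ofReal_ne_zero.2 (Real.Gamma_pos_of_pos (by linarith)).ne'
  have hGb : (Real.Gamma b : ℂ) ≠ 0 := Complex.ofReal_ne_zero.2 (Real.Gamma_pos_of_pos hb0).ne'
  have hpow : Complex.exp ((b : ℂ) * (ξ - 1 - Complex.log ξ)) * ξ *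
      (ξ ^ ((b : ℂ) - 1) * Complex.exp (-(b * ξ))) = ((Real.exp (-b) : ℝ) : ℂ) := by
    have k1 : ξ * ξ ^ ((b : ℂ) - 1) = Complex.exp (Complex.log ξ * b) := by
      rw [Complex.cpow_sub _ _ hξ, Complex.cpow_one, mul_div_cancel₀ _ hξ,
        Complex.cpow_def_of_ne_zero hξ]
    calc _ = Complex.exp ((b : ℂ) * (ξ - 1 - Complex.log ξ)) * (ξ * ξ ^ ((b : ℂ) - 1)) *
          Complex.exp (-(b * ξ)) := by ring
      _ = _ := by
        rw [k1, ← Complex.exp_add, ← Complex.exp_add, Complex.ofReal_exp]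
        congr 1
        push_cast
        ring
  have hne : ξ ^ ((b : ℂ) - 1) * Complex.exp (-(b * ξ)) ≠ 0 :=
    mul_ne_zero (by simp [Complex.cpow_eq_zero_iff, hξ]) (Complex.exp_ne_zero _)
  -- These are the terms of order `b⁻²` and smaller in `(1 + 1 / (12 b) + ρ) (1 + saddleCoeff / b +
  -- R)`, where `ρ` is the error in Stirling's formula.
  refine ⟨saddleCoeff a ξ * (1 / (12 * b)) / b + μ * R + ρ * (1 + saddleCoeff a ξ / b), ?_, ?_⟩
  · refine (norm_add₃_le).trans ?_
    have k0 : ‖saddleCoeff a ξ * (1 / (12 * b)) / b‖ ≤ S / 12 / b ^ 2 := by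
      rw [norm_div, norm_mul, hbinv, Complex.norm_real, Real.norm_of_nonneg hb0.le]
      calc _ ≤ S * (1 / 12 / b) / b := by gcongr
        _ = _ := by ring
    have k1 : ‖μ * R‖ ≤ 2 * (C / b ^ 2) := by
      rw [norm_mul]
      exact mul_le_mul hμn hR (norm_nonneg _) zero_le_two
    have k2 : ‖ρ * (1 + saddleCoeff a ξ / b)‖ ≤ 2 / b ^ 2 * (1 + S) := by
      rw [norm_mul]
      refine mul_le_mul hρn ((norm_add_le _ _).trans ?_) (norm_nonneg _) (by positivity)
      rw [norm_one, norm_div, Complex.norm_real, Real.norm_of_nonneg hb0.le]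
      have : ‖saddleCoeff a ξ‖ / b ≤ ‖saddleCoeff a ξ‖ :=
        div_le_self (norm_nonneg _) (by linarith)
      linarith
    refine (add_le_add (add_le_add k0 k1) k2).trans_eq ?_
    ring
  · have hbr : (1 + 1 / (12 * (b : ℂ)) * (1 + 12 * (a : ℂ) * (a - 1) / (ξ - 1)
        + 6 * ((a : ℂ) - 1) * (a - 2) / (ξ - 1) ^ 2)
        + (saddleCoeff a ξ * (1 / (12 * b)) / b + μ * R + ρ * (1 + saddleCoeff a ξ / b))) =
        μ * (1 + saddleCoeff a ξ / b + R) := by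
      rw [hμρ, saddleCoeff]
      ring
    have hGc : (Real.Gamma b : ℂ) / (Real.Gamma a * Real.Gamma (b - a)) * gammaMass a b =
        ((b ^ (a - 1 / 2) : ℝ) : ℂ) * ((√(2 * Real.pi) / Real.Gamma a : ℝ) : ℂ) *
          ((Real.exp (-b) : ℝ) : ℂ) * μ := by
      rw [hμ]
      exact_mod_cast congrArg Complex.ofReal hG
    rw [hbr]
    refine mul_left_cancel₀ hne ?_
    have hM : ξ ^ ((b : ℂ) - 1) * Complex.exp (-(b * ξ)) *
        confluentHypergeometric a b (b * ξ) =
        Real.Gamma b / (Real.Gamma a * Real.Gamma (b - a)) *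
          (innerPart a b X ξ + tailPart a b X ξ) := by
      rw [← hid]
      field_simp
    rw [hM, hEq]
    linear_combination ((ξ - 1) ^ ((a : ℂ) - 1) * (1 + saddleCoeff a ξ / b + R)) * hGc -
      ((b ^ (a - 1 / 2) : ℝ) : ℂ) * ((√(2 * Real.pi) / Real.Gamma a : ℝ) : ℂ) * μ *
        ((ξ - 1) ^ ((a : ℂ) - 1) * (1 + saddleCoeff a ξ / b + R)) * hpow

theorem theoremB1 (a : ℝ) (ha : 0 < a) :
    (∀ K : Set ℂ, IsCompact K → K ⊆ regionA →
      ∃ C b₀ : ℝ, 0 < b₀ ∧ ∀ b : ℝ, b₀ ≤ b → ∀ ξ ∈ K, ∃ R : ℂ,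
        ‖R‖ ≤ C / b ^ 3 ∧
        confluentHypergeometric (a : ℂ) (b : ℂ) ((b : ℂ) * ξ) =
          (1 - ξ) ^ (-(a : ℂ)) *
            (1 - (a : ℂ) * (a + 1) / 2 * (ξ / (1 - ξ)) ^ 2 / (b : ℂ)
              + ((a : ℂ) * (a + 1) * (a + 2) * (a + 3) / 8 * (ξ / (1 - ξ)) ^ 4
                  + 2 * (a : ℂ) * (a + 1) * (a + 2) / 3 * (ξ / (1 - ξ)) ^ 3
                  + (a : ℂ) * (a + 1) / 2 * (ξ / (1 - ξ)) ^ 2) / (b : ℂ) ^ 2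
              + R)) ∧
    (∀ K : Set ℂ, IsCompact K → K ⊆ regionB →
      ∃ C b₀ : ℝ, 0 < b₀ ∧ ∀ b : ℝ, b₀ ≤ b → ∀ ξ ∈ K, ∃ R : ℂ,
        ‖R‖ ≤ C / b ^ 2 ∧
        confluentHypergeometric (a : ℂ) (b : ℂ) ((b : ℂ) * ξ) =
          Complex.exp ((b : ℂ) * (ξ - 1 - Complex.log ξ)) *
            ((b ^ (a - 1 / 2) : ℝ) : ℂ) *
            ((Real.sqrt (2 * Real.pi) / Real.Gamma a : ℝ) : ℂ) *
            (ξ * (ξ - 1) ^ ((a : ℂ) - 1)) *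
            (1 + 1 / (12 * (b : ℂ)) *
                (1 + 12 * (a : ℂ) * (a - 1) / (ξ - 1)
                  + 6 * ((a : ℂ) - 1) * (a - 2) / (ξ - 1) ^ 2)
              + R)) := 
  -- The threshold 8 comes from the sixth moment bound; `a + 2` guarantees both `a + 1 ≤ b` and the
  -- `b ≥ 2` of the Stirling estimate.
  ⟨fun _ hK hKA => exists_forall_isCompact hK hKA (b₀ := max 8 (a + 1)) (by positivity) 3
      fun _ h => confluentHypergeometric_expansion_regionA ha h,
    fun _ hK hKB => exists_forall_isCompact hK hKB (b₀ := a + 2) (by positivity) 2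
      fun _ h => confluentHypergeometric_expansion_regionB ha h⟩
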